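/- For a finite nonempty simple graph $G$, an edge activity $B$ and an external field $\lambda$, let $$Z_G(B,\lambda)=\sum_{\sigma:V(G)\to\{+,-\}}B^{m_G(\sigma)}\lambda^{n_G(+,\sigma)},$$ where $m_G(\sigma)$ is the number of edges of $G$ whose endpoints get the same spin under $\sigma$ and $n_G(+,\sigma)$ is the number of vertices with spin $+$. The occupancy fraction and the free energy density of $G$ are $$\alpha_G(B,\lambda)=\frac{\lambda}{|V(G)|}\frac{\partial}{\partial\lambda}\log Z_G(B,\lambda),\qquad F_G(B,\lambda)=\frac1{|V(G)|}\log Z_G(B,\lambda).$$ At the single degenerate point $(0,0)$ of the regions below, where $Z_G=0$ for every $3$-regular $G$, both are read as $0$ for every $3$-regular $G$. A graph is said to minimize $\alpha$ (or $F$) at $(B,\lambda)$ if it is $3$-regular and its value is at most that of every finite nonempty simple $3$-regular graph. Let $\mathcal R^{\min}=\bigcup_{i=1}^{8}\mathcal R_i^{\min}$, where 1. $\mathcal R_1^{\min}=\{(B,\lambda):\frac{59}{100}\le B\le 1,\ 0\le\lambda\le\frac{177}{200}B-\frac{267}{1000}B^2\}$, 2. $\mathcal R_2^{\min}=\{(B,\lambda):0\le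 B\le\frac{59}{100},\ 0\le\lambda\le\frac{9}{10}B\}$, 3. $\mathcal R_3^{\min}=\{(B,\lambda):\frac1{10}\le B\le\frac12,\ \frac12B\le\lambda\le\frac{99}{100}B\}$, 4. $\mathcal R_4^{\min}=\{(B,\lambda):\frac12\le B\le\frac9{10},\ \frac3{20}\le\lambda\le\min\{B,\frac{53}{100}\}\}$, 5. $\mathcal R_5^{\min}=\{(B,\lambda):\frac35\le B\le\frac{49}{50},\ \frac7{20}+\frac{11}{50}B\le\lambda\le\frac38+\frac6{25}B\}$, 6. $\mathcal R_6^{\min}=\{(B,\lambda):\frac14\le B\le\frac9{20},\ \frac{49}{50}B\le\lambda\le-\frac{17}{200}+\frac75B\}$, 7. $\mathcal R_7^{\min}=\{(B,\lambda):\frac{56}{125}\le B\le\frac35,\ \frac{99}{100}B\le\lambda\le\frac{133}{200}-\frac{13}{50}B\}$, 8. $\mathcal R_8^{\min}=\{(B,\lambda):\frac{13}{50}\le B\le\frac9{25},\ -\frac3{40}+\frac{34}{25}B\le\lambda\le-\frac9{100}+\frac{36}{25}B\}$. The Goose graph is the $3$-regular graph with vertices $0,\dots,9$ and edges $01,02,12,03,13,24,35,46,47,67,58,68,59,79,89$.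 A region of $[0,1]^2$ means a nonempty connected subset of $[0,1]^2$ that is open in $\mathbb R^2$. **Theorem.** - $K_4$ minimizes the occupancy fraction $\alpha_G(B,\lambda)$ over $3$-regular graphs for every $(B,\lambda)\in\mathcal R^{\min}$. - $\mathcal R^{\min}$ is downward closed in $\lambda$: if $(B,\lambda)\in\mathcal R^{\min}$ and $0\le\ell\le\lambda$, then $(B,\ell)\in\mathcal R^{\min}$. Moreover, $K_4$ minimizes the free energy density $F_G(B,\lambda)$ over $3$-regular graphs for every $(B,\lambda)\in\mathcal R^{\min}$. - $K_4$ does not minimize the occupancy fraction at every point of $[0,1]^2$: there is a region $\mathcal R^{\mathrm{Pet}}$ of $[0,1]^2$ on which the Petersen graph $P$ satisfies $\alpha_P(B,\lambda)<\alpha_{K_4}(B,\lambda)$. - It is also false that at every point of $[0,1]^2$ the occupancy fraction is minimized by $K_4$ or by the Petersen graph: there is a region $\mathcal R^{\mathrm{Goose}}$ of $[0,1]^2$ on which the Goose graph has strictly smaller occupancy fraction than both $K_4$ and the Petersen graph. -/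

import Mathlib

universe u v

section Ising

variable {V : Type u} [Fintype V] [DecidableEq V] (G : SimpleGraph V) [DecidableRel G.Adj]

/-- The number of monochromatic edges of `G` under the spin assignment `σ`, where `true` is the
spin `+` and `false` is the spin `-`. -/
def monoEdges (σ : V → Bool) : ℕ :=
  (G.edgeFinset.filter fun e => (e.map σ).IsDiag).card

/-- The number of vertices that receive the spin `+` under `σ`. -/
def plusCount (σ : V → Bool) : ℕ :=
  (Finset.univ.filter fun x => σ x = true).card

/-- The partition function of the Ising model on `G` with edge activity `B` and external
field `lam`. -/
def isingZ (B lam : ℝ) : ℝ :=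
  ∑ σ : V → Bool, B ^ monoEdges G σ * lam ^ plusCount σ

/-- The occupancy fraction: `lam / |V|` times the partial derivative of `log Z_G` with respect to
the external field. -/
noncomputable def occupancyFraction (B lam : ℝ) : ℝ :=
  lam / (Fintype.card V : ℝ) * deriv (fun l : ℝ => Real.log (isingZ G B l)) lam

/-- The free energy density: `log Z_G` divided by the number of vertices. -/
noncomputable def freeEnergyDensity (B lam : ℝ) : ℝ :=
  1 / (Fintype.card V : ℝ) * Real.log (isingZ G B lam)

end Ising

section Minimizers

variable {W : Type v} [Fintype W] [DecidableEq W] (H : SimpleGraph W) [DecidableRel H.Adj]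

/-- `H` minimizes the occupancy fraction at `(B, lam)` over all finite nonempty (simple)
`3`-regular graphs. -/
def MinimizesOccupancyFraction (B lam : ℝ) : Prop :=
  H.IsRegularOfDegree 3 ∧
    ∀ (V : Type u) [Fintype V] [DecidableEq V] [Nonempty V]
      (G : SimpleGraph V) [DecidableRel G.Adj],
      G.IsRegularOfDegree 3 → occupancyFraction H B lam ≤ occupancyFraction G B lam

/-- `H` minimizes the free energy density at `(B, lam)` over all finite nonempty (simple)
`3`-regular graphs. -/
def MinimizesFreeEnergyDensity (B lam : ℝ) : Prop :=
  H.IsRegularOfDegree 3 ∧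
    ∀ (V : Type u) [Fintype V] [DecidableEq V] [Nonempty V]
      (G : SimpleGraph V) [DecidableRel G.Adj],
      G.IsRegularOfDegree 3 → freeEnergyDensity H B lam ≤ freeEnergyDensity G B lam

end Minimizers

section Graphs

/-- The complete graph on four vertices. -/
abbrev graphK4 : SimpleGraph (Fin 4) := ⊤

/-- The Petersen graph: an outer `5`-cycle on `0, …, 4`, spokes joining `i` to `i + 5`, and an
inner pentagram on `5, …, 9`. -/
abbrev petersenGraph : SimpleGraph (Fin 10) :=
  SimpleGraph.fromEdgeSet (SetLike.coe (
    {s(0, 1), s(1, 2), s(2, 3), s(3, 4), s(4, 0),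
     s(0, 5), s(1, 6), s(2, 7), s(3, 8), s(4, 9),
     s(5, 7), s(7, 9), s(9, 6), s(6, 8), s(8, 5)} : Finset (Sym2 (Fin 10))))

/-- The Goose graph, the graph on ten vertices whose graph6 code consists of the characters
`I`, `}`, `G`, `O`, `O`, `S`, `E`, `@`, `W`. -/
abbrev gooseGraph : SimpleGraph (Fin 10) :=
  SimpleGraph.fromEdgeSet (SetLike.coe (
    {s(0, 1), s(0, 2), s(1, 2), s(0, 3), s(1, 3),
     s(2, 4), s(3, 5), s(4, 6), s(4, 7), s(6, 7),
     s(5, 8), s(6, 8), s(5, 9), s(7, 9), s(8, 9)} : Finset (Sym2 (Fin 10))))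

end Graphs

section Regions

/-! The regions are sets of pairs `(B, lam)`. -/

def minRegion1 : Set (ℝ × ℝ) :=
  {p | 59 / 100 ≤ p.1 ∧ p.1 ≤ 1 ∧ 0 ≤ p.2 ∧ p.2 ≤ 177 / 200 * p.1 - 267 / 1000 * p.1 ^ 2}

def minRegion2 : Set (ℝ × ℝ) :=
  {p | 0 ≤ p.1 ∧ p.1 ≤ 59 / 100 ∧ 0 ≤ p.2 ∧ p.2 ≤ 9 / 10 * p.1}

def minRegion3 : Set (ℝ × ℝ) :=
  {p | 1 / 10 ≤ p.1 ∧ p.1 ≤ 1 / 2 ∧ 1 / 2 * p.1 ≤ p.2 ∧ p.2 ≤ 99 / 100 * p.1}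

def minRegion4 : Set (ℝ × ℝ) :=
  {p | 1 / 2 ≤ p.1 ∧ p.1 ≤ 9 / 10 ∧ 3 / 20 ≤ p.2 ∧ p.2 ≤ min p.1 (53 / 100)}

def minRegion5 : Set (ℝ × ℝ) :=
  {p | 3 / 5 ≤ p.1 ∧ p.1 ≤ 49 / 50 ∧
    7 / 20 + 11 / 50 * p.1 ≤ p.2 ∧ p.2 ≤ 3 / 8 + 6 / 25 * p.1}

def minRegion6 : Set (ℝ × ℝ) :=
  {p | 1 / 4 ≤ p.1 ∧ p.1 ≤ 9 / 20 ∧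
    49 / 50 * p.1 ≤ p.2 ∧ p.2 ≤ -(17 / 200) + 7 / 5 * p.1}

def minRegion7 : Set (ℝ × ℝ) :=
  {p | 56 / 125 ≤ p.1 ∧ p.1 ≤ 3 / 5 ∧
    99 / 100 * p.1 ≤ p.2 ∧ p.2 ≤ 133 / 200 - 13 / 50 * p.1}

def minRegion8 : Set (ℝ × ℝ) :=
  {p | 13 / 50 ≤ p.1 ∧ p.1 ≤ 9 / 25 ∧
    -(3 / 40) + 34 / 25 * p.1 ≤ p.2 ∧ p.2 ≤ -(9 / 100) + 36 / 25 * p.1}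

/-- The union of the eight regions. -/
def minRegion : Set (ℝ × ℝ) :=
  minRegion1 ∪ minRegion2 ∪ minRegion3 ∪ minRegion4 ∪
    minRegion5 ∪ minRegion6 ∪ minRegion7 ∪ minRegion8

/-- The full parameter range `[0,1]²`. -/
def parameterSquare : Set (ℝ × ℝ) := Set.Icc 0 1 ×ˢ Set.Icc 0 1

/-- A region of the parameter range: a nonempty connected open set of parameters. -/
def IsParameterRegion (R : Set (ℝ × ℝ)) : Prop :=
  R ⊆ parameterSquare ∧ IsOpen R ∧ IsConnected R

end Regions

/-! The statements about `K₄` follow from linear programming duality over local views. Draw a spin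
assignment with probability proportional to its weight. The view of a vertex records which of its
three neighbours are adjacent and how many plus spins each neighbour sees from outside the block
formed by the vertex and its neighbours. Given the spins outside the block, the law of its four
spins depends on the view only, because one spin flip changes the weight by a factor determined by
the number of plus neighbours (`isingWeight_update`).

For any function ψ of the number of plus neighbours, three times ψ at a vertex minus the sum of ψ
over its neighbours adds up to zero over a cubic graph. Suppose that the sum of this term and `D (z
· 1[+] - c)`, with `D > 0`, has nonnegative expectation in every view. Averaging over vertices and
assignments then gives that `z` times the expected proportion of plus vertices is at least `c`
(`block_sum_nonneg`, `mean_plusCount_ge`). With `z = centerZ` and `c = centerN` the ratio `c / z` is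
the occupancy fraction of `K₄`, so a suitable pair `D`, ψ proves its minimality.

Up to symmetry there are 23 views. The view in which the block is itself a `K₄` is tight for every
ψ. Constants cancel in the ψ term, so `ψ 3 = 0` may be assumed, and the three remaining values are
chosen to make three further views tight; the problem is homogeneous in `(D, ψ)`, so `D` can absorb
denominators. Each of the other view sums is a visibly nonnegative product, in most cases times a
polynomial in `(B, lam)` whose sign on the region is certified by exact integer arithmetic. One
certificate serves regions 1 to 7, and a second one with other tight views serves region 8.

For the free energy, `lam · ∂F/∂lam` is the occupancy fraction and `F(B, 0) = (3/2) log B` for every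
cubic graph. As the union of the regions is downward closed in `lam`, the occupancy inequality can
be integrated along the vertical segment from field `0`.

The negative statements come from exact evaluation at `(6/25, 3/5)`, where the occupancy fractions
satisfy Goose < 0.46806 < Petersen < 0.46823 < `K₄`. Continuity extends the strict inequalities to a
ball. -/

/-! ### Effect of a single spin flip on the Ising weight -/

section Local

variable {V : Type u} [Fintype V] [DecidableEq V] (G : SimpleGraph V) [DecidableRel G.Adj]

/-- The number of neighbours of `x` that receive the spin `+` under `σ`. -/
def plusNeighbors (σ : V → Bool) (x : V) : ℕ :=
  ((G.neighborFinset x).filter fun y => σ y = true).card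

/-- The weight of a spin assignment in the partition function. -/
def isingWeight (B lam : ℝ) (σ : V → Bool) : ℝ :=
  B ^ monoEdges G σ * lam ^ plusCount σ

theorem incidenceFinset_eq_image (x : V) :
    G.incidenceFinset x = (G.neighborFinset x).image fun y => s(x, y) := by
  ext e
  induction e with
  | _ a b =>
    simp only [SimpleGraph.mem_incidenceFinset, Finset.mem_image, SimpleGraph.mem_neighborFinset,
      SimpleGraph.mk'_mem_incidenceSet_iff]
    constructor
    · rintro ⟨h, rfl | rfl⟩
      · exact ⟨b, h, rfl⟩
      · exact ⟨a, h.symm, Sym2.eq_swap⟩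
    · rintro ⟨y, hy, h⟩
      rcases Sym2.eq_iff.1 h with ⟨rfl, rfl⟩ | ⟨rfl, rfl⟩
      · exact ⟨hy, Or.inl rfl⟩
      · exact ⟨hy.symm, Or.inr rfl⟩

theorem card_filter_incidenceFinset (σ : V → Bool) (x : V) :
    ((G.incidenceFinset x).filter fun e => (e.map σ).IsDiag).card =
      ((G.neighborFinset x).filter fun y => σ x = σ y).card := by
  rw [incidenceFinset_eq_image, Finset.filter_image, Finset.card_image_of_injective]
  · simp
  · exact fun a b h => Sym2.congr_right.1 h

theorem monoEdges_eq_add (σ : V → Bool) (x : V) :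
    monoEdges G σ = ((G.edgeFinset.filter fun e => x ∉ e).filter fun e => (e.map σ).IsDiag).card +
      ((G.neighborFinset x).filter fun y => σ x = σ y).card := by
  rw [← card_filter_incidenceFinset, SimpleGraph.incidenceFinset_eq_filter, monoEdges,
    Finset.filter_filter, Finset.filter_filter, add_comm,
    ← Finset.card_filter_add_card_filter_not (fun e => x ∈ e), Finset.filter_filter,
    Finset.filter_filter]
  simp only [and_comm]

theorem monoEdges_avoiding_update (σ : V → Bool) (x : V) (b : Bool) :
    ((G.edgeFinset.filter fun e => x ∉ e).filter
      fun e => (e.map (Function.update σ x b)).IsDiag) =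
    ((G.edgeFinset.filter fun e => x ∉ e).filter fun e => (e.map σ).IsDiag) := by
  refine Finset.filter_congr fun e he => ?_
  have hx := (Finset.mem_filter.1 he).2
  induction e with
  | _ a c =>
    simp only [Sym2.mem_iff, not_or] at hx
    simp [Function.update_of_ne (Ne.symm hx.1), Function.update_of_ne (Ne.symm hx.2)]

theorem neighbor_update {σ : V → Bool} {x y : V} (b : Bool) (hy : y ∈ G.neighborFinset x) :
    Function.update σ x b y = σ y :=
  Function.update_of_ne (by rintro rfl; simp at hy) _ _

/-- Switching `x` from minus to plus gains the edges to its plus neighbours and loses those to its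
minus neighbours. The change `2k - degree` is written additively because the counts are natural
numbers. -/
theorem monoEdges_update_true (σ : V → Bool) (x : V) :
    monoEdges G (Function.update σ x true) + G.degree x =
      monoEdges G (Function.update σ x false) + 2 * plusNeighbors G σ x := by
  rw [monoEdges_eq_add G _ x, monoEdges_eq_add G (Function.update σ x false) x,
    monoEdges_avoiding_update, monoEdges_avoiding_update]
  have key : ∀ b, ((G.neighborFinset x).filter fun y => Function.update σ x b x =
      Function.update σ x b y) = (G.neighborFinset x).filter fun y => σ y = b := by
    intro b
    refine Finset.filter_congr fun y hy => ?_
    rw [neighbor_update G b hy, Function.update_self, eq_comm]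
  rw [key, key, plusNeighbors, ← SimpleGraph.card_neighborFinset_eq_degree]
  have h := Finset.card_filter_add_card_filter_not (s := G.neighborFinset x)
    (fun y => σ y = true)
  simp only [Bool.not_eq_true] at h
  omega

theorem plusCount_update_true (σ : V → Bool) (x : V) :
    plusCount (Function.update σ x true) = plusCount (Function.update σ x false) + 1 := by
  have h : (Finset.univ.filter fun y => Function.update σ x true y = true) =
      insert x (Finset.univ.filter fun y => Function.update σ x false y = true) := by
    ext y
    by_cases hy : y = x <;> simp [hy, Function.update_of_ne]
  rw [plusCount, h, Finset.card_insert_of_notMem (by simp), plusCount]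

theorem plusNeighbors_update (σ : V → Bool) (x y : V) (b : Bool) :
    plusNeighbors G (Function.update σ x b) y =
      plusNeighbors G (Function.update σ x false) y + (b && decide (G.Adj y x)).toNat := by
  cases b with
  | false => simp
  | true =>
    by_cases h : G.Adj y x
    · have : ((G.neighborFinset y).filter fun z => Function.update σ x true z = true) =
          insert x ((G.neighborFinset y).filter fun z => Function.update σ x false z = true) := by
        ext z
        by_cases hz : z = x
        · subst hz; simp [h]
        · simp [hz, Function.update_of_ne]
      rw [plusNeighbors, this, Finset.card_insert_of_notMem (by simp), plusNeighbors]
      simp [h]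
    · simp only [plusNeighbors, h, decide_false, Bool.and_false, Bool.toNat_false, add_zero]
      congr 1
      refine Finset.filter_congr fun z hz => ?_
      have : z ≠ x := by rintro rfl; exact h (by simpa using hz)
      simp [Function.update_of_ne this]

theorem plusNeighbors_le_degree {V : Type u} [Fintype V] (G : SimpleGraph V) [DecidableRel G.Adj]
    (σ : V → Bool) (x : V) :
    plusNeighbors G σ x ≤ G.degree x := by
  rw [← SimpleGraph.card_neighborFinset_eq_degree]
  exact Finset.card_filter_le _ _

variable {G}

/-- This is the Markov property at one vertex: the plus-to-minus weight ratio is `lam * B ^ (2k -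
3)`, where `k` counts the plus neighbours. The factor `B ^ 3` keeps exponents nonnegative. -/
theorem isingWeight_update (hG : G.IsRegularOfDegree 3) (B lam : ℝ) (σ : V → Bool) (x : V)
    (b : Bool) :
    isingWeight G B lam (Function.update σ x b) * B ^ 3 =
      isingWeight G B lam (Function.update σ x false) *
        (if b then lam * B ^ (2 * plusNeighbors G σ x) else B ^ 3) := by
  cases b with
  | false => simp
  | true =>
    have h := monoEdges_update_true G σ x
    rw [hG x] at h
    have h' : B ^ monoEdges G (Function.update σ x true) * B ^ 3 =
        B ^ monoEdges G (Function.update σ x false) * B ^ (2 * plusNeighbors G σ x) := by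
      rw [← pow_add, ← pow_add, h]
    simp only [isingWeight, plusCount_update_true, pow_succ lam, if_true]
    linear_combination (lam ^ plusCount (Function.update σ x false) * lam) * h'

/-- Resampling one spin hits every assignment exactly twice: one of the two updates leaves `σ`
unchanged and the other flips `x`, which is an involution on assignments. -/
theorem two_mul_sum_eq_sum_update (x : V) (F : (V → Bool) → ℝ) :
    2 * ∑ σ, F σ = ∑ σ : V → Bool, ∑ b, F (Function.update σ x b) := by
  have flip : ∑ σ, F (Function.update σ x (!σ x)) = ∑ σ, F σ := by
    refine Function.Bijective.sum_comp (e := fun σ : V → Bool => Function.update σ x (!σ x)) ?_ F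
    refine Function.Involutive.bijective fun σ => ?_
    simp
  rw [two_mul]
  nth_rw 1 [← flip]
  rw [← Finset.sum_add_distrib]
  refine Finset.sum_congr rfl fun σ _ => ?_
  have h : Function.update σ x (σ x) = σ := Function.update_eq_self x σ
  rw [Fintype.sum_bool]
  cases hx : σ x <;> rw [hx] at h <;> simp [h, add_comm]

end Local

/-! ### Local views and the duality argument -/

section Views

/-- The weight, relative to the all-minus configuration, of the spins `b₀` on a vertex and
`b₁, b₂, b₃` on its neighbours. Here `aᵢⱼ` says whether the neighbours `i` and `j` are adjacent
and `kᵢ` is the number of plus spins seen by neighbour `i` from outside the block. -/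
def viewWeight (B lam : ℝ) (a₁₂ a₁₃ a₂₃ : Bool) (k₁ k₂ k₃ : ℕ) (b₀ b₁ b₂ b₃ : Bool) : ℝ :=
  (if b₀ then lam else B ^ 3) *
    (if b₁ then lam * B ^ (2 * (k₁ + b₀.toNat)) else B ^ 3) *
    (if b₂ then lam * B ^ (2 * (k₂ + b₀.toNat + (b₁ && a₁₂).toNat)) else B ^ 3) *
    (if b₃ then lam * B ^ (2 * (k₃ + b₀.toNat + (b₁ && a₁₃).toNat + (b₂ && a₂₃).toNat))
      else B ^ 3)

/-- The local functional: the excess `D (z · 1[b₀ = +] - c)` of the occupation of the centre,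
plus the difference between the potential `ψ` at the centre and its average at the neighbours. -/
def viewValue (D z c : ℝ) (ψ : ℕ → ℝ) (a₁₂ a₁₃ a₂₃ : Bool) (k₁ k₂ k₃ : ℕ)
    (b₀ b₁ b₂ b₃ : Bool) : ℝ :=
  D * ((if b₀ then z else 0) - c) + (3 * ψ (b₁.toNat + b₂.toNat + b₃.toNat) -
    (ψ (k₁ + b₀.toNat + (b₂ && a₁₂).toNat + (b₃ && a₁₃).toNat) +
      ψ (k₂ + b₀.toNat + (b₁ && a₁₂).toNat + (b₃ && a₂₃).toNat) +
      ψ (k₃ + b₀.toNat + (b₁ && a₁₃).toNat + (b₂ && a₂₃).toNat)))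

/-- The unnormalized expectation of `viewValue` in a given local view. -/
def viewSum (B lam D z c : ℝ) (ψ : ℕ → ℝ) (a₁₂ a₁₃ a₂₃ : Bool) (k₁ k₂ k₃ : ℕ) : ℝ :=
  ∑ b₀, ∑ b₁, ∑ b₂, ∑ b₃, viewWeight B lam a₁₂ a₁₃ a₂₃ k₁ k₂ k₃ b₀ b₁ b₂ b₃ *
    viewValue D z c ψ a₁₂ a₁₃ a₂₃ k₁ k₂ k₃ b₀ b₁ b₂ b₃

/-- The local functional has nonnegative expectation in every local view of a cubic graph. -/
def ViewsNonneg (B lam D z c : ℝ) (ψ : ℕ → ℝ) : Prop :=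
  ∀ (a₁₂ a₁₃ a₂₃ : Bool) (k₁ k₂ k₃ : ℕ),
    k₁ + a₁₂.toNat + a₁₃.toNat ≤ 2 → k₂ + a₁₂.toNat + a₂₃.toNat ≤ 2 →
    k₃ + a₁₃.toNat + a₂₃.toNat ≤ 2 → 0 ≤ viewSum B lam D z c ψ a₁₂ a₁₃ a₂₃ k₁ k₂ k₃

variable {V : Type u} [Fintype V] [DecidableEq V] {G : SimpleGraph V} [DecidableRel G.Adj]

theorem isingWeight_update_of_minus (hG : G.IsRegularOfDegree 3) (B lam : ℝ) {σ : V → Bool}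
    {x : V} (hx : σ x = false) (b : Bool) :
    isingWeight G B lam (Function.update σ x b) * B ^ 3 =
      isingWeight G B lam σ * (if b then lam * B ^ (2 * plusNeighbors G σ x) else B ^ 3) := by
  rw [isingWeight_update hG]
  congr 2
  rw [← hx, Function.update_eq_self]

theorem plusNeighbors_update_of_minus (σ : V → Bool) {x : V} (hx : σ x = false) (y : V)
    (b : Bool) :
    plusNeighbors G (Function.update σ x b) y =
      plusNeighbors G σ y + (b && decide (G.Adj y x)).toNat := by
  rw [plusNeighbors_update]
  congr 2
  rw [← hx, Function.update_eq_self]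

/-- The local functional evaluated at the vertex `x` under the spin assignment `σ`. -/
def vertexValue (G : SimpleGraph V) [DecidableRel G.Adj] (D z c : ℝ) (ψ : ℕ → ℝ) (σ : V → Bool)
    (x : V) : ℝ :=
  D * ((if σ x then z else 0) - c) + (3 * ψ (plusNeighbors G σ x) -
    ∑ y ∈ G.neighborFinset x, ψ (plusNeighbors G σ y))

theorem sixteen_mul_sum_eq (v₀ v₁ v₂ v₃ : V) (F : (V → Bool) → ℝ) :
    16 * ∑ σ, F σ = ∑ σ : V → Bool, ∑ b₀, ∑ b₁, ∑ b₂, ∑ b₃, F (Function.update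
      (Function.update (Function.update (Function.update σ v₀ b₀) v₁ b₁) v₂ b₂) v₃ b₃) := by
  rw [← two_mul_sum_eq_sum_update v₀ (fun σ => ∑ b₁, ∑ b₂, ∑ b₃, F (Function.update
      (Function.update (Function.update σ v₁ b₁) v₂ b₂) v₃ b₃)),
    ← two_mul_sum_eq_sum_update v₁ (fun σ => ∑ b₂, ∑ b₃, F (Function.update
      (Function.update σ v₂ b₂) v₃ b₃)),
    ← two_mul_sum_eq_sum_update v₂ (fun σ => ∑ b₃, F (Function.update σ v₃ b₃)),
    ← two_mul_sum_eq_sum_update v₃]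
  ring

/-- Starting from a block of minus spins, the four spins are set one after another. Each update
contributes one factor of `viewWeight` and one factor `B ^ 3` on the other side, so the block sum
times `B ^ 12` is the weight of `σ` times a `viewSum`. -/
theorem block_sum_nonneg (hG : G.IsRegularOfDegree 3) {B lam D z c : ℝ} {ψ : ℕ → ℝ}
    (hB : 0 < B) (hlam : 0 ≤ lam) (h : ViewsNonneg B lam D z c ψ) {v₀ v₁ v₂ v₃ : V}
    (h₁₂ : v₁ ≠ v₂) (h₁₃ : v₁ ≠ v₃) (h₂₃ : v₂ ≠ v₃)
    (hN : G.neighborFinset v₀ = {v₁, v₂, v₃}) {σ : V → Bool}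
    (s₀ : σ v₀ = false) (s₁ : σ v₁ = false) (s₂ : σ v₂ = false) (s₃ : σ v₃ = false) :
    0 ≤ ∑ b₀, ∑ b₁, ∑ b₂, ∑ b₃, (fun τ => isingWeight G B lam τ * vertexValue G D z c ψ τ v₀)
      (Function.update (Function.update (Function.update (Function.update σ v₀ b₀) v₁ b₁) v₂ b₂)
        v₃ b₃) := by
  have adj : ∀ y, G.Adj v₀ y ↔ y = v₁ ∨ y = v₂ ∨ y = v₃ := fun y => by
    rw [← SimpleGraph.mem_neighborFinset, hN]; simp
  have a₁ : G.Adj v₀ v₁ := (adj _).2 (by simp)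
  have a₂ : G.Adj v₀ v₂ := (adj _).2 (by simp)
  have a₃ : G.Adj v₀ v₃ := (adj _).2 (by simp)
  have n₁ := a₁.ne
  have n₂ := a₂.ne
  have n₃ := a₃.ne
  have k₀ : plusNeighbors G σ v₀ = 0 := by
    simp [plusNeighbors, hN, Finset.filter_insert, Finset.filter_singleton, s₁, s₂, s₃]
  set k₁ := plusNeighbors G σ v₁ with hk₁
  set k₂ := plusNeighbors G σ v₂ with hk₂
  set k₃ := plusNeighbors G σ v₃ with hk₃
  set a₁₂ := decide (G.Adj v₁ v₂) with ha₁₂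
  set a₁₃ := decide (G.Adj v₁ v₃) with ha₁₃
  set a₂₃ := decide (G.Adj v₂ v₃) with ha₂₃
  have c₁₂ : decide (G.Adj v₂ v₁) = a₁₂ := by rw [ha₁₂]; simp [G.adj_comm]
  have c₁₃ : decide (G.Adj v₃ v₁) = a₁₃ := by rw [ha₁₃]; simp [G.adj_comm]
  have c₂₃ : decide (G.Adj v₃ v₂) = a₂₃ := by rw [ha₂₃]; simp [G.adj_comm]
  have count : ∀ b₀ b₁ b₂ b₃ y, plusNeighbors G (Function.update (Function.update
      (Function.update (Function.update σ v₀ b₀) v₁ b₁) v₂ b₂) v₃ b₃) y =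
      plusNeighbors G σ y + (b₀ && decide (G.Adj y v₀)).toNat +
        (b₁ && decide (G.Adj y v₁)).toNat + (b₂ && decide (G.Adj y v₂)).toNat +
        (b₃ && decide (G.Adj y v₃)).toNat := by
    intro b₀ b₁ b₂ b₃ y
    rw [plusNeighbors_update_of_minus, plusNeighbors_update_of_minus,
      plusNeighbors_update_of_minus, plusNeighbors_update_of_minus _ s₀]
    all_goals simp [Function.update_of_ne, *, Ne.symm]
  have weight : ∀ b₀ b₁ b₂ b₃, isingWeight G B lam (Function.update (Function.update
      (Function.update (Function.update σ v₀ b₀) v₁ b₁) v₂ b₂) v₃ b₃) * B ^ 12 =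
      isingWeight G B lam σ * viewWeight B lam a₁₂ a₁₃ a₂₃ k₁ k₂ k₃ b₀ b₁ b₂ b₃ := by
    intro b₀ b₁ b₂ b₃
    have e₀ := isingWeight_update_of_minus hG B lam s₀ b₀
    have e₁ := isingWeight_update_of_minus hG B lam
      (σ := Function.update σ v₀ b₀) (x := v₁) (by simp [*, Ne.symm]) b₁
    have e₂ := isingWeight_update_of_minus hG B lam
      (σ := Function.update (Function.update σ v₀ b₀) v₁ b₁) (x := v₂) (by simp [*, Ne.symm]) b₂
    have e₃ := isingWeight_update_of_minus hG B lam
      (σ := Function.update (Function.update (Function.update σ v₀ b₀) v₁ b₁) v₂ b₂) (x := v₃)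
      (by simp [*, Ne.symm]) b₃
    have f₁ : plusNeighbors G (Function.update σ v₀ b₀) v₁ = k₁ + b₀.toNat := by
      rw [plusNeighbors_update_of_minus _ s₀, ← hk₁]
      simp [a₁.symm]
    have f₂ : plusNeighbors G (Function.update (Function.update σ v₀ b₀) v₁ b₁) v₂ =
        k₂ + b₀.toNat + (b₁ && a₁₂).toNat := by
      rw [plusNeighbors_update_of_minus _ (by simp [*, Ne.symm]),
        plusNeighbors_update_of_minus _ s₀, ← hk₂, c₁₂]
      simp [a₂.symm]
    have f₃ : plusNeighbors G (Function.update (Function.update (Function.update σ v₀ b₀) v₁ b₁)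
        v₂ b₂) v₃ = k₃ + b₀.toNat + (b₁ && a₁₃).toNat + (b₂ && a₂₃).toNat := by
      rw [plusNeighbors_update_of_minus _ (by simp [*, Ne.symm]),
        plusNeighbors_update_of_minus _ (by simp [*, Ne.symm]),
        plusNeighbors_update_of_minus _ s₀, ← hk₃, c₁₃, c₂₃]
      simp [a₃.symm]
    rw [k₀, mul_zero, pow_zero, mul_one] at e₀
    rw [f₁] at e₁
    rw [f₂] at e₂
    rw [f₃] at e₃
    rw [viewWeight]
    generalize (if b₀ = true then lam else B ^ 3) = g₀ at *
    generalize (if b₁ = true then lam * B ^ (2 * (k₁ + b₀.toNat)) else B ^ 3) = g₁ at *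
    generalize (if b₂ = true then lam * B ^ (2 * (k₂ + b₀.toNat + (b₁ && a₁₂).toNat))
      else B ^ 3) = g₂ at *
    generalize (if b₃ = true then lam * B ^ (2 * (k₃ + b₀.toNat + (b₁ && a₁₃).toNat +
      (b₂ && a₂₃).toNat)) else B ^ 3) = g₃ at *
    -- The four one-spin identities telescope: each is multiplied by the factors of the later
    -- updates and by the `B ^ 3` of the earlier ones.
    linear_combination B ^ 9 * e₃ + B ^ 6 * g₃ * e₂ + B ^ 3 * g₃ * g₂ * e₁ + g₃ * g₂ * g₁ * e₀
  have value : ∀ b₀ b₁ b₂ b₃, vertexValue G D z c ψ (Function.update (Function.update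
      (Function.update (Function.update σ v₀ b₀) v₁ b₁) v₂ b₂) v₃ b₃) v₀ =
      viewValue D z c ψ a₁₂ a₁₃ a₂₃ k₁ k₂ k₃ b₀ b₁ b₂ b₃ := by
    intro b₀ b₁ b₂ b₃
    have center : Function.update (Function.update (Function.update (Function.update σ v₀ b₀)
        v₁ b₁) v₂ b₂) v₃ b₃ v₀ = b₀ := by simp [*]
    rw [vertexValue, center, hN, Finset.sum_insert (by simp [h₁₂, h₁₃]),
      Finset.sum_insert (by simp [h₂₃]), Finset.sum_singleton, count, count, count, count,
      c₁₂, c₁₃, c₂₃, ← hk₁, ← hk₂, ← hk₃, k₀, ← ha₁₂, ← ha₁₃, ← ha₂₃]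
    simp [a₁, a₂, a₃, a₁.symm, a₂.symm, a₃.symm, viewValue, add_assoc]
  -- With the whole block plus, a neighbour sees its outside plus spins, the centre and its adjacent
  -- fellow neighbours. The total is at most its degree `3`, which gives the constraints on `kᵢ` in
  -- `ViewsNonneg`.
  have bound : ∀ y, plusNeighbors G (Function.update (Function.update
      (Function.update (Function.update σ v₀ true) v₁ true) v₂ true) v₃ true) y ≤ 3 := fun y =>
    (plusNeighbors_le_degree G _ y).trans (hG y).le
  have b₁ := bound v₁
  have b₂ := bound v₂
  have b₃ := bound v₃
  simp only [count, c₁₂, c₁₃, c₂₃, ← hk₁, ← hk₂, ← hk₃, ← ha₁₂, ← ha₁₃, ← ha₂₃, a₁.symm,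
    a₂.symm, a₃.symm, SimpleGraph.irrefl, decide_true, decide_false, Bool.true_and,
    Bool.toNat_true, Bool.toNat_false, add_zero] at b₁ b₂ b₃
  have hv := h a₁₂ a₁₃ a₂₃ k₁ k₂ k₃ (by omega) (by omega) (by omega)
  have hw : 0 ≤ isingWeight G B lam σ := mul_nonneg (pow_nonneg hB.le _) (pow_nonneg hlam _)
  refine nonneg_of_mul_nonneg_left (b := B ^ 12) ?_ (by positivity)
  have e : (∑ b₀, ∑ b₁, ∑ b₂, ∑ b₃, (fun τ => isingWeight G B lam τ *
      vertexValue G D z c ψ τ v₀) (Function.update (Function.update (Function.update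
        (Function.update σ v₀ b₀) v₁ b₁) v₂ b₂) v₃ b₃)) * B ^ 12 =
      isingWeight G B lam σ * viewSum B lam D z c ψ a₁₂ a₁₃ a₂₃ k₁ k₂ k₃ := by
    simp only [viewSum, Finset.sum_mul, Finset.mul_sum, value]
    refine Finset.sum_congr rfl fun b₀ _ => Finset.sum_congr rfl fun b₁ _ =>
      Finset.sum_congr rfl fun b₂ _ => Finset.sum_congr rfl fun b₃ _ => ?_
    rw [mul_right_comm, weight, mul_assoc]
  rw [e]
  exact mul_nonneg hw hv

theorem sum_vertexValue_nonneg (hG : G.IsRegularOfDegree 3) {B lam D z c : ℝ} {ψ : ℕ → ℝ}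
    (hB : 0 < B) (hlam : 0 ≤ lam) (h : ViewsNonneg B lam D z c ψ) (x : V) :
    0 ≤ ∑ σ, isingWeight G B lam σ * vertexValue G D z c ψ σ x := by
  have hcard : (G.neighborFinset x).card = 3 := by
    rw [SimpleGraph.card_neighborFinset_eq_degree, hG x]
  obtain ⟨v₁, v₂, v₃, h₁₂, h₁₃, h₂₃, hN⟩ := Finset.card_eq_three.1 hcard
  have h16 := sixteen_mul_sum_eq x v₁ v₂ v₃
    (fun σ => isingWeight G B lam σ * vertexValue G D z c ψ σ x)
  refine nonneg_of_mul_nonneg_right (a := 16) ?_ (by norm_num)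
  rw [h16]
  refine Finset.sum_nonneg fun σ _ => ?_
  -- The block spins of `σ` are overwritten in every summand, so they may be reset to minus first.
  have hb := block_sum_nonneg hG hB hlam h h₁₂ h₁₃ h₂₃ hN (σ := Function.update (Function.update
    (Function.update (Function.update σ x false) v₁ false) v₂ false) v₃ false)
    (by simp [Function.update_apply]) (by simp [Function.update_apply])
    (by simp [Function.update_apply]) (by simp)
  have overwrite : ∀ b₀ b₁ b₂ b₃, Function.update (Function.update (Function.update
      (Function.update (Function.update (Function.update
    (Function.update (Function.update σ x false) v₁ false) v₂ false) v₃ false) x b₀) v₁ b₁) v₂ b₂)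
      v₃ b₃ = Function.update (Function.update (Function.update
      (Function.update σ x b₀) v₁ b₁) v₂ b₂) v₃ b₃ := by
    intro b₀ b₁ b₂ b₃
    funext y
    simp only [Function.update_apply]
    split_ifs <;> rfl
  simpa only [overwrite] using hb

/-- Double counting: each vertex is a neighbour of exactly three others. -/
theorem sum_sum_neighborFinset {V : Type u} [Fintype V] {G : SimpleGraph V} [DecidableRel G.Adj]
    (hG : G.IsRegularOfDegree 3) (f : V → ℝ) :
    ∑ x, ∑ y ∈ G.neighborFinset x, f y = 3 * ∑ x, f x := by
  have : ∀ x, ∑ y ∈ G.neighborFinset x, f y = ∑ y, if G.Adj x y then f y else 0 := by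
    intro x
    rw [SimpleGraph.neighborFinset_eq_filter, Finset.sum_filter]
  simp_rw [this]
  rw [Finset.sum_comm, Finset.mul_sum]
  refine Finset.sum_congr rfl fun y _ => ?_
  rw [← Finset.sum_filter, Finset.sum_const, nsmul_eq_mul]
  congr 1
  have : (Finset.univ.filter fun x => G.Adj x y) = G.neighborFinset y := by
    ext x; simp [G.adj_comm]
  rw [this, SimpleGraph.card_neighborFinset_eq_degree, hG y]
  norm_num

theorem sum_vertexValue {V : Type u} [Fintype V] {G : SimpleGraph V} [DecidableRel G.Adj]
    (hG : G.IsRegularOfDegree 3) (D z c : ℝ) (ψ : ℕ → ℝ) (σ : V → Bool) :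
    ∑ x, vertexValue G D z c ψ σ x = D * (z * plusCount σ - c * Fintype.card V) := by
  simp only [vertexValue, Finset.sum_add_distrib, Finset.sum_sub_distrib, ← Finset.mul_sum,
    sum_sum_neighborFinset hG, sub_self, add_zero]
  congr 2
  · rw [← Finset.sum_filter, Finset.sum_const, nsmul_eq_mul, plusCount, mul_comm]
  · simp [mul_comm]

/-- Weak duality. Summed over all vertices the potential cancels pointwise in `σ`, leaving only the
occupation term, and the positive multiplier `D` can be divided out. -/
theorem mean_plusCount_ge (hG : G.IsRegularOfDegree 3) {B lam D z c : ℝ} {ψ : ℕ → ℝ}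
    (hB : 0 < B) (hlam : 0 ≤ lam) (hD : 0 < D) (h : ViewsNonneg B lam D z c ψ) :
    c * (Fintype.card V * isingZ G B lam) ≤ z * ∑ σ, isingWeight G B lam σ * plusCount σ := by
  have hs := Finset.sum_nonneg fun x (_ : x ∈ Finset.univ) =>
    sum_vertexValue_nonneg hG hB hlam h x
  rw [Finset.sum_comm] at hs
  simp_rw [← Finset.mul_sum, sum_vertexValue hG] at hs
  have hZ : isingZ G B lam = ∑ σ, isingWeight G B lam σ := rfl
  have e : ∑ σ, isingWeight G B lam σ * (D * (z * plusCount σ - c * Fintype.card V)) =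
      D * (z * (∑ σ, isingWeight G B lam σ * plusCount σ) -
        c * (Fintype.card V * isingZ G B lam)) := by
    rw [hZ, Finset.mul_sum, Finset.mul_sum, Finset.mul_sum, ← Finset.sum_sub_distrib,
      Finset.mul_sum]
    exact Finset.sum_congr rfl fun σ _ => by ring
  rw [e] at hs
  linarith [nonneg_of_mul_nonneg_right hs hD]

end Views

/-! ### Symmetries and explicit expansions of the 23 view sums -/

section ViewExpansions

/-- The factors of `viewWeight` depend on the order in which spins are set, but their product does
not: an adjacent pair of plus neighbours contributes `B ^ 2` once in either order. -/
theorem viewSum_swap₁₂ (B lam D z c : ℝ) (ψ : ℕ → ℝ) (a₁₂ a₁₃ a₂₃ : Bool) (k₁ k₂ k₃ : ℕ) :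
    viewSum B lam D z c ψ a₁₂ a₁₃ a₂₃ k₁ k₂ k₃ = viewSum B lam D z c ψ a₁₂ a₂₃ a₁₃ k₂ k₁ k₃ := by
  unfold viewSum
  refine Finset.sum_congr rfl fun b₀ _ => ?_
  rw [Finset.sum_comm]
  refine Finset.sum_congr rfl fun b₂ _ => Finset.sum_congr rfl fun b₁ _ =>
    Finset.sum_congr rfl fun b₃ _ => ?_
  congr 1
  · cases b₁ <;> cases b₂ <;> cases b₃ <;> simp [viewWeight] <;> ring_nf
  · simp only [viewValue]
    ring_nf

theorem viewSum_swap₂₃ (B lam D z c : ℝ) (ψ : ℕ → ℝ) (a₁₂ a₁₃ a₂₃ : Bool) (k₁ k₂ k₃ : ℕ) :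
    viewSum B lam D z c ψ a₁₂ a₁₃ a₂₃ k₁ k₂ k₃ = viewSum B lam D z c ψ a₁₃ a₁₂ a₂₃ k₁ k₃ k₂ := by
  unfold viewSum
  refine Finset.sum_congr rfl fun b₀ _ => Finset.sum_congr rfl fun b₁ _ => ?_
  rw [Finset.sum_comm]
  refine Finset.sum_congr rfl fun b₃ _ => Finset.sum_congr rfl fun b₂ _ => ?_
  congr 1
  · cases b₁ <;> cases b₂ <;> cases b₃ <;> simp [viewWeight] <;> ring_nf
  · simp only [viewValue]
    ring_nf

variable (B lam D z c : ℝ) (ψ : ℕ → ℝ)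

/-- In the names of the expansions, Star means no adjacent neighbours, Edge only `1 ~ 2`, Path `1 ~
2 ~ 3`, and Triangle all pairs; the digits are `k₁`, `k₂`, `k₃`. A power of `B` is taken out, and
the bracket is linear in `D` and the values of ψ. -/
theorem viewSumStar000 : viewSum B lam D z c ψ false false false 0 0 0 =
    B ^ 3 * (D * (z * (B ^ 3 * lam ^ 4 + 3 * B ^ 4 * lam ^ 3 + 3 * B ^ 5 * lam ^ 2 + B ^ 6 * lam)
    - c * (lam ^ 3 + 3 * B ^ 3 * lam ^ 2 + B ^ 3 * lam ^ 4 + 3 * B ^ 4 * lam ^ 3 + 3 * B ^ 5 *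
    lam ^ 2 + 4 * B ^ 6 * lam + B ^ 9)) + ψ 0 * (-3 * lam ^ 3 - 9 * B ^ 3 * lam ^ 2 - 6 * B ^ 6 *
    lam) + ψ 1 * (-3 * B ^ 3 * lam ^ 4 - 9 * B ^ 4 * lam ^ 3 + 6 * B ^ 6 * lam) + ψ 2 * (9 * B ^
    3 * lam ^ 2 + 9 * B ^ 4 * lam ^ 3) + ψ 3 * (3 * lam ^ 3 + 3 * B ^ 3 * lam ^ 4)) := by
  simp [viewSum, viewWeight, viewValue]
  ring

theorem viewSumStar001 : viewSum B lam D z c ψ false false false 0 0 1 =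
    B ^ 5 * (D * (z * (B ^ 2 * lam ^ 3 + 2 * B ^ 3 * lam ^ 2 + B ^ 3 * lam ^ 4 + B ^ 4 * lam + 2
    * B ^ 4 * lam ^ 3 + B ^ 5 * lam ^ 2) - c * (lam ^ 3 + B * lam ^ 2 + B ^ 2 * lam ^ 3 + 4 * B ^
    3 * lam ^ 2 + B ^ 3 * lam ^ 4 + 3 * B ^ 4 * lam + 2 * B ^ 4 * lam ^ 3 + B ^ 5 * lam ^ 2 + B ^
    6 * lam + B ^ 7)) + ψ 0 * (-2 * lam ^ 3 - 2 * B * lam ^ 2 - 4 * B ^ 3 * lam ^ 2 - B ^ 4 * lam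
    - 2 * B ^ 6 * lam + B ^ 7) + ψ 1 * (-lam ^ 3 - B * lam ^ 2 - 2 * B ^ 2 * lam ^ 3 - 2 * B ^ 3
    * lam ^ 4 + 2 * B ^ 4 * lam - 4 * B ^ 4 * lam ^ 3 + B ^ 5 * lam ^ 2 + 2 * B ^ 6 * lam - B ^
    7) + ψ 2 * (3 * B * lam ^ 2 + 2 * B ^ 2 * lam ^ 3 + 4 * B ^ 3 * lam ^ 2 - B ^ 3 * lam ^ 4 - B
    ^ 4 * lam + 4 * B ^ 4 * lam ^ 3 - B ^ 5 * lam ^ 2) + ψ 3 * (3 * lam ^ 3 + 3 * B ^ 3 * lam ^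
    4)) := by
  simp [viewSum, viewWeight, viewValue]
  ring

theorem viewSumStar002 : viewSum B lam D z c ψ false false false 0 0 2 =
    B ^ 6 * (D * (z * (B * lam ^ 3 + 2 * B ^ 2 * lam ^ 2 + B ^ 3 * lam + B ^ 4 * lam ^ 4 + 2 * B
    ^ 5 * lam ^ 3 + B ^ 6 * lam ^ 2) - c * (lam ^ 2 + 2 * B * lam ^ 3 + 2 * B ^ 2 * lam ^ 2 + 3 *
    B ^ 3 * lam + 2 * B ^ 4 * lam ^ 2 + B ^ 4 * lam ^ 4 + 2 * B ^ 5 * lam ^ 3 + B ^ 6 + B ^ 6 *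
    lam ^ 2 + B ^ 7 * lam)) + ψ 0 * (-2 * lam ^ 2 - 2 * B * lam ^ 3 - B ^ 3 * lam - 4 * B ^ 4 *
    lam ^ 2 + B ^ 6 - 2 * B ^ 7 * lam) + ψ 1 * (-2 * B * lam ^ 3 + 2 * B ^ 2 * lam ^ 2 + 4 * B ^
    3 * lam - 2 * B ^ 4 * lam ^ 4 - 4 * B ^ 5 * lam ^ 3 + B ^ 6 * lam ^ 2 + 3 * B ^ 7 * lam) + ψ
    2 * (2 * lam ^ 2 + 2 * B * lam ^ 3 - 2 * B ^ 3 * lam + 4 * B ^ 4 * lam ^ 2 + 6 * B ^ 5 * lam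
    ^ 3 - B ^ 6 - B ^ 7 * lam) + ψ 3 * (2 * B * lam ^ 3 - 2 * B ^ 2 * lam ^ 2 - B ^ 3 * lam + 2 *
    B ^ 4 * lam ^ 4 - 2 * B ^ 5 * lam ^ 3 - B ^ 6 * lam ^ 2)) := by
  simp [viewSum, viewWeight, viewValue]
  ring

theorem viewSumStar011 : viewSum B lam D z c ψ false false false 0 1 1 =
    B ^ 7 * (D * (z * (B * lam ^ 2 + B ^ 2 * lam + 2 * B ^ 2 * lam ^ 3 + 2 * B ^ 3 * lam ^ 2 + B
    ^ 3 * lam ^ 4 + B ^ 4 * lam ^ 3) - c * (lam ^ 3 + 3 * B * lam ^ 2 + 2 * B ^ 2 * lam + 2 * B ^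
    2 * lam ^ 3 + 3 * B ^ 3 * lam ^ 2 + B ^ 3 * lam ^ 4 + 2 * B ^ 4 * lam + B ^ 4 * lam ^ 3 + B ^
    5)) + ψ 0 * (-lam ^ 3 - 2 * B * lam ^ 2 + 2 * B ^ 2 * lam - B ^ 3 * lam ^ 2 - 2 * B ^ 4 * lam
    + 2 * B ^ 5) + ψ 1 * (-2 * lam ^ 3 - 2 * B * lam ^ 2 - 2 * B ^ 2 * lam ^ 3 + 2 * B ^ 3 * lam
    ^ 2 - B ^ 3 * lam ^ 4 + 2 * B ^ 4 * lam - B ^ 4 * lam ^ 3 - 2 * B ^ 5) + ψ 2 * (4 * B * lam ^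
    2 - 2 * B ^ 2 * lam + 2 * B ^ 2 * lam ^ 3 - B ^ 3 * lam ^ 2 - 2 * B ^ 3 * lam ^ 4 + B ^ 4 *
    lam ^ 3) + ψ 3 * (3 * lam ^ 3 + 3 * B ^ 3 * lam ^ 4)) := by
  simp [viewSum, viewWeight, viewValue]
  ring

theorem viewSumStar012 : viewSum B lam D z c ψ false false false 0 1 2 =
    B ^ 8 * (D * (z * (lam ^ 2 + B * lam + B * lam ^ 3 + B ^ 2 * lam ^ 2 + B ^ 3 * lam ^ 3 + B ^
    4 * lam ^ 2 + B ^ 4 * lam ^ 4 + B ^ 5 * lam ^ 3) - c * (2 * lam ^ 2 + 2 * B * lam + 2 * B *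
    lam ^ 3 + 2 * B ^ 2 * lam ^ 2 + B ^ 3 * lam + B ^ 3 * lam ^ 3 + B ^ 4 + 2 * B ^ 4 * lam ^ 2 +
    B ^ 4 * lam ^ 4 + B ^ 5 * lam + B ^ 5 * lam ^ 3)) + ψ 0 * (-lam ^ 2 + 2 * B * lam - B * lam ^
    3 - B ^ 2 * lam ^ 2 - B ^ 3 * lam + 2 * B ^ 4 - B ^ 4 * lam ^ 2 - B ^ 5 * lam) + ψ 1 * (lam ^
    2 + B * lam - 2 * B * lam ^ 3 + B ^ 2 * lam ^ 2 + 2 * B ^ 3 * lam - B ^ 3 * lam ^ 3 - B ^ 4 +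
    B ^ 4 * lam ^ 2 - B ^ 4 * lam ^ 4 + 2 * B ^ 5 * lam - B ^ 5 * lam ^ 3) + ψ 2 * (lam ^ 2 - 2 *
    B * lam + B * lam ^ 3 + B ^ 2 * lam ^ 2 - B ^ 3 * lam + 2 * B ^ 3 * lam ^ 3 - B ^ 4 + B ^ 4 *
    lam ^ 2 - B ^ 4 * lam ^ 4 - B ^ 5 * lam + 2 * B ^ 5 * lam ^ 3) + ψ 3 * (-lam ^ 2 - B * lam +
    2 * B * lam ^ 3 - B ^ 2 * lam ^ 2 - B ^ 3 * lam ^ 3 - B ^ 4 * lam ^ 2 + 2 * B ^ 4 * lam ^ 4 -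
    B ^ 5 * lam ^ 3)) := by
  simp [viewSum, viewWeight, viewValue]
  ring

theorem viewSumStar022 : viewSum B lam D z c ψ false false false 0 2 2 =
    B ^ 8 * (D * (z * (lam ^ 2 + B * lam + 2 * B ^ 3 * lam ^ 3 + 2 * B ^ 4 * lam ^ 2 + B ^ 6 *
    lam ^ 4 + B ^ 7 * lam ^ 3) - c * (lam ^ 2 + 2 * B * lam + 2 * B ^ 2 * lam ^ 2 + 3 * B ^ 3 *
    lam ^ 3 + B ^ 4 + 2 * B ^ 4 * lam ^ 2 + 2 * B ^ 5 * lam + B ^ 6 * lam ^ 2 + B ^ 6 * lam ^ 4 +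
    B ^ 7 * lam ^ 3)) + ψ 0 * (2 * B * lam - 2 * B ^ 2 * lam ^ 2 - B ^ 3 * lam ^ 3 + 2 * B ^ 4 -
    2 * B ^ 5 * lam - B ^ 6 * lam ^ 2) + ψ 1 * (2 * lam ^ 2 + 2 * B * lam - 2 * B ^ 3 * lam ^ 3 +
    4 * B ^ 4 * lam ^ 2 + 6 * B ^ 5 * lam - B ^ 6 * lam ^ 4 - B ^ 7 * lam ^ 3) + ψ 2 * (-2 * B *
    lam + 2 * B ^ 2 * lam ^ 2 + 4 * B ^ 3 * lam ^ 3 - 2 * B ^ 4 - 4 * B ^ 5 * lam + B ^ 6 * lam ^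
    2 + 3 * B ^ 7 * lam ^ 3) + ψ 3 * (-2 * lam ^ 2 - 2 * B * lam - B ^ 3 * lam ^ 3 - 4 * B ^ 4 *
    lam ^ 2 + B ^ 6 * lam ^ 4 - 2 * B ^ 7 * lam ^ 3)) := by
  simp [viewSum, viewWeight, viewValue]
  ring

theorem viewSumStar111 : viewSum B lam D z c ψ false false false 1 1 1 =
    B ^ 9 * (D * (z * (lam + 3 * B * lam ^ 2 + 3 * B ^ 2 * lam ^ 3 + B ^ 3 * lam ^ 4) - c * (lam
    + lam ^ 3 + 6 * B * lam ^ 2 + 3 * B ^ 2 * lam + 3 * B ^ 2 * lam ^ 3 + B ^ 3 + B ^ 3 * lam ^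
    4)) + ψ 0 * (3 * lam + 3 * B ^ 3) + ψ 1 * (-3 * lam ^ 3 - 3 * B ^ 3) + ψ 2 * (-3 * lam - 3 *
    B ^ 3 * lam ^ 4) + ψ 3 * (3 * lam ^ 3 + 3 * B ^ 3 * lam ^ 4)) := by
  simp [viewSum, viewWeight, viewValue]
  ring

theorem viewSumStar112 : viewSum B lam D z c ψ false false false 1 1 2 =
    B ^ 9 * (D * (z * (lam + 2 * B * lam ^ 2 + B ^ 2 * lam ^ 3 + B ^ 3 * lam ^ 2 + 2 * B ^ 4 *
    lam ^ 3 + B ^ 5 * lam ^ 4) - c * (lam + 3 * B * lam ^ 2 + 2 * B ^ 2 * lam + 2 * B ^ 2 * lam ^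
    3 + B ^ 3 + 3 * B ^ 3 * lam ^ 2 + B ^ 4 * lam + 2 * B ^ 4 * lam ^ 3 + B ^ 5 * lam ^ 4)) + ψ 0
    * (3 * lam + 3 * B ^ 3) + ψ 1 * (4 * B * lam ^ 2 + 2 * B ^ 2 * lam - 2 * B ^ 2 * lam ^ 3 - 2
    * B ^ 3 - B ^ 3 * lam ^ 2 + B ^ 4 * lam) + ψ 2 * (-2 * lam - 2 * B * lam ^ 2 - 2 * B ^ 2 *
    lam - B ^ 3 + 2 * B ^ 3 * lam ^ 2 - B ^ 4 * lam + 2 * B ^ 4 * lam ^ 3 - 2 * B ^ 5 * lam ^ 4)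
    + ψ 3 * (-lam - 2 * B * lam ^ 2 + 2 * B ^ 2 * lam ^ 3 - B ^ 3 * lam ^ 2 - 2 * B ^ 4 * lam ^ 3
    + 2 * B ^ 5 * lam ^ 4)) := by
  simp [viewSum, viewWeight, viewValue]
  ring

theorem viewSumStar122 : viewSum B lam D z c ψ false false false 1 2 2 =
    B ^ 9 * (D * (z * (lam + B * lam ^ 2 + 2 * B ^ 3 * lam ^ 2 + 2 * B ^ 4 * lam ^ 3 + B ^ 6 *
    lam ^ 3 + B ^ 7 * lam ^ 4) - c * (lam + B * lam ^ 2 + B ^ 2 * lam + B ^ 3 + 4 * B ^ 3 * lam ^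
    2 + 2 * B ^ 4 * lam + 3 * B ^ 4 * lam ^ 3 + B ^ 5 * lam ^ 2 + B ^ 6 * lam ^ 3 + B ^ 7 * lam ^
    4)) + ψ 0 * (3 * lam + 3 * B ^ 3) + ψ 1 * (3 * B * lam ^ 2 + 2 * B ^ 2 * lam - B ^ 3 + 4 * B
    ^ 3 * lam ^ 2 + 4 * B ^ 4 * lam - B ^ 4 * lam ^ 3 - B ^ 5 * lam ^ 2) + ψ 2 * (-lam - B * lam
    ^ 2 - 2 * B ^ 2 * lam - 2 * B ^ 3 - 4 * B ^ 4 * lam + 2 * B ^ 4 * lam ^ 3 + B ^ 5 * lam ^ 2 +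
    2 * B ^ 6 * lam ^ 3 - B ^ 7 * lam ^ 4) + ψ 3 * (-2 * lam - 2 * B * lam ^ 2 - 4 * B ^ 3 * lam
    ^ 2 - B ^ 4 * lam ^ 3 - 2 * B ^ 6 * lam ^ 3 + B ^ 7 * lam ^ 4)) := by
  simp [viewSum, viewWeight, viewValue]
  ring

theorem viewSumStar222 : viewSum B lam D z c ψ false false false 2 2 2 =
    B ^ 9 * (D * (z * (lam + 3 * B ^ 3 * lam ^ 2 + 3 * B ^ 6 * lam ^ 3 + B ^ 9 * lam ^ 4) - c *
    (lam + B ^ 3 + 3 * B ^ 3 * lam ^ 2 + 3 * B ^ 4 * lam + 3 * B ^ 5 * lam ^ 2 + 4 * B ^ 6 * lam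
    ^ 3 + B ^ 9 * lam ^ 4)) + ψ 0 * (3 * lam + 3 * B ^ 3) + ψ 1 * (9 * B ^ 3 * lam ^ 2 + 9 * B ^
    4 * lam) + ψ 2 * (-3 * B ^ 3 - 9 * B ^ 4 * lam + 6 * B ^ 6 * lam ^ 3) + ψ 3 * (-3 * lam - 9 *
    B ^ 3 * lam ^ 2 - 6 * B ^ 6 * lam ^ 3)) := by
  simp [viewSum, viewWeight, viewValue]
  ring

theorem viewSumEdge000 : viewSum B lam D z c ψ true false false 0 0 0 =
    B ^ 5 * (D * (z * (2 * B ^ 2 * lam ^ 3 + 3 * B ^ 3 * lam ^ 2 + B ^ 3 * lam ^ 4 + B ^ 4 * lam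
    + B ^ 4 * lam ^ 3) - c * (lam ^ 3 + 2 * B * lam ^ 2 + 2 * B ^ 2 * lam ^ 3 + 4 * B ^ 3 * lam ^
    2 + B ^ 3 * lam ^ 4 + 4 * B ^ 4 * lam + B ^ 4 * lam ^ 3 + B ^ 7)) + ψ 0 * (-lam ^ 3 - 4 * B *
    lam ^ 2 - B ^ 3 * lam ^ 2 - 4 * B ^ 4 * lam) + ψ 1 * (-2 * lam ^ 3 - 2 * B * lam ^ 2 - 4 * B
    ^ 2 * lam ^ 3 - B ^ 3 * lam ^ 4 + 4 * B ^ 4 * lam - B ^ 4 * lam ^ 3) + ψ 2 * (6 * B * lam ^ 2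
    + 4 * B ^ 2 * lam ^ 3 + B ^ 3 * lam ^ 2 - 2 * B ^ 3 * lam ^ 4 + B ^ 4 * lam ^ 3) + ψ 3 * (3 *
    lam ^ 3 + 3 * B ^ 3 * lam ^ 4)) := by
  simp [viewSum, viewWeight, viewValue]
  ring

theorem viewSumEdge001 : viewSum B lam D z c ψ true false false 0 0 1 =
    B ^ 7 * (D * (z * (2 * B * lam ^ 2 + B ^ 2 * lam + 3 * B ^ 2 * lam ^ 3 + B ^ 3 * lam ^ 2 + B
    ^ 3 * lam ^ 4) - c * (lam ^ 3 + 5 * B * lam ^ 2 + 3 * B ^ 2 * lam + 3 * B ^ 2 * lam ^ 3 + B ^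
    3 * lam ^ 2 + B ^ 3 * lam ^ 4 + B ^ 4 * lam + B ^ 5)) + ψ 0 * (-2 * B * lam ^ 2 + B ^ 2 * lam
    - 2 * B ^ 4 * lam + B ^ 5) + ψ 1 * (-3 * lam ^ 3 - 3 * B * lam ^ 2 - 2 * B ^ 2 * lam ^ 3 + B
    ^ 3 * lam ^ 2 + 2 * B ^ 4 * lam - B ^ 5) + ψ 2 * (5 * B * lam ^ 2 - B ^ 2 * lam + 2 * B ^ 2 *
    lam ^ 3 - B ^ 3 * lam ^ 2 - 3 * B ^ 3 * lam ^ 4) + ψ 3 * (3 * lam ^ 3 + 3 * B ^ 3 * lam ^ 4)) :=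
    by
  simp [viewSum, viewWeight, viewValue]
  ring

theorem viewSumEdge002 : viewSum B lam D z c ψ true false false 0 0 2 =
    B ^ 8 * (D * (z * (2 * lam ^ 2 + B * lam + B * lam ^ 3 + 2 * B ^ 3 * lam ^ 3 + B ^ 4 * lam ^
    2 + B ^ 4 * lam ^ 4) - c * (3 * lam ^ 2 + 3 * B * lam + 2 * B * lam ^ 3 + 2 * B ^ 2 * lam ^ 2
    + 2 * B ^ 3 * lam ^ 3 + B ^ 4 + B ^ 4 * lam ^ 2 + B ^ 4 * lam ^ 4 + B ^ 5 * lam)) + ψ 0 * (B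
    * lam - 2 * B ^ 2 * lam ^ 2 + B ^ 4 - 2 * B ^ 5 * lam) + ψ 1 * (2 * lam ^ 2 + 2 * B * lam - 2
    * B * lam ^ 3 - 2 * B ^ 2 * lam ^ 2 - 2 * B ^ 3 * lam ^ 3 + B ^ 4 * lam ^ 2 + 3 * B ^ 5 *
    lam) + ψ 2 * (-2 * B * lam + 4 * B ^ 2 * lam ^ 2 + 4 * B ^ 3 * lam ^ 3 - B ^ 4 - 2 * B ^ 4 *
    lam ^ 4 - B ^ 5 * lam) + ψ 3 * (-2 * lam ^ 2 - B * lam + 2 * B * lam ^ 3 - 2 * B ^ 3 * lam ^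
    3 - B ^ 4 * lam ^ 2 + 2 * B ^ 4 * lam ^ 4)) := by
  simp [viewSum, viewWeight, viewValue]
  ring

theorem viewSumEdge010 : viewSum B lam D z c ψ true false false 0 1 0 =
    B ^ 6 * (D * (z * (B * lam ^ 3 + 2 * B ^ 2 * lam ^ 2 + B ^ 3 * lam + B ^ 3 * lam ^ 3 + B ^ 4
    * lam ^ 2 + B ^ 4 * lam ^ 4 + B ^ 5 * lam ^ 3) - c * (lam ^ 2 + 2 * B * lam ^ 3 + 3 * B ^ 2 *
    lam ^ 2 + 3 * B ^ 3 * lam + B ^ 3 * lam ^ 3 + 2 * B ^ 4 * lam ^ 2 + B ^ 4 * lam ^ 4 + B ^ 5 *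
    lam + B ^ 5 * lam ^ 3 + B ^ 6)) + ψ 0 * (-2 * lam ^ 2 - B * lam ^ 3 - B ^ 2 * lam ^ 2 - B ^ 3
    * lam - B ^ 4 * lam ^ 2 - B ^ 5 * lam + B ^ 6) + ψ 1 * (-3 * B * lam ^ 3 + 3 * B ^ 3 * lam -
    B ^ 3 * lam ^ 3 + B ^ 4 * lam ^ 2 - B ^ 4 * lam ^ 4 + B ^ 5 * lam - B ^ 5 * lam ^ 3 - B ^ 6)
    + ψ 2 * (2 * lam ^ 2 + 2 * B * lam ^ 3 + 2 * B ^ 2 * lam ^ 2 - 2 * B ^ 3 * lam + B ^ 3 * lam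
    ^ 3 - B ^ 4 * lam ^ 4 + 2 * B ^ 5 * lam ^ 3) + ψ 3 * (2 * B * lam ^ 3 - B ^ 2 * lam ^ 2 + 2 *
    B ^ 4 * lam ^ 4 - B ^ 5 * lam ^ 3)) := by
  simp [viewSum, viewWeight, viewValue]
  ring

theorem viewSumEdge011 : viewSum B lam D z c ψ true false false 0 1 1 =
    B ^ 8 * (D * (z * (lam ^ 2 + B * lam + B * lam ^ 3 + 2 * B ^ 2 * lam ^ 2 + 2 * B ^ 3 * lam ^
    3 + B ^ 4 * lam ^ 4) - c * (2 * lam ^ 2 + 2 * B * lam + 2 * B * lam ^ 3 + 4 * B ^ 2 * lam ^ 2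
    + 2 * B ^ 3 * lam + 2 * B ^ 3 * lam ^ 3 + B ^ 4 + B ^ 4 * lam ^ 4)) + ψ 0 * (-lam ^ 2 + 2 * B
    * lam - B ^ 3 * lam + 2 * B ^ 4) + ψ 1 * (lam ^ 2 + B * lam - 3 * B * lam ^ 3 + B ^ 3 * lam -
    2 * B ^ 4) + ψ 2 * (lam ^ 2 - 3 * B * lam + B * lam ^ 3 + B ^ 3 * lam ^ 3 - 2 * B ^ 4 * lam ^
    4) + ψ 3 * (-lam ^ 2 + 2 * B * lam ^ 3 - B ^ 3 * lam ^ 3 + 2 * B ^ 4 * lam ^ 4)) := by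
  simp [viewSum, viewWeight, viewValue]
  ring

theorem viewSumEdge012 : viewSum B lam D z c ψ true false false 0 1 2 =
    B ^ 8 * (D * (z * (lam ^ 2 + B * lam + B ^ 2 * lam ^ 2 + 2 * B ^ 3 * lam ^ 3 + B ^ 4 * lam ^
    2 + B ^ 5 * lam ^ 3 + B ^ 6 * lam ^ 4) - c * (lam ^ 2 + 2 * B * lam + 3 * B ^ 2 * lam ^ 2 + B
    ^ 3 * lam + 3 * B ^ 3 * lam ^ 3 + B ^ 4 + 2 * B ^ 4 * lam ^ 2 + B ^ 5 * lam + B ^ 5 * lam ^ 3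
    + B ^ 6 * lam ^ 4)) + ψ 0 * (2 * B * lam - B ^ 2 * lam ^ 2 + 2 * B ^ 4 - B ^ 5 * lam) + ψ 1 *
    (2 * lam ^ 2 + 2 * B * lam + 2 * B ^ 2 * lam ^ 2 + B ^ 3 * lam - 2 * B ^ 3 * lam ^ 3 - B ^ 4
    + 2 * B ^ 5 * lam) + ψ 2 * (-3 * B * lam - B ^ 3 * lam + 3 * B ^ 3 * lam ^ 3 - B ^ 4 + B ^ 4
    * lam ^ 2 - B ^ 5 * lam + B ^ 5 * lam ^ 3 - B ^ 6 * lam ^ 4) + ψ 3 * (-2 * lam ^ 2 - B * lam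
    - B ^ 2 * lam ^ 2 - B ^ 3 * lam ^ 3 - B ^ 4 * lam ^ 2 - B ^ 5 * lam ^ 3 + B ^ 6 * lam ^ 4)) :=
    by
  simp [viewSum, viewWeight, viewValue]
  ring

theorem viewSumEdge110 : viewSum B lam D z c ψ true false false 1 1 0 =
    B ^ 8 * (D * (z * (lam ^ 2 + B * lam + 2 * B * lam ^ 3 + 2 * B ^ 2 * lam ^ 2 + B ^ 4 * lam ^
    4 + B ^ 5 * lam ^ 3) - c * (3 * lam ^ 2 + 2 * B * lam + 3 * B * lam ^ 3 + 2 * B ^ 2 * lam ^ 2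
    + 2 * B ^ 3 * lam + B ^ 4 + B ^ 4 * lam ^ 2 + B ^ 4 * lam ^ 4 + B ^ 5 * lam ^ 3)) + ψ 0 * (-2
    * lam ^ 2 + 2 * B * lam - B * lam ^ 3 - 2 * B ^ 3 * lam + 2 * B ^ 4 - B ^ 4 * lam ^ 2) + ψ 1
    * (-2 * B * lam ^ 3 + 4 * B ^ 2 * lam ^ 2 + 4 * B ^ 3 * lam - 2 * B ^ 4 - B ^ 4 * lam ^ 4 - B
    ^ 5 * lam ^ 3) + ψ 2 * (2 * lam ^ 2 - 2 * B * lam + 2 * B * lam ^ 3 - 2 * B ^ 2 * lam ^ 2 - 2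
    * B ^ 3 * lam + B ^ 4 * lam ^ 2 + 3 * B ^ 5 * lam ^ 3) + ψ 3 * (B * lam ^ 3 - 2 * B ^ 2 * lam
    ^ 2 + B ^ 4 * lam ^ 4 - 2 * B ^ 5 * lam ^ 3)) := by
  simp [viewSum, viewWeight, viewValue]
  ring

theorem viewSumEdge111 : viewSum B lam D z c ψ true false false 1 1 1 =
    B ^ 9 * (D * (z * (lam + 3 * B * lam ^ 2 + 2 * B ^ 2 * lam ^ 3 + B ^ 4 * lam ^ 3 + B ^ 5 *
    lam ^ 4) - c * (lam + 5 * B * lam ^ 2 + 3 * B ^ 2 * lam + 3 * B ^ 2 * lam ^ 3 + B ^ 3 + B ^ 3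
    * lam ^ 2 + B ^ 4 * lam ^ 3 + B ^ 5 * lam ^ 4)) + ψ 0 * (3 * lam + 3 * B ^ 3) + ψ 1 * (5 * B
    * lam ^ 2 + 2 * B ^ 2 * lam - B ^ 2 * lam ^ 3 - 3 * B ^ 3 - B ^ 3 * lam ^ 2) + ψ 2 * (-3 *
    lam - 3 * B * lam ^ 2 - 2 * B ^ 2 * lam + B ^ 3 * lam ^ 2 + 2 * B ^ 4 * lam ^ 3 - B ^ 5 * lam
    ^ 4) + ψ 3 * (-2 * B * lam ^ 2 + B ^ 2 * lam ^ 3 - 2 * B ^ 4 * lam ^ 3 + B ^ 5 * lam ^ 4)) := by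
  simp [viewSum, viewWeight, viewValue]
  ring

theorem viewSumEdge112 : viewSum B lam D z c ψ true false false 1 1 2 =
    B ^ 9 * (D * (z * (lam + 2 * B * lam ^ 2 + B ^ 3 * lam ^ 2 + 3 * B ^ 4 * lam ^ 3 + B ^ 7 *
    lam ^ 4) - c * (lam + 2 * B * lam ^ 2 + 2 * B ^ 2 * lam + B ^ 3 + 4 * B ^ 3 * lam ^ 2 + B ^ 4
    * lam + 4 * B ^ 4 * lam ^ 3 + B ^ 7 * lam ^ 4)) + ψ 0 * (3 * lam + 3 * B ^ 3) + ψ 1 * (6 * B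
    * lam ^ 2 + 4 * B ^ 2 * lam - 2 * B ^ 3 + B ^ 3 * lam ^ 2 + B ^ 4 * lam) + ψ 2 * (-2 * lam -
    2 * B * lam ^ 2 - 4 * B ^ 2 * lam - B ^ 3 - B ^ 4 * lam + 4 * B ^ 4 * lam ^ 3) + ψ 3 * (-lam
    - 4 * B * lam ^ 2 - B ^ 3 * lam ^ 2 - 4 * B ^ 4 * lam ^ 3)) := by
  simp [viewSum, viewWeight, viewValue]
  ring

theorem viewSumPath000 : viewSum B lam D z c ψ true false true 0 0 0 =
    B ^ 6 * (D * (z * (B * lam ^ 3 + 3 * B ^ 2 * lam ^ 2 + B ^ 3 * lam + 2 * B ^ 3 * lam ^ 3 + B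
    ^ 4 * lam ^ 4) - c * (lam ^ 2 + 2 * B * lam ^ 3 + 5 * B ^ 2 * lam ^ 2 + 4 * B ^ 3 * lam + 2 *
    B ^ 3 * lam ^ 3 + B ^ 4 * lam ^ 4 + B ^ 6)) + ψ 0 * (-2 * lam ^ 2 - 2 * B ^ 3 * lam) + ψ 1 *
    (-4 * B * lam ^ 3 - 2 * B ^ 2 * lam ^ 2 + 2 * B ^ 3 * lam) + ψ 2 * (2 * lam ^ 2 + 2 * B * lam
    ^ 3 + 2 * B ^ 2 * lam ^ 2 - 2 * B ^ 4 * lam ^ 4) + ψ 3 * (2 * B * lam ^ 3 + 2 * B ^ 4 * lam ^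
    4)) := by
  simp [viewSum, viewWeight, viewValue]
  ring

theorem viewSumPath001 : viewSum B lam D z c ψ true false true 0 0 1 =
    B ^ 8 * (D * (z * (2 * lam ^ 2 + B * lam + 2 * B * lam ^ 3 + B ^ 2 * lam ^ 2 + B ^ 3 * lam ^
    3 + B ^ 4 * lam ^ 4) - c * (4 * lam ^ 2 + 3 * B * lam + 3 * B * lam ^ 3 + 2 * B ^ 2 * lam ^ 2
    + B ^ 3 * lam + B ^ 3 * lam ^ 3 + B ^ 4 + B ^ 4 * lam ^ 4)) + ψ 0 * (-lam ^ 2 + B * lam - B ^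
    3 * lam + B ^ 4) + ψ 1 * (lam ^ 2 + B * lam - 2 * B * lam ^ 3 + B ^ 3 * lam - B ^ 4) + ψ 2 *
    (lam ^ 2 - 2 * B * lam + B * lam ^ 3 + B ^ 3 * lam ^ 3 - B ^ 4 * lam ^ 4) + ψ 3 * (-lam ^ 2 +
    B * lam ^ 3 - B ^ 3 * lam ^ 3 + B ^ 4 * lam ^ 4)) := by
  simp [viewSum, viewWeight, viewValue]
  ring

theorem viewSumPath101 : viewSum B lam D z c ψ true false true 1 0 1 =
    B ^ 8 * (D * (z * (lam ^ 2 + B * lam + 2 * B ^ 2 * lam ^ 2 + 3 * B ^ 3 * lam ^ 3 + B ^ 6 *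
    lam ^ 4) - c * (lam ^ 2 + 2 * B * lam + 5 * B ^ 2 * lam ^ 2 + 2 * B ^ 3 * lam + 4 * B ^ 3 *
    lam ^ 3 + B ^ 4 + B ^ 6 * lam ^ 4)) + ψ 0 * (2 * B * lam + 2 * B ^ 4) + ψ 1 * (2 * lam ^ 2 +
    2 * B * lam + 2 * B ^ 2 * lam ^ 2 - 2 * B ^ 4) + ψ 2 * (-4 * B * lam - 2 * B ^ 2 * lam ^ 2 +
    2 * B ^ 3 * lam ^ 3) + ψ 3 * (-2 * lam ^ 2 - 2 * B ^ 3 * lam ^ 3)) := by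
  simp [viewSum, viewWeight, viewValue]
  ring

/-- Here the block is a whole `K₄` component, whose four vertices play symmetric roles, so the ψ
terms cancel for every potential. -/
theorem viewSumTriangle000 : viewSum B lam D z c ψ true true true 0 0 0 =
    B ^ 8 * (D * (z * (3 * lam ^ 2 + B * lam + 3 * B * lam ^ 3 + B ^ 4 * lam ^ 4) - c * (6 * lam
    ^ 2 + 4 * B * lam + 4 * B * lam ^ 3 + B ^ 4 + B ^ 4 * lam ^ 4))) := by
  simp [viewSum, viewWeight, viewValue]
  ring

end ViewExpansions

/-! ### Certified polynomial inequalities on the unit square -/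

section PolynomialBounds

/-- The value at `y` of the polynomial with coefficient list `p`. -/
def evalList (y : ℝ) : List ℤ → ℝ
  | [] => 0
  | a :: p => a + y * evalList y p

/-- The value at `(x, y)` of the bivariate polynomial whose coefficient of `x ^ i` is the `i`-th
entry of the list, a polynomial in `y`. -/
def evalLists (x y : ℝ) : List (List ℤ) → ℝ
  | [] => 0
  | p :: P => evalList y p + x * evalLists x y P

/-! Nonnegativity is certified by kernel computation on lists of natural numbers, the positive and
the negative parts of the polynomials being kept apart. -/

namespace NatPoly

def eval (y : ℝ) : List ℕ → ℝ
  | [] => 0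
  | a :: p => a + y * eval y p

def eval₂ (x y : ℝ) : List (List ℕ) → ℝ
  | [] => 0
  | p :: P => eval y p + x * eval₂ x y P

def add : List ℕ → List ℕ → List ℕ
  | [], q => q
  | a :: p, [] => a :: p
  | a :: p, b :: q => a.add b :: add p q

def smul (a : ℕ) : List ℕ → List ℕ
  | [] => []
  | b :: p => a.mul b :: smul a p

def mul : List ℕ → List ℕ → List ℕ
  | [], _ => []
  | [a], q => smul a q
  | a :: b :: p, q => add (smul a q) (0 :: mul (b :: p) q)

def add₂ : List (List ℕ) → List (List ℕ) → List (List ℕ)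
  | [], Q => Q
  | p :: P, [] => p :: P
  | p :: P, q :: Q => add p q :: add₂ P Q

def mapMul (p : List ℕ) : List (List ℕ) → List (List ℕ)
  | [] => []
  | q :: Q => mul p q :: mapMul p Q

def mul₂ : List (List ℕ) → List (List ℕ) → List (List ℕ)
  | [], _ => []
  | p :: P, Q => add₂ (mapMul p Q) ([] :: mul₂ P Q)

/-- Substitution of the bivariate polynomial `Y` into a univariate polynomial. -/
def comp (Y : List (List ℕ)) : List ℕ → List (List ℕ)
  | [] => []
  | a :: p => add₂ [[a]] (mul₂ Y (comp Y p))

/-- Substitution of the bivariate polynomials `X` and `Y` into a bivariate polynomial. -/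
def comp₂ (X Y : List (List ℕ)) : List (List ℕ) → List (List ℕ)
  | [] => []
  | p :: P => add₂ (comp Y p) (mul₂ X (comp₂ X Y P))

/-- `N ^ k` times the polynomial with its variable divided by `N`. -/
def dilate (N : ℕ) : ℕ → List ℕ → List ℕ
  | _, [] => []
  | k, a :: p => (N.pow k).mul a :: dilate N k.pred p

def dilateOuter (N : ℕ) : ℕ → List (List ℕ) → List (List ℕ)
  | _, [] => []
  | k, p :: P => smul (N.pow k) p :: dilateOuter N k.pred P

def dilateInner (N k : ℕ) : List (List ℕ) → List (List ℕ)
  | [] => []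
  | p :: P => dilate N k p :: dilateInner N k P

/-- The polynomial with its variable increased by `1`. -/
def shift : List ℕ → List ℕ
  | [] => []
  | a :: p => add (shift p) (a :: shift p)

def shiftOuter : List (List ℕ) → List (List ℕ)
  | [] => []
  | p :: P => add₂ (shiftOuter P) (p :: shiftOuter P)

def shiftInner : List (List ℕ) → List (List ℕ)
  | [] => []
  | p :: P => shift p :: shiftInner P

def maxLength : List (List ℕ) → ℕ
  | [] => 0
  | p :: P => max p.length (maxLength P)

def sum : List ℕ → ℕ
  | [] => 0
  | a :: p => a.add (sum p)

def sum₂ : List (List ℕ) → ℕ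
  | [] => 0
  | p :: P => (sum p).add (sum₂ P)

/-- A bound for the negative part of `p - q - d` on `[0, 1]`. -/
def deficit (d : ℕ) : List ℕ → List ℕ → ℕ
  | [], q => d.add (sum q)
  | a :: p, [] => (d.add (deficit 0 p [])).sub a
  | a :: p, b :: q => ((b.add d).add (deficit 0 p q)).sub a

/-- A bound for the negative part of `P - Q` on `[0, 1]²`. -/
def deficit₂ : List (List ℕ) → List (List ℕ) → ℕ
  | [], Q => sum₂ Q
  | p :: P, [] => deficit (deficit₂ P []) p []
  | p :: P, q :: Q => deficit (deficit₂ P Q) p q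

/-- Certifies `Q ≤ P` on `[0, 1]²`, bisecting the two variables in turn at most `fuel` times. -/
def isLE : ℕ → List (List ℕ) → List (List ℕ) → Bool
  | 0, P, Q => (deficit₂ P Q).beq 0
  | fuel + 1, P, Q => (deficit₂ P Q).beq 0 ||
      bif (fuel.mod 2).beq 0 then
        isLE fuel (dilateOuter 2 (max P.length Q.length) P)
            (dilateOuter 2 (max P.length Q.length) Q) &&
          isLE fuel (shiftOuter (dilateOuter 2 (max P.length Q.length) P))
            (shiftOuter (dilateOuter 2 (max P.length Q.length) Q))
      else
        isLE fuel (dilateInner 2 (max (maxLength P) (maxLength Q)) P)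
            (dilateInner 2 (max (maxLength P) (maxLength Q)) Q) &&
          isLE fuel (shiftInner (dilateInner 2 (max (maxLength P) (maxLength Q)) P))
            (shiftInner (dilateInner 2 (max (maxLength P) (maxLength Q)) Q))

theorem eval_add (y : ℝ) (p q : List ℕ) : eval y (add p q) = eval y p + eval y q := by
  induction p generalizing q with
  | nil => simp [add, eval]
  | cons a p ih => cases q with
    | nil => simp [add, eval]
    | cons b q => simp only [add, eval, ih, Nat.add_eq]; push_cast; ring

theorem eval_smul (y : ℝ) (a : ℕ) (p : List ℕ) : eval y (smul a p) = a * eval y p := by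
  induction p with
  | nil => simp [smul, eval]
  | cons b p ih => simp only [smul, eval, ih, Nat.mul_eq]; push_cast; ring

theorem eval_mul (y : ℝ) (p q : List ℕ) : eval y (mul p q) = eval y p * eval y q := by
  induction p with
  | nil => simp [mul, eval]
  | cons a p ih =>
    cases p with
    | nil => simp [mul, eval, eval_smul]
    | cons b p => simp only [mul, eval_add, eval_smul, eval] at ih ⊢; rw [ih]; push_cast; ring

theorem eval₂_add (x y : ℝ) (P Q : List (List ℕ)) :
    eval₂ x y (add₂ P Q) = eval₂ x y P + eval₂ x y Q := by
  induction P generalizing Q with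
  | nil => simp [add₂, eval₂]
  | cons p P ih => cases Q with
    | nil => simp [add₂, eval₂]
    | cons q Q => simp only [add₂, eval₂, ih, eval_add]; ring

theorem eval₂_mapMul (x y : ℝ) (p : List ℕ) (Q : List (List ℕ)) :
    eval₂ x y (mapMul p Q) = eval y p * eval₂ x y Q := by
  induction Q with
  | nil => simp [mapMul, eval₂]
  | cons q Q ih => simp only [mapMul, eval₂, ih, eval_mul]; ring

theorem eval₂_mul (x y : ℝ) (P Q : List (List ℕ)) :
    eval₂ x y (mul₂ P Q) = eval₂ x y P * eval₂ x y Q := by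
  induction P with
  | nil => simp [mul₂, eval₂]
  | cons p P ih => simp only [mul₂, eval₂_add, eval₂_mapMul, eval₂, eval, ih]; ring

theorem eval₂_comp (x y : ℝ) (Y : List (List ℕ)) (p : List ℕ) :
    eval₂ x y (comp Y p) = eval (eval₂ x y Y) p := by
  induction p with
  | nil => simp [comp, eval, eval₂]
  | cons a p ih => simp only [comp, eval₂_add, eval₂_mul, ih, eval, eval₂]; ring

theorem eval₂_comp₂ (x y : ℝ) (X Y P : List (List ℕ)) :
    eval₂ x y (comp₂ X Y P) = eval₂ (eval₂ x y X) (eval₂ x y Y) P := by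
  induction P with
  | nil => simp [comp₂, eval₂]
  | cons p P ih => simp only [comp₂, eval₂_add, eval₂_mul, ih, eval₂, eval₂_comp]

/-- The length hypothesis matters: the exponent in `dilate` decreases by `pred`, which would stay at
`0` on a longer list. -/
theorem eval_dilate (N : ℕ) (y : ℝ) {k : ℕ} {p : List ℕ} (h : p.length ≤ k + 1) :
    eval (N * y) (dilate N k p) = N ^ k * eval y p := by
  induction p generalizing k with
  | nil => simp [dilate, eval]
  | cons a p ih =>
    cases k with
    | zero =>
      have : p = [] := List.length_eq_zero_iff.1 (by simpa using h)
      simp [this, dilate, eval]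
    | succ k =>
      have h' : p.length ≤ k + 1 := by simpa using h
      simp only [dilate, eval, Nat.pred_succ, ih h', Nat.mul_eq, Nat.pow_eq]
      push_cast
      ring

theorem eval₂_dilateOuter (N : ℕ) (x y : ℝ) {k : ℕ} {P : List (List ℕ)}
    (h : P.length ≤ k + 1) :
    eval₂ (N * x) y (dilateOuter N k P) = N ^ k * eval₂ x y P := by
  induction P generalizing k with
  | nil => simp [dilateOuter, eval₂]
  | cons p P ih =>
    cases k with
    | zero =>
      have : P = [] := List.length_eq_zero_iff.1 (by simpa using h)
      simp [this, dilateOuter, eval₂, eval_smul]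
    | succ k =>
      have h' : P.length ≤ k + 1 := by simpa using h
      simp only [dilateOuter, eval₂, Nat.pred_succ, ih h', eval_smul, Nat.pow_eq]
      push_cast
      ring

theorem eval₂_dilateInner (N : ℕ) (x y : ℝ) {k : ℕ} {P : List (List ℕ)}
    (h : maxLength P ≤ k + 1) :
    eval₂ x (N * y) (dilateInner N k P) = N ^ k * eval₂ x y P := by
  induction P with
  | nil => simp [dilateInner, eval₂]
  | cons p P ih =>
    have h' := max_le_iff.1 h
    simp only [dilateInner, eval₂, eval_dilate N y h'.1, ih h'.2]
    ring

theorem eval_shift (y : ℝ) (p : List ℕ) : eval y (shift p) = eval (y + 1) p := by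
  induction p with
  | nil => simp [shift, eval]
  | cons a p ih => simp only [shift, eval_add, eval, ih]; ring

theorem eval₂_shiftOuter (x y : ℝ) (P : List (List ℕ)) :
    eval₂ x y (shiftOuter P) = eval₂ (x + 1) y P := by
  induction P with
  | nil => simp [shiftOuter, eval₂]
  | cons p P ih => simp only [shiftOuter, eval₂_add, eval₂, ih]; ring

theorem eval₂_shiftInner (x y : ℝ) (P : List (List ℕ)) :
    eval₂ x y (shiftInner P) = eval₂ x (y + 1) P := by
  induction P with
  | nil => simp [shiftInner, eval₂]
  | cons p P ih => simp only [shiftInner, eval₂, eval_shift, ih]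

theorem length_dilateInner (N k : ℕ) (P : List (List ℕ)) :
    (dilateInner N k P).length = P.length := by
  induction P with
  | nil => rfl
  | cons p P ih => simp [dilateInner, ih]

theorem eval_nonneg {y : ℝ} (hy : 0 ≤ y) (p : List ℕ) : 0 ≤ eval y p := by
  induction p with
  | nil => exact le_rfl
  | cons a p ih => exact add_nonneg a.cast_nonneg (mul_nonneg hy ih)

theorem eval_le_sum {y : ℝ} (hy : y ∈ Set.Icc (0 : ℝ) 1) (p : List ℕ) : eval y p ≤ sum p := by
  induction p with
  | nil => simp [eval, sum]
  | cons a p ih =>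
    simp only [eval, sum, Nat.add_eq, Nat.cast_add]
    nlinarith [hy.1, hy.2, eval_nonneg hy.1 p]

theorem eval₂_le_sum₂ {x y : ℝ} (hx : x ∈ Set.Icc (0 : ℝ) 1) (hy : y ∈ Set.Icc (0 : ℝ) 1)
    (P : List (List ℕ)) : 0 ≤ eval₂ x y P ∧ eval₂ x y P ≤ sum₂ P := by
  induction P with
  | nil => simp [eval₂, sum₂]
  | cons p P ih =>
    simp only [eval₂, sum₂, Nat.add_eq, Nat.cast_add]
    have h₁ := eval_nonneg hy.1 p
    have h₂ := eval_le_sum hy p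
    exact ⟨add_nonneg h₁ (mul_nonneg hx.1 ih.1), by nlinarith [hx.1, hx.2, ih.1, ih.2]⟩

theorem le_add_sub (a b : ℕ) : (b : ℝ) ≤ a + ((b - a : ℕ) : ℝ) := by
  exact_mod_cast (by omega : b ≤ a + (b - a))

theorem neg_le_mul {x a b : ℝ} (hx : x ∈ Set.Icc (0 : ℝ) 1) (hb : 0 ≤ b) (h : -b ≤ a) :
    -b ≤ x * a := by
  nlinarith [hx.1, hx.2, mul_nonneg hx.1 (by linarith : 0 ≤ a + b)]

/-- Horner's scheme: a tail bounded below by `-e` with `e ≥ 0` contributes at least `-e` after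
multiplication by `y` in `[0, 1]`. Truncated subtraction takes the positive part, which is what a
bound for the negative part needs. -/
theorem le_add_deficit {y : ℝ} (hy : y ∈ Set.Icc (0 : ℝ) 1) (d : ℕ) (p q : List ℕ) :
    (d : ℝ) ≤ eval y p - eval y q + deficit d p q := by
  induction p generalizing q d with
  | nil =>
    simp only [eval, deficit, Nat.add_eq, Nat.cast_add]
    linarith [eval_le_sum hy q]
  | cons a p ih =>
    cases q with
    | nil =>
      have h₁ := le_add_sub a (d + deficit 0 p [])
      have h₂ := neg_le_mul hy (Nat.cast_nonneg (deficit 0 p []))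
        (a := eval y p) (by have := ih 0 []; simp only [eval, Nat.cast_zero] at this; linarith)
      simp only [eval, deficit, Nat.add_eq, Nat.sub_eq]
      push_cast at h₁
      linarith
    | cons b q =>
      have h₁ := le_add_sub a (b + d + deficit 0 p q)
      have h₂ := neg_le_mul hy (Nat.cast_nonneg (deficit 0 p q))
        (a := eval y p - eval y q) (by have := ih 0 q; rw [Nat.cast_zero] at this; linarith)
      simp only [eval, deficit, Nat.add_eq, Nat.sub_eq]
      push_cast at h₁
      linarith

/-- The same scheme in the outer variable: the deficit of the tail in `x` enters the leading row as
the constant `d` to be subtracted. -/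
theorem neg_deficit₂_le {x y : ℝ} (hx : x ∈ Set.Icc (0 : ℝ) 1) (hy : y ∈ Set.Icc (0 : ℝ) 1)
    (P Q : List (List ℕ)) : -(deficit₂ P Q : ℝ) ≤ eval₂ x y P - eval₂ x y Q := by
  induction P generalizing Q with
  | nil =>
    simp only [eval₂, deficit₂]
    linarith [(eval₂_le_sum₂ hx hy Q).2]
  | cons p P ih =>
    cases Q with
    | nil =>
      have h₁ := neg_le_mul hx (Nat.cast_nonneg _) (ih [])
      have h₂ := le_add_deficit hy (deficit₂ P []) p []
      simp only [eval₂, deficit₂, eval] at *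
      linarith
    | cons q Q =>
      have h₁ := neg_le_mul hx (Nat.cast_nonneg _) (ih Q)
      have h₂ := le_add_deficit hy (deficit₂ P Q) p q
      simp only [eval₂, deficit₂]
      linarith

theorem two_mul_mem_or {x : ℝ} (hx : x ∈ Set.Icc (0 : ℝ) 1) :
    2 * x ∈ Set.Icc (0 : ℝ) 1 ∨ 2 * x - 1 ∈ Set.Icc (0 : ℝ) 1 := by
  obtain ⟨h₀, h₁⟩ := hx
  rcases le_total (2 * x) 1 with h | h
  · exact Or.inl ⟨by linarith, h⟩
  · exact Or.inr ⟨by linarith, by linarith⟩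

/-- Dilation by `2` brings the lower half of an interval to `[0, 1]`, and a further shift by `1`
does so for the upper half. The factor `2 ^ k` is positive and occurs on both sides. -/
theorem eval₂_le {fuel : ℕ} {P Q : List (List ℕ)} (h : isLE fuel P Q = true) {x y : ℝ}
    (hx : x ∈ Set.Icc (0 : ℝ) 1) (hy : y ∈ Set.Icc (0 : ℝ) 1) : eval₂ x y Q ≤ eval₂ x y P := by
  have base : ∀ {P Q : List (List ℕ)} {x y : ℝ}, x ∈ Set.Icc (0 : ℝ) 1 →
      y ∈ Set.Icc (0 : ℝ) 1 → (deficit₂ P Q).beq 0 = true → eval₂ x y Q ≤ eval₂ x y P := by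
    intro P Q x y hx hy h
    have := neg_deficit₂_le hx hy P Q
    rw [Nat.eq_of_beq_eq_true h, Nat.cast_zero] at this
    linarith
  induction fuel generalizing P Q x y with
  | zero => exact base hx hy h
  | succ fuel ih =>
    rw [isLE, Bool.or_eq_true] at h
    rcases h with h | h
    · exact base hx hy h
    cases hf : (fuel.mod 2).beq 0
    · rw [hf, cond_false, Bool.and_eq_true] at h
      have kP := eval₂_dilateInner 2 x y (P := P) (k := max (maxLength P) (maxLength Q))
        (by omega)
      have kQ := eval₂_dilateInner 2 x y (P := Q) (k := max (maxLength P) (maxLength Q))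
        (by omega)
      refine le_of_mul_le_mul_left (a := ((2 : ℕ) : ℝ) ^ max (maxLength P) (maxLength Q)) ?_
        (by positivity)
      rw [← kP, ← kQ]
      rcases two_mul_mem_or hy with hy' | hy'
      · exact ih h.1 hx (by simpa using hy')
      · have := ih h.2 hx hy'
        rw [eval₂_shiftInner, eval₂_shiftInner, sub_add_cancel] at this
        simpa using this
    · rw [hf, cond_true, Bool.and_eq_true] at h
      have kP := eval₂_dilateOuter 2 x y (P := P) (k := max P.length Q.length) (by omega)
      have kQ := eval₂_dilateOuter 2 x y (P := Q) (k := max P.length Q.length) (by omega)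
      refine le_of_mul_le_mul_left (a := ((2 : ℕ) : ℝ) ^ max P.length Q.length) ?_
        (by positivity)
      rw [← kP, ← kQ]
      rcases two_mul_mem_or hx with hx' | hx'
      · exact ih h.1 (by simpa using hx') hy
      · have := ih h.2 hx' hy
        rw [eval₂_shiftOuter, eval₂_shiftOuter, sub_add_cancel] at this
        simpa using this

def positivePart (P : List (List ℤ)) : List (List ℕ) := P.map (·.map Int.toNat)

def negativePart (P : List (List ℤ)) : List (List ℕ) := P.map (·.map fun a => (-a).toNat)

theorem eval₂_positivePart_sub (x y : ℝ) (P : List (List ℤ)) :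
    eval₂ x y (positivePart P) - eval₂ x y (negativePart P) = evalLists x y P := by
  have row : ∀ p : List ℤ, eval y (p.map Int.toNat) - eval y (p.map fun a => (-a).toNat) =
      evalList y p := by
    intro p
    induction p with
    | nil => simp [eval, evalList]
    | cons a p ih =>
      have h : ((a.toNat : ℤ) : ℝ) - (((-a).toNat : ℤ) : ℝ) = a := by
        rw [← Int.cast_sub, Int.toNat_sub_toNat_neg]
      simp only [List.map_cons, eval, evalList, ← ih]
      push_cast at h
      linear_combination h
  induction P with
  | nil => simp [positivePart, negativePart, eval₂, evalLists]
  | cons p P ih =>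
    simp only [positivePart, negativePart, List.map_cons, eval₂, evalLists, ← row] at ih ⊢
    rw [← ih]
    ring

/-- `N ^ (k + l)` times the polynomial with both variables divided by `N`. -/
def rescale (N k l : ℕ) (P : List (List ℕ)) : List (List ℕ) :=
  dilateOuter N k (dilateInner N l P)

theorem eval₂_rescale (N : ℕ) (x y : ℝ) {k l : ℕ} {P : List (List ℕ)} (hk : P.length ≤ k)
    (hl : maxLength P ≤ l) :
    eval₂ (N * x) (N * y) (rescale N k l P) = N ^ k * (N ^ l * eval₂ x y P) := by
  rw [rescale, eval₂_dilateOuter _ _ _ (by rw [length_dilateInner]; omega),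
    eval₂_dilateInner _ _ _ (by omega)]

end NatPoly

open NatPoly in
/-- Certifies that `P` is nonnegative on the image of `[0, 1]²` under `(X / N, Y / N)`. -/
def isNonnegOn (N : ℕ) (X Y : List (List ℕ)) (P : List (List ℤ)) : Bool :=
  P.length.ble 16 && ((maxLength (positivePart P)).ble 8 && (maxLength (negativePart P)).ble 8) &&
    isLE 4 (comp₂ X Y (rescale N 16 8 (positivePart P)))
      (comp₂ X Y (rescale N 16 8 (negativePart P)))

open NatPoly in
-- Scaling by `N ^ 16 * N ^ 8` makes the substitution of `X / N` and `Y / N` integral. The length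
-- checks in `isNonnegOn` ensure that `rescale` performs exactly this scaling.
theorem evalLists_nonneg_of_isNonnegOn {N : ℕ} {X Y : List (List ℕ)} {P : List (List ℤ)}
    (hN : 0 < N) (h : isNonnegOn N X Y P = true) {x y s t : ℝ} (hs : s ∈ Set.Icc (0 : ℝ) 1)
    (ht : t ∈ Set.Icc (0 : ℝ) 1) (hx : N * x = eval₂ s t X) (hy : N * y = eval₂ s t Y) :
    0 ≤ evalLists x y P := by
  simp only [isNonnegOn, Bool.and_eq_true] at h
  obtain ⟨⟨h₁, h₂, h₃⟩, h⟩ := h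
  have key := eval₂_le h hs ht
  rw [eval₂_comp₂, eval₂_comp₂, ← hx, ← hy,
    eval₂_rescale _ _ _ (by simpa [negativePart] using Nat.le_of_ble_eq_true h₁)
      (Nat.le_of_ble_eq_true h₃),
    eval₂_rescale _ _ _ (by simpa [positivePart] using Nat.le_of_ble_eq_true h₁)
      (Nat.le_of_ble_eq_true h₂)] at key
  have hN' : (0 : ℝ) < N := by exact_mod_cast hN
  rw [← eval₂_positivePart_sub, sub_nonneg]
  exact le_of_mul_le_mul_left (le_of_mul_le_mul_left key (by positivity)) (by positivity)

end PolynomialBounds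

/-! ### The main dual certificate -/

section Certificates

/-- The partition function of `K₄`, divided by `B ^ 2`. -/
def centerZ (B lam : ℝ) : ℝ :=
  B ^ 4 + 4 * B * lam + 6 * lam ^ 2 + 4 * B * lam ^ 3 + B ^ 4 * lam ^ 4

/-- The contribution to `centerZ` of the configurations in which a fixed vertex has spin `+`. -/
def centerN (B lam : ℝ) : ℝ :=
  B * lam + 3 * lam ^ 2 + 3 * B * lam ^ 3 + B ^ 4 * lam ^ 4

/-- Relabelling the neighbours leaves 10 star, 9 edge, 3 path and 1 triangle views. The degree bound
forces `kᵢ = 0` at a neighbour adjacent to both others. -/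
theorem viewsNonneg_of_canonical {B lam D z c : ℝ} {ψ : ℕ → ℝ}
    (star : ∀ k₁ k₂ k₃, k₁ ≤ k₂ → k₂ ≤ k₃ → k₃ ≤ 2 →
      0 ≤ viewSum B lam D z c ψ false false false k₁ k₂ k₃)
    (edge : ∀ k₁ k₂ k₃, k₁ ≤ k₂ → k₂ ≤ 1 → k₃ ≤ 2 →
      0 ≤ viewSum B lam D z c ψ true false false k₁ k₂ k₃)
    (path : ∀ k₁ k₃, k₁ ≤ k₃ → k₃ ≤ 1 → 0 ≤ viewSum B lam D z c ψ true false true k₁ 0 k₃)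
    (triangle : 0 ≤ viewSum B lam D z c ψ true true true 0 0 0) :
    ViewsNonneg B lam D z c ψ := by
  have edge' : ∀ k₁ k₂ k₃, k₁ ≤ 1 → k₂ ≤ 1 → k₃ ≤ 2 →
      0 ≤ viewSum B lam D z c ψ true false false k₁ k₂ k₃ := by
    intro k₁ k₂ k₃ h₁ h₂ h₃
    rcases le_total k₁ k₂ with h | h
    · exact edge _ _ _ h h₂ h₃
    · rw [viewSum_swap₁₂]
      exact edge _ _ _ h h₁ h₃
  have path' : ∀ k₁ k₃, k₁ ≤ 1 → k₃ ≤ 1 → 0 ≤ viewSum B lam D z c ψ true false true k₁ 0 k₃ := by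
    intro k₁ k₃ h₁ h₃
    rcases le_total k₁ k₃ with h | h
    · exact path _ _ h h₃
    · rw [viewSum_swap₁₂, viewSum_swap₂₃, viewSum_swap₁₂]
      exact path _ _ h h₁
  have sorted : ∀ k₁ k₂ k₃, k₁ ≤ k₂ → k₁ ≤ k₃ → k₂ ≤ 2 → k₃ ≤ 2 →
      0 ≤ viewSum B lam D z c ψ false false false k₁ k₂ k₃ := by
    intro k₁ k₂ k₃ h₁₂ h₁₃ h₂ h₃
    rcases le_total k₂ k₃ with h | h
    · exact star _ _ _ h₁₂ h h₃
    · rw [viewSum_swap₂₃]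
      exact star _ _ _ h₁₃ h h₂
  intro a₁₂ a₁₃ a₂₃ k₁ k₂ k₃ h₁ h₂ h₃
  cases a₁₂ <;> cases a₁₃ <;> cases a₂₃ <;>
    simp only [Bool.toNat_true, Bool.toNat_false, add_zero] at h₁ h₂ h₃
  · rcases le_total k₁ k₂ with h | h
    · rcases le_total k₁ k₃ with h' | h'
      · exact sorted _ _ _ h h' h₂ h₃
      · rw [viewSum_swap₂₃, viewSum_swap₁₂]
        exact sorted _ _ _ h' (h'.trans h) h₁ h₂
    · rw [viewSum_swap₁₂]
      rcases le_total k₂ k₃ with h' | h'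
      · exact sorted _ _ _ h h' h₁ h₃
      · rw [viewSum_swap₂₃, viewSum_swap₁₂]
        exact sorted _ _ _ h' (h'.trans h) h₂ h₁
  · rw [viewSum_swap₁₂, viewSum_swap₂₃]
    exact edge' _ _ _ (by omega) (by omega) (by omega)
  · rw [viewSum_swap₂₃]
    exact edge' _ _ _ (by omega) (by omega) (by omega)
  · obtain rfl : k₃ = 0 := by omega
    rw [viewSum_swap₂₃]
    exact path' _ _ (by omega) (by omega)
  · exact edge' _ _ _ (by omega) (by omega) (by omega)
  · obtain rfl : k₂ = 0 := by omega
    exact path' _ _ (by omega) (by omega)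
  · obtain rfl : k₁ = 0 := by omega
    rw [viewSum_swap₁₂]
    exact path' _ _ (by omega) (by omega)
  · obtain rfl : k₁ = 0 := by omega
    obtain rfl : k₂ = 0 := by omega
    obtain rfl : k₃ = 0 := by omega
    exact triangle

/-- The multiplier of the occupation of the centre in the main certificate. -/
def mainD (B lam : ℝ) : ℝ :=
  3 * (1 + B * lam) * (B + lam) * (1 + B ^ 3 * lam) * (B ^ 3 + lam) * (3 * lam + 2 * B - B ^ 2 *
  lam)

/-- The potential of the main certificate. -/
def mainPsi (B lam : ℝ) : ℕ → ℝ
  | 0 =>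
    lam * (1 - B) ^ 2 * (1 + B) ^ 2 * (1 + B * lam) * (B + lam) * (-9 * lam ^ 3 - 15 * B * lam ^
    2 - 3 * B * lam ^ 4 - 6 * B ^ 2 * lam - 17 * B ^ 2 * lam ^ 3 - 18 * B ^ 3 * lam ^ 2 - 14 * B
    ^ 3 * lam ^ 4 - 6 * B ^ 4 * lam - 19 * B ^ 4 * lam ^ 3 + 15 * B ^ 4 * lam ^ 5 - 17 * B ^ 5 *
    lam ^ 2 - 6 * B ^ 6 * lam - 21 * B ^ 6 * lam ^ 3 - 14 * B ^ 6 * lam ^ 5 - 3 * B ^ 7 + 8 * B ^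
    7 * lam ^ 4 + 6 * B ^ 7 * lam ^ 6 - 3 * B ^ 8 * lam + 14 * B ^ 8 * lam ^ 3 - 3 * B ^ 9 * lam
    ^ 2 - 16 * B ^ 9 * lam ^ 4 - 3 * B ^ 9 * lam ^ 6 + B ^ 10 * lam ^ 3 + 3 * B ^ 10 * lam ^ 5 +
    2 * B ^ 11 * lam ^ 2 + 3 * B ^ 11 * lam ^ 4 - 3 * B ^ 12 * lam ^ 3 - B ^ 12 * lam ^ 5 + B ^
    13 * lam ^ 4)
  | 1 =>
    lam * (1 - B) ^ 2 * (1 + B) ^ 2 * (1 + B * lam) * (B ^ 3 + lam) * (-9 * lam ^ 3 - 12 * B *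
    lam ^ 2 - 9 * B * lam ^ 4 - 3 * B ^ 2 * lam - 15 * B ^ 2 * lam ^ 3 - 14 * B ^ 3 * lam ^ 2 -
    12 * B ^ 3 * lam ^ 4 - 9 * B ^ 4 * lam - 15 * B ^ 4 * lam ^ 3 + 3 * B ^ 4 * lam ^ 5 - 3 * B ^
    5 - 3 * B ^ 5 * lam ^ 2 + 17 * B ^ 5 * lam ^ 4 - 3 * B ^ 6 * lam + 9 * B ^ 6 * lam ^ 3 - 9 *
    B ^ 6 * lam ^ 5 - 3 * B ^ 7 * lam ^ 2 - 12 * B ^ 7 * lam ^ 4 + 3 * B ^ 8 * lam ^ 3 + 3 * B ^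
    8 * lam ^ 5 + 2 * B ^ 9 * lam ^ 2 - 3 * B ^ 10 * lam ^ 3 + B ^ 11 * lam ^ 4)
  | 2 =>
    B * lam * (1 - B) ^ 2 * (1 + B) ^ 2 * (B + lam) * (B ^ 3 + lam) * (-6 * lam ^ 3 - 11 * B *
    lam ^ 2 - 12 * B * lam ^ 4 - 6 * B ^ 2 * lam - 14 * B ^ 2 * lam ^ 3 - 3 * B ^ 3 - 3 * B ^ 3 *
    lam ^ 2 + 12 * B ^ 3 * lam ^ 4 - 6 * B ^ 4 * lam + 9 * B ^ 4 * lam ^ 3 - 6 * B ^ 5 * lam ^ 2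
    - 3 * B ^ 5 * lam ^ 4 + 2 * B ^ 7 * lam ^ 2 - B ^ 8 * lam ^ 3)
  | _ => 0

def mainStar000 : List (List ℤ) :=
  [[0, 0, 6], [0, 4], [0, 0, -2], [0, 9, 0, 9], [6, 0, 15], [0, 3, 0, -3], [], [0, 2], [0, 0,
  -1]]

def mainStar001 : List (List ℤ) :=
  [[0, 0, 3, 0, -6], [0, 6, 0, -4], [3, 0, 6, 0, -1], [0, 9, 0, -6, 0, -9], [3, 0, 3, 0, -12],
  [0, 3, 0, 0, 0, 3], [], [0, 0, 0, -2], [0, 0, 0, 0, 1]]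

def mainStar002 : List (List ℤ) :=
  [[0, 0, -9], [0, 3, 0, 3], [6, 0, 30, 0, -18], [0, 12, 0, -26], [0, 0, -3, 0, 4], [0, 22, 0, 0,
  0, -18], [6, 0, -2, 0, -24], [0, 0, 0, 6, 0, 6], [0, 0, 9], [0, -3, 0, -7], [0, 0, 0, 0, 2],
  [0, 2], [0, 0, -1]]

def mainStar011 : List (List ℤ) :=
  [[0, 0, 3, 0, -6], [0, 9, 0, -7], [6, 0, 6, 0, -4], [0, 9, 0, -6, 0, -9], [0, 0, 3, 0, -9], [0,
  0, 0, 3, 0, 3], [], [0, 0, 0, -2], [0, 0, 0, 0, 1]]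

def mainStar012 : List (List ℤ) :=
  [[0, 3], [3, 0, 9], [0, 10], [3, 0, 1], [0, 6, 0, 9], [0, 0, 9], [0, -3, 0, -3], [], [0, 2],
  [0, 0, -1]]

def mainStar022 : List (List ℤ) :=
  [[0, 0, 9], [0, 3, 0, -9], [0, 0, -18], [0, 8, 0, 6], [6, 0, 5, 0, -12], [0, 0, 0, -4], [0, 0,
  18, 0, 2], [0, 3, 0, -6, 0, -9], [0, 0, 0, 0, -9], [0, 4, 0, 3, 0, 3], [0, 0, -2], [0, 0, 0,
  -2], [0, 0, 0, 0, 1]]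

def mainStar112 : List (List ℤ) :=
  [[0, 3], [1, 0, -3], [0, -2], [2], [0, -1]]

def mainEdge000 : List (List ℤ) :=
  [[0, 0, -6, 0, -6], [0, 12, 0, -4], [12, 0, 21, 0, -10], [0, 12, 0, -21, 0, -9], [0, 0, 0, 0,
  -9], [0, 6, 0, 3, 0, 3], [0, 0, -3], [0, 0, 0, -2], [0, 0, 0, 0, 1]]

def mainEdge002 : List (List ℤ) :=
  [[0, 0, 9], [0, 3, 0, -9], [0, 0, -12], [0, 10], [6, 0, -5, 0, -6], [], [0, 0, 9], [0, -3, 0,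
  -3], [], [0, 2], [0, 0, -1]]

def mainEdge010 : List (List ℤ) :=
  [[0, 0, -9], [0, 3, 0, 3], [6, 0, 18, 0, -12], [0, 9, 0, -19], [3, 0, 3, 0, -1], [0, 12, 0, -3,
  0, -9], [0, 0, 0, 0, -9], [0, 0, 0, 3, 0, 3], [], [0, 0, 0, -2], [0, 0, 0, 0, 1]]

def mainEdge012 : List (List ℤ) :=
  [[0, 0, 9], [0, 3, 0, -9], [0, 0, -12], [0, 7, 0, 3], [3, 0, -5, 0, -3], [0, -3, 0, 3], [0, 0,
  9], [0, -3, 0, -3], [], [0, 2], [0, 0, -1]]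

def mainEdge110 : List (List ℤ) :=
  [[0, 0, -9], [0, 3, 0, 3], [6, 0, 18, 0, -12], [0, 6, 0, -16], [0, 0, 3, 0, 2], [0, 9, 0, 0, 0,
  -9], [0, 0, 0, 0, -9], [0, 0, 0, 3, 0, 3], [], [0, 0, 0, -2], [0, 0, 0, 0, 1]]

def mainEdge112 : List (List ℤ) :=
  [[0, 12], [4, 0, -12], [0, -11], [7, 0, 3], [0, -2], [-2], [0, 1]]

def mainPath000 : List (List ℤ) :=
  [[0, 0, -3], [0, 1, 0, 1], [2, 0, 5, 0, -2], [0, 1, 0, -5], [0, 0, -1], [0, 2], [0, 0, -1]]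

/-- The polynomials whose signs decide the main certificate. -/
def mainPolys : List (List (List ℤ)) :=
  [mainStar000, mainStar001, mainStar002, mainStar011, mainStar012, mainStar022, mainStar112,
  mainEdge000, mainEdge002, mainEdge010, mainEdge012, mainEdge110, mainEdge112, mainPath000]

/-- The local view sums of the main certificate. -/
abbrev mainView (B lam : ℝ) (a₁₂ a₁₃ a₂₃ : Bool) (k₁ k₂ k₃ : ℕ) : ℝ :=
  viewSum B lam (mainD B lam) (centerZ B lam) (centerN B lam) (mainPsi B lam) a₁₂ a₁₃ a₂₃ k₁ k₂ k₃

/-- This is the pattern for all views that are not tight: substituting `D` and ψ makes the view sum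
factor. The factors vanish at least to third order at `B = 1`, where the spins are independent, and
only the sign of the last polynomial depends on the region. -/
theorem mainViewStar000_nonneg {B lam : ℝ} (hB : B ∈ Set.Icc (0 : ℝ) 1)
    (hlam : lam ∈ Set.Icc (0 : ℝ) 1)
    (h : ∀ P ∈ mainPolys, 0 ≤ evalLists B lam P) :
    0 ≤ mainView B lam false false false 0 0 0 := by
  obtain ⟨⟨hB₀, hB₁⟩, hl₀, hl₁⟩ := And.intro hB hlam
  rw [← sub_nonneg] at hB₁ hl₁
  have hP := h mainStar000 (by simp [mainPolys])
  have e : mainView B lam false false false 0 0 0 =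
      B ^ 3 * 3 * B * lam ^ 3 * (1 - B) ^ 3 * (1 + B) ^ 3 * (1 - lam) * (1 + lam) * (1 + B * lam)
      * (B + lam) * (1 + B ^ 3 * lam) * (B ^ 3 + lam) * evalLists B lam mainStar000 := by
    rw [mainView, viewSumStar000]
    simp only [mainD, mainPsi, centerZ, centerN, mainStar000, evalLists, evalList]
    push_cast
    ring
  rw [e]
  positivity

theorem mainViewStar001_nonneg {B lam : ℝ} (hB : B ∈ Set.Icc (0 : ℝ) 1)
    (hlam : lam ∈ Set.Icc (0 : ℝ) 1)
    (h : ∀ P ∈ mainPolys, 0 ≤ evalLists B lam P) :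
    0 ≤ mainView B lam false false false 0 0 1 := by
  obtain ⟨⟨hB₀, hB₁⟩, hl₀, hl₁⟩ := And.intro hB hlam
  rw [← sub_nonneg] at hB₁ hl₁
  have hP := h mainStar001 (by simp [mainPolys])
  have e : mainView B lam false false false 0 0 1 =
      B ^ 5 * 2 * B * lam ^ 3 * (1 - B) ^ 3 * (1 + B) ^ 3 * (1 + B * lam) * (B + lam) * (1 + B ^
      3 * lam) * (B ^ 3 + lam) * evalLists B lam mainStar001 := by
    rw [mainView, viewSumStar001]
    simp only [mainD, mainPsi, centerZ, centerN, mainStar001, evalLists, evalList]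
    push_cast
    ring
  rw [e]
  positivity

theorem mainViewStar002_nonneg {B lam : ℝ} (hB : B ∈ Set.Icc (0 : ℝ) 1)
    (hlam : lam ∈ Set.Icc (0 : ℝ) 1)
    (h : ∀ P ∈ mainPolys, 0 ≤ evalLists B lam P) :
    0 ≤ mainView B lam false false false 0 0 2 := by
  obtain ⟨⟨hB₀, hB₁⟩, hl₀, hl₁⟩ := And.intro hB hlam
  rw [← sub_nonneg] at hB₁ hl₁
  have hP := h mainStar002 (by simp [mainPolys])
  have e : mainView B lam false false false 0 0 2 =
      B ^ 6 * lam ^ 3 * (1 - B) ^ 3 * (1 + B) ^ 3 * (1 + B * lam) * (B + lam) * (1 + B ^ 3 * lam)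
      * (B ^ 3 + lam) * evalLists B lam mainStar002 := by
    rw [mainView, viewSumStar002]
    simp only [mainD, mainPsi, centerZ, centerN, mainStar002, evalLists, evalList]
    push_cast
    ring
  rw [e]
  positivity

theorem mainViewStar011_nonneg {B lam : ℝ} (hB : B ∈ Set.Icc (0 : ℝ) 1)
    (hlam : lam ∈ Set.Icc (0 : ℝ) 1)
    (h : ∀ P ∈ mainPolys, 0 ≤ evalLists B lam P) :
    0 ≤ mainView B lam false false false 0 1 1 := by
  obtain ⟨⟨hB₀, hB₁⟩, hl₀, hl₁⟩ := And.intro hB hlam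
  rw [← sub_nonneg] at hB₁ hl₁
  have hP := h mainStar011 (by simp [mainPolys])
  have e : mainView B lam false false false 0 1 1 =
      B ^ 7 * B * lam ^ 3 * (1 - B) ^ 3 * (1 + B) ^ 3 * (1 + B * lam) * (B + lam) * (1 + B ^ 3 *
      lam) * (B ^ 3 + lam) * evalLists B lam mainStar011 := by
    rw [mainView, viewSumStar011]
    simp only [mainD, mainPsi, centerZ, centerN, mainStar011, evalLists, evalList]
    push_cast
    ring
  rw [e]
  positivity

theorem mainViewStar012_nonneg {B lam : ℝ} (hB : B ∈ Set.Icc (0 : ℝ) 1)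
    (hlam : lam ∈ Set.Icc (0 : ℝ) 1)
    (h : ∀ P ∈ mainPolys, 0 ≤ evalLists B lam P) :
    0 ≤ mainView B lam false false false 0 1 2 := by
  obtain ⟨⟨hB₀, hB₁⟩, hl₀, hl₁⟩ := And.intro hB hlam
  rw [← sub_nonneg] at hB₁ hl₁
  have hP := h mainStar012 (by simp [mainPolys])
  have e : mainView B lam false false false 0 1 2 =
      B ^ 8 * B * lam ^ 3 * (1 - B) ^ 3 * (1 + B) ^ 3 * (1 - lam) * (1 + lam) * (1 + B * lam) *
      (B + lam) * (1 + B ^ 3 * lam) * (B ^ 3 + lam) * evalLists B lam mainStar012 := by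
    rw [mainView, viewSumStar012]
    simp only [mainD, mainPsi, centerZ, centerN, mainStar012, evalLists, evalList]
    push_cast
    ring
  rw [e]
  positivity

theorem mainViewStar022_nonneg {B lam : ℝ} (hB : B ∈ Set.Icc (0 : ℝ) 1)
    (hlam : lam ∈ Set.Icc (0 : ℝ) 1)
    (h : ∀ P ∈ mainPolys, 0 ≤ evalLists B lam P) :
    0 ≤ mainView B lam false false false 0 2 2 := by
  obtain ⟨⟨hB₀, hB₁⟩, hl₀, hl₁⟩ := And.intro hB hlam
  rw [← sub_nonneg] at hB₁ hl₁
  have hP := h mainStar022 (by simp [mainPolys])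
  have e : mainView B lam false false false 0 2 2 =
      B ^ 8 * lam ^ 3 * (1 - B) ^ 3 * (1 + B) ^ 3 * (1 + B * lam) * (B + lam) * (1 + B ^ 3 * lam)
      * (B ^ 3 + lam) * evalLists B lam mainStar022 := by
    rw [mainView, viewSumStar022]
    simp only [mainD, mainPsi, centerZ, centerN, mainStar022, evalLists, evalList]
    push_cast
    ring
  rw [e]
  positivity

/-- Tight view. The vanishing of the stars `111` and `222` and of the edge view `111` gives the
three equations met by `mainPsi`. -/
theorem mainViewStar111_nonneg (B lam : ℝ) : 0 ≤ mainView B lam false false false 1 1 1 := by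
  refine le_of_eq ?_
  rw [mainView, viewSumStar111]
  simp only [mainD, mainPsi, centerZ, centerN]
  ring

theorem mainViewStar112_nonneg {B lam : ℝ} (hB : B ∈ Set.Icc (0 : ℝ) 1)
    (hlam : lam ∈ Set.Icc (0 : ℝ) 1)
    (h : ∀ P ∈ mainPolys, 0 ≤ evalLists B lam P) :
    0 ≤ mainView B lam false false false 1 1 2 := by
  obtain ⟨⟨hB₀, hB₁⟩, hl₀, hl₁⟩ := And.intro hB hlam
  rw [← sub_nonneg] at hB₁ hl₁
  have hP := h mainStar112 (by simp [mainPolys])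
  have e : mainView B lam false false false 1 1 2 =
      B ^ 9 * B * lam ^ 4 * (1 - B) ^ 5 * (1 + B) ^ 5 * (1 + B * lam) * (B + lam) * (1 + B ^ 3 *
      lam) * (B ^ 3 + lam) * evalLists B lam mainStar112 := by
    rw [mainView, viewSumStar112]
    simp only [mainD, mainPsi, centerZ, centerN, mainStar112, evalLists, evalList]
    push_cast
    ring
  rw [e]
  positivity

theorem mainViewStar122_nonneg {B lam : ℝ} (hB : B ∈ Set.Icc (0 : ℝ) 1)
    (hlam : lam ∈ Set.Icc (0 : ℝ) 1)
    (h : ∀ P ∈ mainPolys, 0 ≤ evalLists B lam P) :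
    0 ≤ mainView B lam false false false 1 2 2 := by
  obtain ⟨⟨hB₀, hB₁⟩, hl₀, hl₁⟩ := And.intro hB hlam
  rw [← sub_nonneg] at hB₁ hl₁
  have hP := h mainStar112 (by simp [mainPolys])
  have e : mainView B lam false false false 1 2 2 =
      B ^ 9 * 2 * B * lam ^ 4 * (1 - B) ^ 5 * (1 + B) ^ 5 * (1 + B * lam) * (B + lam) * (1 + B ^
      3 * lam) * (B ^ 3 + lam) * evalLists B lam mainStar112 := by
    rw [mainView, viewSumStar122]
    simp only [mainD, mainPsi, centerZ, centerN, mainStar112, evalLists, evalList]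
    push_cast
    ring
  rw [e]
  positivity

theorem mainViewStar222_nonneg (B lam : ℝ) : 0 ≤ mainView B lam false false false 2 2 2 := by
  refine le_of_eq ?_
  rw [mainView, viewSumStar222]
  simp only [mainD, mainPsi, centerZ, centerN]
  ring

theorem mainViewEdge000_nonneg {B lam : ℝ} (hB : B ∈ Set.Icc (0 : ℝ) 1)
    (hlam : lam ∈ Set.Icc (0 : ℝ) 1)
    (h : ∀ P ∈ mainPolys, 0 ≤ evalLists B lam P) :
    0 ≤ mainView B lam true false false 0 0 0 := by
  obtain ⟨⟨hB₀, hB₁⟩, hl₀, hl₁⟩ := And.intro hB hlam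
  rw [← sub_nonneg] at hB₁ hl₁
  have hP := h mainEdge000 (by simp [mainPolys])
  have e : mainView B lam true false false 0 0 0 =
      B ^ 5 * B * lam ^ 3 * (1 - B) ^ 3 * (1 + B) ^ 3 * (1 + B * lam) * (B + lam) * (1 + B ^ 3 *
      lam) * (B ^ 3 + lam) * evalLists B lam mainEdge000 := by
    rw [mainView, viewSumEdge000]
    simp only [mainD, mainPsi, centerZ, centerN, mainEdge000, evalLists, evalList]
    push_cast
    ring
  rw [e]
  positivity

/-- For this view, and for the edge view `011` and the path view `001`, the remaining factor is
itself a product with evident sign on the unit square, so no polynomial has to be certified. -/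
theorem mainViewEdge001_nonneg {B lam : ℝ} (hB : B ∈ Set.Icc (0 : ℝ) 1)
    (hlam : lam ∈ Set.Icc (0 : ℝ) 1) :
    0 ≤ mainView B lam true false false 0 0 1 := by
  obtain ⟨⟨hB₀, hB₁⟩, hl₀, hl₁⟩ := And.intro hB hlam
  rw [← sub_nonneg] at hB₁ hl₁
  have e : mainView B lam true false false 0 0 1 =
      B ^ 7 * 2 * 3 * B ^ 2 * lam ^ 3 * (1 - B) ^ 3 * (1 + B) ^ 3 * (1 - lam) * (1 + lam) * (1 +
      B * lam) ^ 2 * (B + lam) ^ 2 * (1 + B ^ 3 * lam) * (B ^ 3 + lam) := by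
    rw [mainView, viewSumEdge001]
    simp only [mainD, mainPsi, centerZ, centerN]
    ring
  rw [e]
  positivity

theorem mainViewEdge002_nonneg {B lam : ℝ} (hB : B ∈ Set.Icc (0 : ℝ) 1)
    (hlam : lam ∈ Set.Icc (0 : ℝ) 1)
    (h : ∀ P ∈ mainPolys, 0 ≤ evalLists B lam P) :
    0 ≤ mainView B lam true false false 0 0 2 := by
  obtain ⟨⟨hB₀, hB₁⟩, hl₀, hl₁⟩ := And.intro hB hlam
  rw [← sub_nonneg] at hB₁ hl₁
  have hP := h mainEdge002 (by simp [mainPolys])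
  have e : mainView B lam true false false 0 0 2 =
      B ^ 8 * lam ^ 3 * (1 - B) ^ 3 * (1 + B) ^ 3 * (1 + B * lam) * (B + lam) * (1 + B ^ 3 * lam)
      * (B ^ 3 + lam) * evalLists B lam mainEdge002 := by
    rw [mainView, viewSumEdge002]
    simp only [mainD, mainPsi, centerZ, centerN, mainEdge002, evalLists, evalList]
    push_cast
    ring
  rw [e]
  positivity

theorem mainViewEdge010_nonneg {B lam : ℝ} (hB : B ∈ Set.Icc (0 : ℝ) 1)
    (hlam : lam ∈ Set.Icc (0 : ℝ) 1)
    (h : ∀ P ∈ mainPolys, 0 ≤ evalLists B lam P) :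
    0 ≤ mainView B lam true false false 0 1 0 := by
  obtain ⟨⟨hB₀, hB₁⟩, hl₀, hl₁⟩ := And.intro hB hlam
  rw [← sub_nonneg] at hB₁ hl₁
  have hP := h mainEdge010 (by simp [mainPolys])
  have e : mainView B lam true false false 0 1 0 =
      B ^ 6 * lam ^ 3 * (1 - B) ^ 3 * (1 + B) ^ 3 * (1 + B * lam) * (B + lam) * (1 + B ^ 3 * lam)
      * (B ^ 3 + lam) * evalLists B lam mainEdge010 := by
    rw [mainView, viewSumEdge010]
    simp only [mainD, mainPsi, centerZ, centerN, mainEdge010, evalLists, evalList]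
    push_cast
    ring
  rw [e]
  positivity

theorem mainViewEdge011_nonneg {B lam : ℝ} (hB : B ∈ Set.Icc (0 : ℝ) 1)
    (hlam : lam ∈ Set.Icc (0 : ℝ) 1) :
    0 ≤ mainView B lam true false false 0 1 1 := by
  obtain ⟨⟨hB₀, hB₁⟩, hl₀, hl₁⟩ := And.intro hB hlam
  rw [← sub_nonneg] at hB₁ hl₁
  have e : mainView B lam true false false 0 1 1 =
      B ^ 8 * 3 * B * lam ^ 3 * (1 - B) ^ 3 * (1 + B) ^ 3 * (1 - lam) * (1 + lam) * (1 + B * lam)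
      ^ 2 * (B + lam) ^ 2 * (1 + B ^ 3 * lam) * (B ^ 3 + lam) := by
    rw [mainView, viewSumEdge011]
    simp only [mainD, mainPsi, centerZ, centerN]
    ring
  rw [e]
  positivity

theorem mainViewEdge012_nonneg {B lam : ℝ} (hB : B ∈ Set.Icc (0 : ℝ) 1)
    (hlam : lam ∈ Set.Icc (0 : ℝ) 1)
    (h : ∀ P ∈ mainPolys, 0 ≤ evalLists B lam P) :
    0 ≤ mainView B lam true false false 0 1 2 := by
  obtain ⟨⟨hB₀, hB₁⟩, hl₀, hl₁⟩ := And.intro hB hlam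
  rw [← sub_nonneg] at hB₁ hl₁
  have hP := h mainEdge012 (by simp [mainPolys])
  have e : mainView B lam true false false 0 1 2 =
      B ^ 8 * lam ^ 3 * (1 - B) ^ 3 * (1 + B) ^ 3 * (1 + B * lam) * (B + lam) * (1 + B ^ 3 * lam)
      * (B ^ 3 + lam) * evalLists B lam mainEdge012 := by
    rw [mainView, viewSumEdge012]
    simp only [mainD, mainPsi, centerZ, centerN, mainEdge012, evalLists, evalList]
    push_cast
    ring
  rw [e]
  positivity

theorem mainViewEdge110_nonneg {B lam : ℝ} (hB : B ∈ Set.Icc (0 : ℝ) 1)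
    (hlam : lam ∈ Set.Icc (0 : ℝ) 1)
    (h : ∀ P ∈ mainPolys, 0 ≤ evalLists B lam P) :
    0 ≤ mainView B lam true false false 1 1 0 := by
  obtain ⟨⟨hB₀, hB₁⟩, hl₀, hl₁⟩ := And.intro hB hlam
  rw [← sub_nonneg] at hB₁ hl₁
  have hP := h mainEdge110 (by simp [mainPolys])
  have e : mainView B lam true false false 1 1 0 =
      B ^ 8 * lam ^ 3 * (1 - B) ^ 3 * (1 + B) ^ 3 * (1 + B * lam) * (B + lam) * (1 + B ^ 3 * lam)
      * (B ^ 3 + lam) * evalLists B lam mainEdge110 := by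
    rw [mainView, viewSumEdge110]
    simp only [mainD, mainPsi, centerZ, centerN, mainEdge110, evalLists, evalList]
    push_cast
    ring
  rw [e]
  positivity

theorem mainViewEdge111_nonneg (B lam : ℝ) : 0 ≤ mainView B lam true false false 1 1 1 := by
  refine le_of_eq ?_
  rw [mainView, viewSumEdge111]
  simp only [mainD, mainPsi, centerZ, centerN]
  ring

theorem mainViewEdge112_nonneg {B lam : ℝ} (hB : B ∈ Set.Icc (0 : ℝ) 1)
    (hlam : lam ∈ Set.Icc (0 : ℝ) 1)
    (h : ∀ P ∈ mainPolys, 0 ≤ evalLists B lam P) :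
    0 ≤ mainView B lam true false false 1 1 2 := by
  obtain ⟨⟨hB₀, hB₁⟩, hl₀, hl₁⟩ := And.intro hB hlam
  rw [← sub_nonneg] at hB₁ hl₁
  have hP := h mainEdge112 (by simp [mainPolys])
  have e : mainView B lam true false false 1 1 2 =
      B ^ 9 * B * lam ^ 4 * (1 - B) ^ 4 * (1 + B) ^ 4 * (1 + B * lam) * (B + lam) * (1 + B ^ 3 *
      lam) * (B ^ 3 + lam) * evalLists B lam mainEdge112 := by
    rw [mainView, viewSumEdge112]
    simp only [mainD, mainPsi, centerZ, centerN, mainEdge112, evalLists, evalList]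
    push_cast
    ring
  rw [e]
  positivity

theorem mainViewPath000_nonneg {B lam : ℝ} (hB : B ∈ Set.Icc (0 : ℝ) 1)
    (hlam : lam ∈ Set.Icc (0 : ℝ) 1)
    (h : ∀ P ∈ mainPolys, 0 ≤ evalLists B lam P) :
    0 ≤ mainView B lam true false true 0 0 0 := by
  obtain ⟨⟨hB₀, hB₁⟩, hl₀, hl₁⟩ := And.intro hB hlam
  rw [← sub_nonneg] at hB₁ hl₁
  have hP := h mainPath000 (by simp [mainPolys])
  have e : mainView B lam true false true 0 0 0 =
      B ^ 6 * 3 * lam ^ 3 * (1 - B) ^ 3 * (1 + B) ^ 3 * (1 + B * lam) * (B + lam) * (1 + B ^ 3 *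
      lam) * (B ^ 3 + lam) * evalLists B lam mainPath000 := by
    rw [mainView, viewSumPath000]
    simp only [mainD, mainPsi, centerZ, centerN, mainPath000, evalLists, evalList]
    push_cast
    ring
  rw [e]
  positivity

theorem mainViewPath001_nonneg {B lam : ℝ} (hB : B ∈ Set.Icc (0 : ℝ) 1)
    (hlam : lam ∈ Set.Icc (0 : ℝ) 1) :
    0 ≤ mainView B lam true false true 0 0 1 := by
  obtain ⟨⟨hB₀, hB₁⟩, hl₀, hl₁⟩ := And.intro hB hlam
  rw [← sub_nonneg] at hB₁ hl₁
  have e : mainView B lam true false true 0 0 1 =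
      B ^ 8 * 3 * B * lam ^ 3 * (1 - B) ^ 3 * (1 + B) ^ 3 * (1 - lam) * (1 + lam) * (1 + B * lam)
      ^ 2 * (B + lam) ^ 2 * (1 + B ^ 3 * lam) * (B ^ 3 + lam) := by
    rw [mainView, viewSumPath001]
    simp only [mainD, mainPsi, centerZ, centerN]
    ring
  rw [e]
  positivity

theorem mainViewPath101_nonneg {B lam : ℝ} (hB : B ∈ Set.Icc (0 : ℝ) 1)
    (hlam : lam ∈ Set.Icc (0 : ℝ) 1)
    (h : ∀ P ∈ mainPolys, 0 ≤ evalLists B lam P) :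
    0 ≤ mainView B lam true false true 1 0 1 := by
  obtain ⟨⟨hB₀, hB₁⟩, hl₀, hl₁⟩ := And.intro hB hlam
  rw [← sub_nonneg] at hB₁ hl₁
  have hP := h mainStar112 (by simp [mainPolys])
  have e : mainView B lam true false true 1 0 1 =
      B ^ 8 * 3 * lam ^ 4 * (1 - B) ^ 4 * (1 + B) ^ 4 * (1 + B * lam) * (B + lam) * (1 + B ^ 3 *
      lam) * (B ^ 3 + lam) * evalLists B lam mainStar112 := by
    rw [mainView, viewSumPath101]
    simp only [mainD, mainPsi, centerZ, centerN, mainStar112, evalLists, evalList]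
    push_cast
    ring
  rw [e]
  positivity

/-- Tightness is forced by the choice of `z` and `c` as the partition function and the plus
contribution of `K₄`, both divided by `B ^ 2`. -/
theorem mainViewTriangle000_nonneg (B lam : ℝ) : 0 ≤ mainView B lam true true true 0 0 0 := by
  refine le_of_eq ?_
  rw [mainView, viewSumTriangle000]
  simp only [mainD, centerZ, centerN]
  ring

theorem viewsNonneg_main {B lam : ℝ} (hB : B ∈ Set.Icc (0 : ℝ) 1)
    (hlam : lam ∈ Set.Icc (0 : ℝ) 1) (h : ∀ P ∈ mainPolys, 0 ≤ evalLists B lam P) :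
    ViewsNonneg B lam (mainD B lam) (centerZ B lam) (centerN B lam) (mainPsi B lam) := by
  refine viewsNonneg_of_canonical ?_ ?_ ?_ ?_
  · intro k₁ k₂ k₃ h₁ h₂ h₃
    interval_cases k₃ <;> interval_cases k₂ <;> interval_cases k₁
    · exact mainViewStar000_nonneg hB hlam h
    · exact mainViewStar001_nonneg hB hlam h
    · exact mainViewStar011_nonneg hB hlam h
    · exact mainViewStar111_nonneg _ _
    · exact mainViewStar002_nonneg hB hlam h
    · exact mainViewStar012_nonneg hB hlam h
    · exact mainViewStar112_nonneg hB hlam h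
    · exact mainViewStar022_nonneg hB hlam h
    · exact mainViewStar122_nonneg hB hlam h
    · exact mainViewStar222_nonneg _ _
  · intro k₁ k₂ k₃ h₁ h₂ h₃
    interval_cases k₃ <;> interval_cases k₂ <;> interval_cases k₁
    · exact mainViewEdge000_nonneg hB hlam h
    · exact mainViewEdge010_nonneg hB hlam h
    · exact mainViewEdge110_nonneg hB hlam h
    · exact mainViewEdge001_nonneg hB hlam
    · exact mainViewEdge011_nonneg hB hlam
    · exact mainViewEdge111_nonneg _ _
    · exact mainViewEdge002_nonneg hB hlam h
    · exact mainViewEdge012_nonneg hB hlam h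
    · exact mainViewEdge112_nonneg hB hlam h
  · intro k₁ k₃ h₁ h₃
    interval_cases k₃ <;> interval_cases k₁
    · exact mainViewPath000_nonneg hB hlam h
    · exact mainViewPath001_nonneg hB hlam
    · exact mainViewPath101_nonneg hB hlam h
  · exact mainViewTriangle000_nonneg _ _

end Certificates

/-! ### A second dual certificate, for region 8 -/

section StripCertificate

/-- The multiplier of the occupation of the centre in the strip certificate. -/
def stripD (B lam : ℝ) : ℝ :=
  2 * 3 * lam * (1 + B * lam) * (B + lam) * (1 + B ^ 3 * lam) ^ 2 * (B ^ 3 + lam)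

/-- The potential of the strip certificate. -/
def stripPsi (B lam : ℝ) : ℕ → ℝ
  | 0 =>
    (1 - B) ^ 2 * (1 + B) ^ 2 * (1 + B * lam) * (B + lam) * (-6 * lam ^ 4 - 6 * B * lam ^ 3 - 2 *
    B * lam ^ 5 - 12 * B ^ 2 * lam ^ 4 - 12 * B ^ 3 * lam ^ 3 - 16 * B ^ 3 * lam ^ 5 + 12 * B ^ 4
    * lam ^ 2 - 14 * B ^ 4 * lam ^ 4 + 2 * B ^ 4 * lam ^ 6 - 9 * B ^ 5 * lam + 3 * B ^ 5 * lam ^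
    3 - 15 * B ^ 5 * lam ^ 5 + 3 * B ^ 6 - 15 * B ^ 6 * lam ^ 2 - 20 * B ^ 6 * lam ^ 4 - 17 * B ^
    6 * lam ^ 6 + 9 * B ^ 7 * lam + 18 * B ^ 7 * lam ^ 3 - 16 * B ^ 7 * lam ^ 5 + 5 * B ^ 7 * lam
    ^ 7 - 9 * B ^ 8 * lam ^ 2 + 3 * B ^ 9 * lam - 18 * B ^ 9 * lam ^ 3 - 11 * B ^ 9 * lam ^ 5 - 6
    * B ^ 9 * lam ^ 7 + 6 * B ^ 10 * lam ^ 2 + 5 * B ^ 10 * lam ^ 4 - 5 * B ^ 10 * lam ^ 6 + 3 *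
    B ^ 10 * lam ^ 8 - 6 * B ^ 11 * lam ^ 3 + 3 * B ^ 11 * lam ^ 5 + 3 * B ^ 11 * lam ^ 7 - B ^
    12 * lam ^ 4 - 4 * B ^ 12 * lam ^ 6 + B ^ 13 * lam ^ 7)
  | 1 =>
    (1 - B) ^ 2 * (1 + B) ^ 2 * (1 + B * lam) * (B ^ 3 + lam) * (3 * lam ^ 2 - 6 * lam ^ 4 - 3 *
    B * lam - 3 * B * lam ^ 3 - 4 * B * lam ^ 5 - 3 * B ^ 2 * lam ^ 2 - 11 * B ^ 2 * lam ^ 4 - 6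
    * B ^ 3 * lam - 9 * B ^ 3 * lam ^ 3 - 11 * B ^ 3 * lam ^ 5 + 3 * B ^ 4 - 9 * B ^ 4 * lam ^ 2
    + B ^ 4 * lam ^ 4 - 5 * B ^ 4 * lam ^ 6 + 9 * B ^ 5 * lam + 9 * B ^ 5 * lam ^ 3 - 12 * B ^ 5
    * lam ^ 5 - 6 * B ^ 6 * lam ^ 2 - 12 * B ^ 6 * lam ^ 4 - 6 * B ^ 6 * lam ^ 6 + 3 * B ^ 7 *
    lam - 12 * B ^ 7 * lam ^ 3 - 2 * B ^ 7 * lam ^ 5 - 3 * B ^ 7 * lam ^ 7 + 6 * B ^ 8 * lam ^ 2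
    + 2 * B ^ 8 * lam ^ 4 - 3 * B ^ 8 * lam ^ 6 - 6 * B ^ 9 * lam ^ 3 + 2 * B ^ 9 * lam ^ 5 - B ^
    10 * lam ^ 4 - B ^ 10 * lam ^ 6)
  | 2 =>
    (1 - B) ^ 2 * (1 + B) ^ 2 * (B + lam) * (B ^ 3 + lam) * (3 * lam ^ 3 + 3 * B * lam ^ 2 - 5 *
    B * lam ^ 4 - 9 * B ^ 2 * lam - 12 * B ^ 2 * lam ^ 3 - 2 * B ^ 2 * lam ^ 5 + 3 * B ^ 3 - 15 *
    B ^ 3 * lam ^ 2 + B ^ 3 * lam ^ 4 + 12 * B ^ 4 * lam + 3 * B ^ 4 * lam ^ 3 - 5 * B ^ 4 * lam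
    ^ 5 - 9 * B ^ 5 * lam ^ 4 + 3 * B ^ 6 * lam - 12 * B ^ 6 * lam ^ 3 - 3 * B ^ 6 * lam ^ 5 + 9
    * B ^ 7 * lam ^ 2 - 7 * B ^ 7 * lam ^ 4 - 3 * B ^ 7 * lam ^ 6 - B ^ 8 * lam ^ 5 - B ^ 9 * lam
    ^ 4 - B ^ 10 * lam ^ 5)
  | _ => 0

def stripStar000 : List (List ℤ) :=
  [[0, 0, 2, 0, -2], [], [0, 0, 6], [0, 0, 0, -1, 0, -3], [-3, 0, -6, 0, 2], [0, -3, 0, 9], [0,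
  0, -2, 0, -1], [0, -3, 0, 0, 0, 3], [0, 0, 0, 0, 3], [0, 0, 0, -2], [0, 0, 0, 0, 1]]

def stripStar001 : List (List ℤ) :=
  [[0, 0, -3], [0, 3, 0, 12, 0, -10], [0, 0, 9, 0, -3], [0, -6, 0, 15, 0, 4], [0, 0, -12, 0, 3,
  0, -15], [0, -6, 0, -15, 0, 1], [3, 0, -6, 0, 28, 0, 6], [0, 3, 0, -18, 0, 1], [0, 0, -3, 0,
  -3, 0, 6], [0, 3, 0, 3, 0, 5], [0, 0, 0, 0, -9], [0, 0, 0, 3, 0, 2], [0, 0, 0, 0, -1]]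

def stripStar002 : List (List ℤ) :=
  [[0, 0, 3], [0, 0, 0, 3, 0, -2], [-3, 0, -6, 0, 2], [0, -3, 0, 14], [0, 0, -3, 0, 0, 0, -3],
  [0, -9, 0, -12, 0, 5], [3, 0, 0, 0, 15], [0, 3, 0, -6, 0, -1], [0, 0, -6, 0, -2, 0, 3], [0, 3,
  0, 1, 0, 3], [0, 0, 0, 0, -3], [0, 0, 0, 0, 0, 1]]

def stripStar011 : List (List ℤ) :=
  [[0, 0, -3], [0, 3, 0, 6, 0, -4], [0, 0, 3, 0, -3], [0, -3, 0, 0, 0, 2], [3, 0, 3, 0, 1, 0,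
  -6], [0, 3, 0, -9, 0, -3], [0, 0, 0, 0, 6, 0, 3], [0, 3, 0, 0, 0, -2], [0, 0, 0, 0, -6], [0, 0,
  0, 3, 0, 1], [0, 0, 0, 0, -1]]

def stripStar012 : List (List ℤ) :=
  [[0, 3, 0, 3], [-3, 0, -6, 0, -1], [0, 0, 0, 7, 0, -4], [0, 0, 9], [0, -12, 0, -6, 0, 2], [6,
  0, 3, 0, 6, 0, -6], [0, 6, 0, -3, 0, -3], [0, 0, -9, 0, 1, 0, 3], [0, 6, 0, -1, 0, 1], [0, 0,
  0, 0, -3], [0, 0, 0, 0, 0, 1]]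

def stripStar022 : List (List ℤ) :=
  [[0, 3, 0, 3], [-3, 0, -3, 0, -1], [0, -3, 0, 1], [0, 0, 6, 0, 3], [0, -9, 0, -6], [3, 0, 0, 0,
  5], [0, 3, 0, 6], [0, 0, -9, 0, -5], [0, 3, 0, -1, 0, 3], [0, 0, 0, 0, 3], [0, 0, 0, -3], [0,
  0, 0, 0, 1]]

def stripStar111 : List (List ℤ) :=
  [[0, 0, -6], [0, 3, 0, 3, 0, -2], [3, 0, 9, 0, -5], [0, 3, 0, -9], [0, 0, 6, 0, 0, 0, -3], [0,
  3, 0, 3, 0, -6], [0, 0, 0, 0, -3], [0, 0, 0, 3, 0, -1], [0, 0, 0, 0, -1]]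

def stripStar112 : List (List ℤ) :=
  [[0, 0, -3], [0, 3, 0, 2], [0, 0, 0, 0, -3], [0, 0, 0, -6, 0, -2], [3, 0, 12], [0, 3, 0, 0, 0,
  -3], [0, 0, 0, 0, -6, 0, -3], [0, 3, 0, 4, 0, -3], [], [0, 0, 0, 0, 0, -1]]

def stripStar122 : List (List ℤ) :=
  [[0, 0, -3], [0, 6, 0, 5], [-3, 0, 0, 0, -4], [0, -9, 0, -12], [6, 0, 12, 0, 7], [0, 6, 0, 3,
  0, -5], [0, 0, -3, 0, -12], [0, 6, 0, 4], [0, 0, 3, 0, -2, 0, -3], [0, 0, 0, 0, 0, -3], [0, 0,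
  0, 0, 2], [0, 0, 0, 0, 0, -1]]

def stripEdge000 : List (List ℤ) :=
  [[0, -3], [3, 0, 6, 0, -4], [0, 9, 0, -3], [-6, 0, -3, 0, 4], [0, -6, 0, 6, 0, -6], [0, 0, 0,
  0, -3], [0, -6, 0, 6, 0, 6], [0, 0, -3, 0, 4], [0, 0, 0, -3], [0, 0, 0, 0, 2]]

def stripEdge001 : List (List ℤ) :=
  [[0, 0, -9], [0, 9, 0, 12, 0, -6], [0, 0, 12, 0, -9], [0, -6, 0, -12, 0, 4], [3, 0, 9, 0, 7, 0,
  -9], [0, 3, 0, -6, 0, -9], [0, 0, -3, 0, 3, 0, 6], [0, 3, 0, 3], [0, 0, 0, 0, -9], [0, 0, 0, 3,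
  0, 2], [0, 0, 0, 0, -1]]

def stripEdge002 : List (List ℤ) :=
  [[0, 3, 0, 3], [-3, 0, -6, 0, -1], [0, 3, 0, 8, 0, -2], [-3, 0, 3, 0, -1], [0, -6, 0, -1], [0,
  0, 6, 0, 5, 0, -3], [0, -3, 0, -1, 0, -3], [0, 0, 0, 0, 3], [0, 0, 0, 0, 0, -1]]

def stripEdge010 : List (List ℤ) :=
  [[0, 0, 3], [0, 0, 0, 3, 0, -2], [-3, 0, -6, 0, 2], [0, -6, 0, 9, 0, 2], [3, 0, -3, 0, 1, 0,
  -3], [0, 0, 0, -12, 0, 3], [0, 0, 0, 0, 9, 0, 3], [0, 3, 0, -3, 0, -1], [0, 0, 0, 0, -5], [0,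
  0, 0, 3, 0, 1], [0, 0, 0, 0, -1]]

def stripEdge011 : List (List ℤ) :=
  [[0, 3, 0, 3], [-3, 0, -12, 0, -1], [0, 0, 0, 3, 0, -2], [6, 0, 18, 0, -4], [0, 3, 0, -18], [0,
  0, 9, 0, 0, 0, -3], [0, 6, 0, 6, 0, -9], [0, 0, 0, 0, -8], [0, 0, 0, 6, 0, -1], [0, 0, 0, 0,
  -2]]

def stripEdge012 : List (List ℤ) :=
  [[0, 6, 0, 6], [-6, 0, -9, 0, -2], [0, -3, 0, 4], [0, 0, 9, 0, 3], [0, -12, 0, -15], [6, 0, 12,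
  0, 6], [0, 6, 0, 0, 0, -3], [0, 0, -6, 0, -10], [0, 6, 0, 5], [0, 0, 0, 0, -3]]

def stripEdge111 : List (List ℤ) :=
  [[0, 0, -9], [0, 6, 0, 3], [3, 0, 9, 0, -8], [0, 6, 0, -18, 0, -2], [0, 0, 18], [0, 3, 0, 6, 0,
  -9], [0, 0, 3, 0, -12, 0, -3], [0, 0, 0, 9, 0, -3], [0, 0, 0, 0, -1], [0, 0, 0, 0, 0, -1]]

def stripEdge112 : List (List ℤ) :=
  [[0, 0, -3], [0, 6, 0, 5], [-3, 0, 0, 0, -4], [0, -6, 0, -9], [3, 0, 12, 0, 6], [0, 0, 0, 0, 0,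
  -3], [0, 0, -3, 0, -6], [0, 3, 0, 4], [0, 0, 0, 0, -2]]

def stripPath001 : List (List ℤ) :=
  [[0, 3, 0, 3], [-3, 0, -6, 0, -1], [0, -3], [3, 0, 9, 0, 1], [0, 0, 0, -9], [0, 0, 3], [0, 3,
  0, 3, 0, -3], [0, 0, 0, 0, -5], [0, 0, 0, 3], [0, 0, 0, 0, -1]]

/-- The polynomials whose signs decide the strip certificate. -/
def stripPolys : List (List (List ℤ)) :=
  [stripStar000, stripStar001, stripStar002, stripStar011, stripStar012, stripStar022,
  stripStar111, stripStar112, stripStar122, stripEdge000, stripEdge001, stripEdge002,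
  stripEdge010, stripEdge011, stripEdge012, stripEdge111, stripEdge112, stripPath001]

/-- The local view sums of the strip certificate. -/
abbrev stripView (B lam : ℝ) (a₁₂ a₁₃ a₂₃ : Bool) (k₁ k₂ k₃ : ℕ) : ℝ :=
  viewSum B lam (stripD B lam) (centerZ B lam) (centerN B lam) (stripPsi B lam) a₁₂ a₁₃ a₂₃ k₁ k₂ k₃

theorem stripViewStar000_nonneg {B lam : ℝ} (hB : B ∈ Set.Icc (0 : ℝ) 1)
    (hlam : lam ∈ Set.Icc (0 : ℝ) 1)
    (h : ∀ P ∈ stripPolys, 0 ≤ evalLists B lam P) :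
    0 ≤ stripView B lam false false false 0 0 0 := by
  obtain ⟨⟨hB₀, hB₁⟩, hl₀, hl₁⟩ := And.intro hB hlam
  rw [← sub_nonneg] at hB₁ hl₁
  have hP := h stripStar000 (by simp [stripPolys])
  have e : stripView B lam false false false 0 0 0 =
      B ^ 3 * 2 * 3 * B * lam ^ 3 * (1 - B) ^ 3 * (1 + B) ^ 3 * (1 + B * lam) * (B + lam) * (1 +
      B ^ 3 * lam) * (B ^ 3 + lam) * evalLists B lam stripStar000 := by
    rw [stripView, viewSumStar000]
    simp only [stripD, stripPsi, centerZ, centerN, stripStar000, evalLists, evalList]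
    push_cast
    ring
  rw [e]
  positivity

theorem stripViewStar001_nonneg {B lam : ℝ} (hB : B ∈ Set.Icc (0 : ℝ) 1)
    (hlam : lam ∈ Set.Icc (0 : ℝ) 1)
    (h : ∀ P ∈ stripPolys, 0 ≤ evalLists B lam P) :
    0 ≤ stripView B lam false false false 0 0 1 := by
  obtain ⟨⟨hB₀, hB₁⟩, hl₀, hl₁⟩ := And.intro hB hlam
  rw [← sub_nonneg] at hB₁ hl₁
  have hP := h stripStar001 (by simp [stripPolys])
  have e : stripView B lam false false false 0 0 1 =
      B ^ 5 * lam ^ 2 * (1 - B) ^ 3 * (1 + B) ^ 3 * (1 + B * lam) * (B + lam) * (1 + B ^ 3 * lam)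
      * (B ^ 3 + lam) * evalLists B lam stripStar001 := by
    rw [stripView, viewSumStar001]
    simp only [stripD, stripPsi, centerZ, centerN, stripStar001, evalLists, evalList]
    push_cast
    ring
  rw [e]
  positivity

theorem stripViewStar002_nonneg {B lam : ℝ} (hB : B ∈ Set.Icc (0 : ℝ) 1)
    (hlam : lam ∈ Set.Icc (0 : ℝ) 1)
    (h : ∀ P ∈ stripPolys, 0 ≤ evalLists B lam P) :
    0 ≤ stripView B lam false false false 0 0 2 := by
  obtain ⟨⟨hB₀, hB₁⟩, hl₀, hl₁⟩ := And.intro hB hlam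
  rw [← sub_nonneg] at hB₁ hl₁
  have hP := h stripStar002 (by simp [stripPolys])
  have e : stripView B lam false false false 0 0 2 =
      B ^ 6 * 2 * B * lam ^ 2 * (1 - B) ^ 3 * (1 + B) ^ 3 * (1 + B * lam) * (B + lam) * (1 + B ^
      3 * lam) * (B ^ 3 + lam) * evalLists B lam stripStar002 := by
    rw [stripView, viewSumStar002]
    simp only [stripD, stripPsi, centerZ, centerN, stripStar002, evalLists, evalList]
    push_cast
    ring
  rw [e]
  positivity

theorem stripViewStar011_nonneg {B lam : ℝ} (hB : B ∈ Set.Icc (0 : ℝ) 1)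
    (hlam : lam ∈ Set.Icc (0 : ℝ) 1)
    (h : ∀ P ∈ stripPolys, 0 ≤ evalLists B lam P) :
    0 ≤ stripView B lam false false false 0 1 1 := by
  obtain ⟨⟨hB₀, hB₁⟩, hl₀, hl₁⟩ := And.intro hB hlam
  rw [← sub_nonneg] at hB₁ hl₁
  have hP := h stripStar011 (by simp [stripPolys])
  have e : stripView B lam false false false 0 1 1 =
      B ^ 7 * 2 * lam ^ 2 * (1 - B) ^ 3 * (1 + B) ^ 3 * (1 + B * lam) * (B + lam) * (1 + B ^ 3 *
      lam) * (B ^ 3 + lam) * evalLists B lam stripStar011 := by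
    rw [stripView, viewSumStar011]
    simp only [stripD, stripPsi, centerZ, centerN, stripStar011, evalLists, evalList]
    push_cast
    ring
  rw [e]
  positivity

theorem stripViewStar012_nonneg {B lam : ℝ} (hB : B ∈ Set.Icc (0 : ℝ) 1)
    (hlam : lam ∈ Set.Icc (0 : ℝ) 1)
    (h : ∀ P ∈ stripPolys, 0 ≤ evalLists B lam P) :
    0 ≤ stripView B lam false false false 0 1 2 := by
  obtain ⟨⟨hB₀, hB₁⟩, hl₀, hl₁⟩ := And.intro hB hlam
  rw [← sub_nonneg] at hB₁ hl₁
  have hP := h stripStar012 (by simp [stripPolys])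
  have e : stripView B lam false false false 0 1 2 =
      B ^ 8 * lam ^ 2 * (1 - B) ^ 3 * (1 + B) ^ 3 * (1 + B * lam) * (B + lam) * (1 + B ^ 3 * lam)
      * (B ^ 3 + lam) * evalLists B lam stripStar012 := by
    rw [stripView, viewSumStar012]
    simp only [stripD, stripPsi, centerZ, centerN, stripStar012, evalLists, evalList]
    push_cast
    ring
  rw [e]
  positivity

theorem stripViewStar022_nonneg {B lam : ℝ} (hB : B ∈ Set.Icc (0 : ℝ) 1)
    (hlam : lam ∈ Set.Icc (0 : ℝ) 1)
    (h : ∀ P ∈ stripPolys, 0 ≤ evalLists B lam P) :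
    0 ≤ stripView B lam false false false 0 2 2 := by
  obtain ⟨⟨hB₀, hB₁⟩, hl₀, hl₁⟩ := And.intro hB hlam
  rw [← sub_nonneg] at hB₁ hl₁
  have hP := h stripStar022 (by simp [stripPolys])
  have e : stripView B lam false false false 0 2 2 =
      B ^ 8 * 2 * lam ^ 2 * (1 - B) ^ 3 * (1 + B) ^ 3 * (1 + B * lam) * (B + lam) * (1 + B ^ 3 *
      lam) * (B ^ 3 + lam) * evalLists B lam stripStar022 := by
    rw [stripView, viewSumStar022]
    simp only [stripD, stripPsi, centerZ, centerN, stripStar022, evalLists, evalList]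
    push_cast
    ring
  rw [e]
  positivity

theorem stripViewStar111_nonneg {B lam : ℝ} (hB : B ∈ Set.Icc (0 : ℝ) 1)
    (hlam : lam ∈ Set.Icc (0 : ℝ) 1)
    (h : ∀ P ∈ stripPolys, 0 ≤ evalLists B lam P) :
    0 ≤ stripView B lam false false false 1 1 1 := by
  obtain ⟨⟨hB₀, hB₁⟩, hl₀, hl₁⟩ := And.intro hB hlam
  rw [← sub_nonneg] at hB₁ hl₁
  have hP := h stripStar111 (by simp [stripPolys])
  have e : stripView B lam false false false 1 1 1 =
      B ^ 9 * 3 * lam ^ 2 * (1 - B) ^ 3 * (1 + B) ^ 3 * (1 + B * lam) * (B + lam) * (1 + B ^ 3 *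
      lam) * (B ^ 3 + lam) * evalLists B lam stripStar111 := by
    rw [stripView, viewSumStar111]
    simp only [stripD, stripPsi, centerZ, centerN, stripStar111, evalLists, evalList]
    push_cast
    ring
  rw [e]
  positivity

theorem stripViewStar112_nonneg {B lam : ℝ} (hB : B ∈ Set.Icc (0 : ℝ) 1)
    (hlam : lam ∈ Set.Icc (0 : ℝ) 1)
    (h : ∀ P ∈ stripPolys, 0 ≤ evalLists B lam P) :
    0 ≤ stripView B lam false false false 1 1 2 := by
  obtain ⟨⟨hB₀, hB₁⟩, hl₀, hl₁⟩ := And.intro hB hlam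
  rw [← sub_nonneg] at hB₁ hl₁
  have hP := h stripStar112 (by simp [stripPolys])
  have e : stripView B lam false false false 1 1 2 =
      B ^ 9 * 2 * lam ^ 2 * (1 - B) ^ 3 * (1 + B) ^ 3 * (1 + B * lam) * (B + lam) * (1 + B ^ 3 *
      lam) * (B ^ 3 + lam) * evalLists B lam stripStar112 := by
    rw [stripView, viewSumStar112]
    simp only [stripD, stripPsi, centerZ, centerN, stripStar112, evalLists, evalList]
    push_cast
    ring
  rw [e]
  positivity

theorem stripViewStar122_nonneg {B lam : ℝ} (hB : B ∈ Set.Icc (0 : ℝ) 1)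
    (hlam : lam ∈ Set.Icc (0 : ℝ) 1)
    (h : ∀ P ∈ stripPolys, 0 ≤ evalLists B lam P) :
    0 ≤ stripView B lam false false false 1 2 2 := by
  obtain ⟨⟨hB₀, hB₁⟩, hl₀, hl₁⟩ := And.intro hB hlam
  rw [← sub_nonneg] at hB₁ hl₁
  have hP := h stripStar122 (by simp [stripPolys])
  have e : stripView B lam false false false 1 2 2 =
      B ^ 9 * lam ^ 2 * (1 - B) ^ 3 * (1 + B) ^ 3 * (1 + B * lam) * (B + lam) * (1 + B ^ 3 * lam)
      * (B ^ 3 + lam) * evalLists B lam stripStar122 := by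
    rw [stripView, viewSumStar122]
    simp only [stripD, stripPsi, centerZ, centerN, stripStar122, evalLists, evalList]
    push_cast
    ring
  rw [e]
  positivity

/-- Besides the triangle, the tight views are now the star `222`, the edge view `110` and the path
view `000`. The change is needed because `mainPath000` is negative at some points of `minRegion8`,
for instance at `(3/10, 171/500)`. -/
theorem stripViewStar222_nonneg (B lam : ℝ) : 0 ≤ stripView B lam false false false 2 2 2 := by
  refine le_of_eq ?_
  rw [stripView, viewSumStar222]
  simp only [stripD, stripPsi, centerZ, centerN]
  ring

theorem stripViewEdge000_nonneg {B lam : ℝ} (hB : B ∈ Set.Icc (0 : ℝ) 1)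
    (hlam : lam ∈ Set.Icc (0 : ℝ) 1)
    (h : ∀ P ∈ stripPolys, 0 ≤ evalLists B lam P) :
    0 ≤ stripView B lam true false false 0 0 0 := by
  obtain ⟨⟨hB₀, hB₁⟩, hl₀, hl₁⟩ := And.intro hB hlam
  rw [← sub_nonneg] at hB₁ hl₁
  have hP := h stripEdge000 (by simp [stripPolys])
  have e : stripView B lam true false false 0 0 0 =
      B ^ 5 * 2 * lam ^ 3 * (1 - B) ^ 3 * (1 + B) ^ 3 * (1 + B * lam) * (B + lam) * (1 + B ^ 3 *
      lam) * (B ^ 3 + lam) * evalLists B lam stripEdge000 := by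
    rw [stripView, viewSumEdge000]
    simp only [stripD, stripPsi, centerZ, centerN, stripEdge000, evalLists, evalList]
    push_cast
    ring
  rw [e]
  positivity

theorem stripViewEdge001_nonneg {B lam : ℝ} (hB : B ∈ Set.Icc (0 : ℝ) 1)
    (hlam : lam ∈ Set.Icc (0 : ℝ) 1)
    (h : ∀ P ∈ stripPolys, 0 ≤ evalLists B lam P) :
    0 ≤ stripView B lam true false false 0 0 1 := by
  obtain ⟨⟨hB₀, hB₁⟩, hl₀, hl₁⟩ := And.intro hB hlam
  rw [← sub_nonneg] at hB₁ hl₁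
  have hP := h stripEdge001 (by simp [stripPolys])
  have e : stripView B lam true false false 0 0 1 =
      B ^ 7 * lam ^ 2 * (1 - B) ^ 3 * (1 + B) ^ 3 * (1 + B * lam) * (B + lam) * (1 + B ^ 3 * lam)
      * (B ^ 3 + lam) * evalLists B lam stripEdge001 := by
    rw [stripView, viewSumEdge001]
    simp only [stripD, stripPsi, centerZ, centerN, stripEdge001, evalLists, evalList]
    push_cast
    ring
  rw [e]
  positivity

theorem stripViewEdge002_nonneg {B lam : ℝ} (hB : B ∈ Set.Icc (0 : ℝ) 1)
    (hlam : lam ∈ Set.Icc (0 : ℝ) 1)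
    (h : ∀ P ∈ stripPolys, 0 ≤ evalLists B lam P) :
    0 ≤ stripView B lam true false false 0 0 2 := by
  obtain ⟨⟨hB₀, hB₁⟩, hl₀, hl₁⟩ := And.intro hB hlam
  rw [← sub_nonneg] at hB₁ hl₁
  have hP := h stripEdge002 (by simp [stripPolys])
  have e : stripView B lam true false false 0 0 2 =
      B ^ 8 * 2 * lam ^ 2 * (1 - B) ^ 4 * (1 + B) ^ 4 * (1 + B * lam) * (B + lam) * (1 + B ^ 3 *
      lam) * (B ^ 3 + lam) * evalLists B lam stripEdge002 := by
    rw [stripView, viewSumEdge002]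
    simp only [stripD, stripPsi, centerZ, centerN, stripEdge002, evalLists, evalList]
    push_cast
    ring
  rw [e]
  positivity

theorem stripViewEdge010_nonneg {B lam : ℝ} (hB : B ∈ Set.Icc (0 : ℝ) 1)
    (hlam : lam ∈ Set.Icc (0 : ℝ) 1)
    (h : ∀ P ∈ stripPolys, 0 ≤ evalLists B lam P) :
    0 ≤ stripView B lam true false false 0 1 0 := by
  obtain ⟨⟨hB₀, hB₁⟩, hl₀, hl₁⟩ := And.intro hB hlam
  rw [← sub_nonneg] at hB₁ hl₁
  have hP := h stripEdge010 (by simp [stripPolys])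
  have e : stripView B lam true false false 0 1 0 =
      B ^ 6 * B * lam ^ 2 * (1 - B) ^ 3 * (1 + B) ^ 3 * (1 + B * lam) * (B + lam) * (1 + B ^ 3 *
      lam) * (B ^ 3 + lam) * evalLists B lam stripEdge010 := by
    rw [stripView, viewSumEdge010]
    simp only [stripD, stripPsi, centerZ, centerN, stripEdge010, evalLists, evalList]
    push_cast
    ring
  rw [e]
  positivity

theorem stripViewEdge011_nonneg {B lam : ℝ} (hB : B ∈ Set.Icc (0 : ℝ) 1)
    (hlam : lam ∈ Set.Icc (0 : ℝ) 1)
    (h : ∀ P ∈ stripPolys, 0 ≤ evalLists B lam P) :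
    0 ≤ stripView B lam true false false 0 1 1 := by
  obtain ⟨⟨hB₀, hB₁⟩, hl₀, hl₁⟩ := And.intro hB hlam
  rw [← sub_nonneg] at hB₁ hl₁
  have hP := h stripEdge011 (by simp [stripPolys])
  have e : stripView B lam true false false 0 1 1 =
      B ^ 8 * lam ^ 2 * (1 - B) ^ 3 * (1 + B) ^ 3 * (1 + B * lam) * (B + lam) * (1 + B ^ 3 * lam)
      * (B ^ 3 + lam) * evalLists B lam stripEdge011 := by
    rw [stripView, viewSumEdge011]
    simp only [stripD, stripPsi, centerZ, centerN, stripEdge011, evalLists, evalList]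
    push_cast
    ring
  rw [e]
  positivity

theorem stripViewEdge012_nonneg {B lam : ℝ} (hB : B ∈ Set.Icc (0 : ℝ) 1)
    (hlam : lam ∈ Set.Icc (0 : ℝ) 1)
    (h : ∀ P ∈ stripPolys, 0 ≤ evalLists B lam P) :
    0 ≤ stripView B lam true false false 0 1 2 := by
  obtain ⟨⟨hB₀, hB₁⟩, hl₀, hl₁⟩ := And.intro hB hlam
  rw [← sub_nonneg] at hB₁ hl₁
  have hP := h stripEdge012 (by simp [stripPolys])
  have e : stripView B lam true false false 0 1 2 =
      B ^ 8 * lam ^ 2 * (1 - B) ^ 3 * (1 + B) ^ 3 * (1 + B * lam) * (B + lam) * (1 + B ^ 3 * lam)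
      * (B ^ 3 + lam) * evalLists B lam stripEdge012 := by
    rw [stripView, viewSumEdge012]
    simp only [stripD, stripPsi, centerZ, centerN, stripEdge012, evalLists, evalList]
    push_cast
    ring
  rw [e]
  positivity

theorem stripViewEdge110_nonneg (B lam : ℝ) : 0 ≤ stripView B lam true false false 1 1 0 := by
  refine le_of_eq ?_
  rw [stripView, viewSumEdge110]
  simp only [stripD, stripPsi, centerZ, centerN]
  ring

theorem stripViewEdge111_nonneg {B lam : ℝ} (hB : B ∈ Set.Icc (0 : ℝ) 1)
    (hlam : lam ∈ Set.Icc (0 : ℝ) 1)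
    (h : ∀ P ∈ stripPolys, 0 ≤ evalLists B lam P) :
    0 ≤ stripView B lam true false false 1 1 1 := by
  obtain ⟨⟨hB₀, hB₁⟩, hl₀, hl₁⟩ := And.intro hB hlam
  rw [← sub_nonneg] at hB₁ hl₁
  have hP := h stripEdge111 (by simp [stripPolys])
  have e : stripView B lam true false false 1 1 1 =
      B ^ 9 * lam ^ 2 * (1 - B) ^ 3 * (1 + B) ^ 3 * (1 + B * lam) * (B + lam) * (1 + B ^ 3 * lam)
      * (B ^ 3 + lam) * evalLists B lam stripEdge111 := by
    rw [stripView, viewSumEdge111]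
    simp only [stripD, stripPsi, centerZ, centerN, stripEdge111, evalLists, evalList]
    push_cast
    ring
  rw [e]
  positivity

theorem stripViewEdge112_nonneg {B lam : ℝ} (hB : B ∈ Set.Icc (0 : ℝ) 1)
    (hlam : lam ∈ Set.Icc (0 : ℝ) 1)
    (h : ∀ P ∈ stripPolys, 0 ≤ evalLists B lam P) :
    0 ≤ stripView B lam true false false 1 1 2 := by
  obtain ⟨⟨hB₀, hB₁⟩, hl₀, hl₁⟩ := And.intro hB hlam
  rw [← sub_nonneg] at hB₁ hl₁
  have hP := h stripEdge112 (by simp [stripPolys])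
  have e : stripView B lam true false false 1 1 2 =
      B ^ 9 * 2 * lam ^ 2 * (1 - B) ^ 3 * (1 + B) ^ 3 * (1 + B * lam) * (B + lam) * (1 + B ^ 3 *
      lam) * (B ^ 3 + lam) * evalLists B lam stripEdge112 := by
    rw [stripView, viewSumEdge112]
    simp only [stripD, stripPsi, centerZ, centerN, stripEdge112, evalLists, evalList]
    push_cast
    ring
  rw [e]
  positivity

theorem stripViewPath000_nonneg (B lam : ℝ) : 0 ≤ stripView B lam true false true 0 0 0 := by
  refine le_of_eq ?_
  rw [stripView, viewSumPath000]
  simp only [stripD, stripPsi, centerZ, centerN]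
  ring

theorem stripViewPath001_nonneg {B lam : ℝ} (hB : B ∈ Set.Icc (0 : ℝ) 1)
    (hlam : lam ∈ Set.Icc (0 : ℝ) 1)
    (h : ∀ P ∈ stripPolys, 0 ≤ evalLists B lam P) :
    0 ≤ stripView B lam true false true 0 0 1 := by
  obtain ⟨⟨hB₀, hB₁⟩, hl₀, hl₁⟩ := And.intro hB hlam
  rw [← sub_nonneg] at hB₁ hl₁
  have hP := h stripPath001 (by simp [stripPolys])
  have e : stripView B lam true false true 0 0 1 =
      B ^ 8 * lam ^ 2 * (1 - B) ^ 3 * (1 + B) ^ 3 * (1 + B * lam) * (B + lam) * (1 + B ^ 3 * lam)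
      * (B ^ 3 + lam) * evalLists B lam stripPath001 := by
    rw [stripView, viewSumPath001]
    simp only [stripD, stripPsi, centerZ, centerN, stripPath001, evalLists, evalList]
    push_cast
    ring
  rw [e]
  positivity

theorem stripViewPath101_nonneg {B lam : ℝ} (hB : B ∈ Set.Icc (0 : ℝ) 1)
    (hlam : lam ∈ Set.Icc (0 : ℝ) 1)
    (h : ∀ P ∈ stripPolys, 0 ≤ evalLists B lam P) :
    0 ≤ stripView B lam true false true 1 0 1 := by
  obtain ⟨⟨hB₀, hB₁⟩, hl₀, hl₁⟩ := And.intro hB hlam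
  rw [← sub_nonneg] at hB₁ hl₁
  have hP := h stripPath001 (by simp [stripPolys])
  have e : stripView B lam true false true 1 0 1 =
      B ^ 8 * 2 * lam ^ 2 * (1 - B) ^ 3 * (1 + B) ^ 3 * (1 + B * lam) * (B + lam) * (1 + B ^ 3 *
      lam) * (B ^ 3 + lam) * evalLists B lam stripPath001 := by
    rw [stripView, viewSumPath101]
    simp only [stripD, stripPsi, centerZ, centerN, stripPath001, evalLists, evalList]
    push_cast
    ring
  rw [e]
  positivity

theorem stripViewTriangle000_nonneg (B lam : ℝ) : 0 ≤ stripView B lam true true true 0 0 0 := by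
  refine le_of_eq ?_
  rw [stripView, viewSumTriangle000]
  simp only [stripD, centerZ, centerN]
  ring

theorem viewsNonneg_strip {B lam : ℝ} (hB : B ∈ Set.Icc (0 : ℝ) 1)
    (hlam : lam ∈ Set.Icc (0 : ℝ) 1) (h : ∀ P ∈ stripPolys, 0 ≤ evalLists B lam P) :
    ViewsNonneg B lam (stripD B lam) (centerZ B lam) (centerN B lam) (stripPsi B lam) := by
  refine viewsNonneg_of_canonical ?_ ?_ ?_ ?_
  · intro k₁ k₂ k₃ h₁ h₂ h₃
    interval_cases k₃ <;> interval_cases k₂ <;> interval_cases k₁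
    · exact stripViewStar000_nonneg hB hlam h
    · exact stripViewStar001_nonneg hB hlam h
    · exact stripViewStar011_nonneg hB hlam h
    · exact stripViewStar111_nonneg hB hlam h
    · exact stripViewStar002_nonneg hB hlam h
    · exact stripViewStar012_nonneg hB hlam h
    · exact stripViewStar112_nonneg hB hlam h
    · exact stripViewStar022_nonneg hB hlam h
    · exact stripViewStar122_nonneg hB hlam h
    · exact stripViewStar222_nonneg _ _
  · intro k₁ k₂ k₃ h₁ h₂ h₃
    interval_cases k₃ <;> interval_cases k₂ <;> interval_cases k₁
    · exact stripViewEdge000_nonneg hB hlam h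
    · exact stripViewEdge010_nonneg hB hlam h
    · exact stripViewEdge110_nonneg _ _
    · exact stripViewEdge001_nonneg hB hlam h
    · exact stripViewEdge011_nonneg hB hlam h
    · exact stripViewEdge111_nonneg hB hlam h
    · exact stripViewEdge002_nonneg hB hlam h
    · exact stripViewEdge012_nonneg hB hlam h
    · exact stripViewEdge112_nonneg hB hlam h
  · intro k₁ k₃ h₁ h₃
    interval_cases k₃ <;> interval_cases k₁
    · exact stripViewPath000_nonneg _ _
    · exact stripViewPath001_nonneg hB hlam h
    · exact stripViewPath101_nonneg hB hlam h
  · exact stripViewTriangle000_nonneg _ _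

end StripCertificate

/-! ### Covering the regions by certified pieces, and downward closure -/

section RegionCertificates

/-- The substitution `(s / 2, s t / 2)` maps the unit square onto the triangle `0 ≤ lam ≤ B ≤ 1/2`.
-/
theorem mainPolys_triangle :
    (mainPolys.all (isNonnegOn 2 [[0], [1]] [[0], [0, 1]])) = true := by decide +kernel

/-- The piece over `11/25 ≤ B ≤ 1`, whose upper edge rises linearly from `14/25` to `31/50`. -/
theorem mainPolys_trapezoid :
    (mainPolys.all (isNonnegOn 50 [[22], [28]] [[0, 28], [0, 3]])) = true := by decide +kernel

/-- The piece over `1/4 ≤ B ≤ 9/20` below the upper edge of region 6. -/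
theorem mainPolys_wedge :
    (mainPolys.all (isNonnegOn 200 [[50], [40]] [[0, 53], [0, 56]])) = true := by decide +kernel

/-- The square is mapped onto region 8: `s` runs along `B`, and `t` runs between the two bounding
lines. -/
theorem stripPolys_strip :
    (stripPolys.all (isNonnegOn 10000 [[2600], [1000]] [[2786, 58], [1360, 80]])) = true := by
  decide +kernel

theorem forall_evalLists_nonneg {N : ℕ} {X Y : List (List ℕ)} {L : List (List (List ℤ))}
    (hN : 0 < N) (h : L.all (isNonnegOn N X Y) = true) {x y s t : ℝ}
    (hs : s ∈ Set.Icc (0 : ℝ) 1) (ht : t ∈ Set.Icc (0 : ℝ) 1) (hx : N * x = NatPoly.eval₂ s t X)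
    (hy : N * y = NatPoly.eval₂ s t Y) : ∀ P ∈ L, 0 ≤ evalLists x y P := fun P hP =>
  evalLists_nonneg_of_isNonnegOn hN (List.all_eq_true.1 h P hP) hs ht hx hy

theorem div_mem_Icc {a b : ℝ} (ha : 0 ≤ a) (hab : a ≤ b) : a / b ∈ Set.Icc (0 : ℝ) 1 :=
  ⟨div_nonneg ha (ha.trans hab), div_le_one_of_le₀ hab (ha.trans hab)⟩

theorem mainPolys_nonneg_of_le {B lam : ℝ} (h₀ : 0 < B) (h₁ : B ≤ 1 / 2) (h₂ : 0 ≤ lam)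
    (h₃ : lam ≤ B) : ∀ P ∈ mainPolys, 0 ≤ evalLists B lam P := by
  refine forall_evalLists_nonneg (s := 2 * B) (t := lam / B) (by norm_num) mainPolys_triangle
    ⟨by linarith, by linarith⟩ (div_mem_Icc h₂ h₃) ?_ ?_ <;>
  simp only [NatPoly.eval₂, NatPoly.eval] <;> push_cast <;> field_simp <;> ring

theorem mainPolys_nonneg_of_le_trapezoid {B lam : ℝ} (h₀ : 11 / 25 ≤ B) (h₁ : B ≤ 1)
    (h₂ : 0 ≤ lam) (h₃ : lam ≤ 14 / 25 + 3 / 28 * (B - 11 / 25)) :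
    ∀ P ∈ mainPolys, 0 ≤ evalLists B lam P := by
  have h : (0 : ℝ) < 14 / 25 + 3 / 28 * (B - 11 / 25) := by linarith
  refine forall_evalLists_nonneg (s := (25 * B - 11) / 14)
    (t := lam / (14 / 25 + 3 / 28 * (B - 11 / 25))) (by norm_num) mainPolys_trapezoid
    ⟨by linarith, by linarith⟩ (div_mem_Icc h₂ h₃) ?_ ?_
  · simp only [NatPoly.eval₂, NatPoly.eval]; push_cast; ring
  · have e := div_mul_cancel₀ lam h.ne'
    simp only [NatPoly.eval₂, NatPoly.eval]; push_cast
    linear_combination -50 * e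

theorem mainPolys_nonneg_of_le_wedge {B lam : ℝ} (h₀ : 1 / 4 ≤ B) (h₁ : B ≤ 9 / 20)
    (h₂ : 0 ≤ lam) (h₃ : lam ≤ -(17 / 200) + 7 / 5 * B) :
    ∀ P ∈ mainPolys, 0 ≤ evalLists B lam P := by
  have h : (0 : ℝ) < -(17 / 200) + 7 / 5 * B := by linarith
  refine forall_evalLists_nonneg (s := 5 * B - 5 / 4)
    (t := lam / (-(17 / 200) + 7 / 5 * B)) (by norm_num) mainPolys_wedge
    ⟨by linarith, by linarith⟩ (div_mem_Icc h₂ h₃) ?_ ?_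
  · simp only [NatPoly.eval₂, NatPoly.eval]; push_cast; ring
  · have e := div_mul_cancel₀ lam h.ne'
    simp only [NatPoly.eval₂, NatPoly.eval]; push_cast
    linear_combination -200 * e

theorem stripPolys_nonneg {B lam : ℝ} (h : (B, lam) ∈ minRegion8) :
    ∀ P ∈ stripPolys, 0 ≤ evalLists B lam P := by
  obtain ⟨h₀, h₁, h₂, h₃⟩ := h
  simp only at h₀ h₁ h₂ h₃
  have hw : (0 : ℝ) < -(3 / 200) + 2 / 25 * B := by linarith
  refine forall_evalLists_nonneg (s := 10 * B - 13 / 5)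
    (t := (lam - (-(3 / 40) + 34 / 25 * B)) / (-(3 / 200) + 2 / 25 * B)) (by norm_num)
    stripPolys_strip ⟨by linarith, by linarith⟩ (div_mem_Icc (by linarith) (by linarith)) ?_ ?_
  · simp only [NatPoly.eval₂, NatPoly.eval]; push_cast; ring
  · have e := div_mul_cancel₀ (lam - (-(3 / 40) + 34 / 25 * B)) hw.ne'
    simp only [NatPoly.eval₂, NatPoly.eval]; push_cast
    linear_combination -10000 * e

theorem mainPolys_nonneg {B lam : ℝ} (hB : 0 < B) (h : (B, lam) ∈ minRegion)
    (h₈ : (B, lam) ∉ minRegion8) : ∀ P ∈ mainPolys, 0 ≤ evalLists B lam P := by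
  simp only [minRegion, Set.mem_union, h₈, or_false] at h
  rcases h with (((((h | h) | h) | h) | h) | h) | h <;>
  simp only [minRegion1, minRegion2, minRegion3, minRegion4, minRegion5, minRegion6, minRegion7,
    Set.mem_ofPred_eq, le_min_iff] at h
  · obtain ⟨h₀, h₁, h₂, h₃⟩ := h
    -- The parabola bounding region 1 stays below the upper edge of the trapezoid; at `B = 1` the
    -- heights are `0.618` and `0.62`.
    exact mainPolys_nonneg_of_le_trapezoid (by linarith) h₁ h₂ (by nlinarith)
  · obtain ⟨h₀, h₁, h₂, h₃⟩ := h
    rcases le_total B (1 / 2) with h | h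
    · exact mainPolys_nonneg_of_le hB h h₂ (by linarith)
    · exact mainPolys_nonneg_of_le_trapezoid (by linarith) (by linarith) h₂ (by linarith)
  · obtain ⟨h₀, h₁, h₂, h₃⟩ := h
    exact mainPolys_nonneg_of_le hB h₁ (by linarith) (by linarith)
  · obtain ⟨h₀, h₁, h₂, h₃, h₄⟩ := h
    exact mainPolys_nonneg_of_le_trapezoid (by linarith) (by linarith) (by linarith) (by linarith)
  · obtain ⟨h₀, h₁, h₂, h₃⟩ := h
    exact mainPolys_nonneg_of_le_trapezoid (by linarith) (by linarith) (by linarith) (by linarith)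
  · obtain ⟨h₀, h₁, h₂, h₃⟩ := h
    exact mainPolys_nonneg_of_le_wedge h₀ h₁ (by linarith) h₃
  · obtain ⟨h₀, h₁, h₂, h₃⟩ := h
    exact mainPolys_nonneg_of_le_trapezoid (by linarith) (by linarith) (by linarith) (by linarith)

/-- The last clause isolates the degenerate point: only region 2 reaches `B = 0`, and there `lam ≤
9/10 * B` forces `lam = 0`. -/
theorem minRegion_bounds {B lam : ℝ} (h : (B, lam) ∈ minRegion) :
    0 ≤ B ∧ B ≤ 1 ∧ 0 ≤ lam ∧ lam ≤ 1 ∧ (B = 0 → lam = 0) := by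
  have hz : 0 < B → (B = 0 → lam = 0) := fun h h' => absurd h' h.ne'
  simp only [minRegion, Set.mem_union, minRegion1, minRegion2, minRegion3, minRegion4,
    minRegion5, minRegion6, minRegion7, minRegion8, Set.mem_ofPred_eq, le_min_iff] at h
  rcases h with ((((((⟨h₀, h₁, h₂, h₃⟩ | ⟨h₀, h₁, h₂, h₃⟩) | ⟨h₀, h₁, h₂, h₃⟩) |
    ⟨h₀, h₁, h₂, h₃, h₄⟩) | ⟨h₀, h₁, h₂, h₃⟩) | ⟨h₀, h₁, h₂, h₃⟩) | ⟨h₀, h₁, h₂, h₃⟩) |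
    ⟨h₀, h₁, h₂, h₃⟩
  · exact ⟨by linarith, by linarith, by linarith, by nlinarith, hz (by linarith)⟩
  · exact ⟨by linarith, by linarith, by linarith, by linarith, fun h => by subst h; linarith⟩
  all_goals exact ⟨by linarith, by linarith, by linarith, by linarith, hz (by linarith)⟩

theorem exists_certificate {B lam : ℝ} (hB : 0 < B) (hlam : 0 < lam) (h : (B, lam) ∈ minRegion) :
    ∃ D ψ, 0 < D ∧ ViewsNonneg B lam D (centerZ B lam) (centerN B lam) ψ := by
  obtain ⟨hB₀, hB₁, hl₀, hl₁, -⟩ := minRegion_bounds h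
  by_cases h₈ : (B, lam) ∈ minRegion8
  · exact ⟨_, _, by unfold stripD; positivity,
      viewsNonneg_strip ⟨hB₀, hB₁⟩ ⟨hl₀, hl₁⟩ (stripPolys_nonneg h₈)⟩
  · refine ⟨_, _, ?_, viewsNonneg_main ⟨hB₀, hB₁⟩ ⟨hl₀, hl₁⟩ (mainPolys_nonneg hB h h₈)⟩
    have : 0 < 3 * lam + 2 * B - B ^ 2 * lam := by nlinarith [mul_pos hB hlam]
    unfold mainD
    positivity

/-- Below its lower edge each region is continued by others: 8 by 6, then 3, then 2; 7 by 3 or 4; 5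
by 4 or 1; and 4 by 2 or 1. Regions 1 and 2 reach down to field `0`. -/
theorem minRegion_downward_closed {B lam l : ℝ} (h : (B, lam) ∈ minRegion) (hl : 0 ≤ l)
    (hle : l ≤ lam) : (B, l) ∈ minRegion := by
  have r₁ : 59 / 100 ≤ B → B ≤ 1 → l ≤ 177 / 200 * B - 267 / 1000 * B ^ 2 →
      (B, l) ∈ minRegion := fun h₀ h₁ h₂ => by
    simp only [minRegion, Set.mem_union]
    exact Or.inl (Or.inl (Or.inl (Or.inl (Or.inl (Or.inl (Or.inl ⟨h₀, h₁, hl, h₂⟩))))))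
  have r₂ : 0 ≤ B → B ≤ 59 / 100 → l ≤ 9 / 10 * B → (B, l) ∈ minRegion := fun h₀ h₁ h₂ => by
    simp only [minRegion, Set.mem_union]
    exact Or.inl (Or.inl (Or.inl (Or.inl (Or.inl (Or.inl (Or.inr ⟨h₀, h₁, hl, h₂⟩))))))
  have r₃ : 1 / 10 ≤ B → B ≤ 1 / 2 → l ≤ 99 / 100 * B → (B, l) ∈ minRegion := fun h₀ h₁ h₂ => by
    rcases le_total (1 / 2 * B) l with h | h
    · simp only [minRegion, Set.mem_union]
      exact Or.inl (Or.inl (Or.inl (Or.inl (Or.inl (Or.inr ⟨h₀, h₁, h, h₂⟩)))))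
    · exact r₂ (by linarith) (by linarith) (by linarith)
  have r₄ : 1 / 2 ≤ B → B ≤ 9 / 10 → l ≤ B → l ≤ 53 / 100 → (B, l) ∈ minRegion :=
      fun h₀ h₁ h₂ h₃ => by
    rcases le_total (3 / 20) l with h | h
    · simp only [minRegion, Set.mem_union]
      exact Or.inl (Or.inl (Or.inl (Or.inl (Or.inr ⟨h₀, h₁, h, le_min h₂ h₃⟩))))
    · rcases le_total B (59 / 100) with h' | h'
      · exact r₂ (by linarith) h' (by linarith)
      · exact r₁ h' (by linarith) (by nlinarith)
  have r₆ : 1 / 4 ≤ B → B ≤ 9 / 20 → l ≤ -(17 / 200) + 7 / 5 * B → (B, l) ∈ minRegion :=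
      fun h₀ h₁ h₂ => by
    rcases le_total (49 / 50 * B) l with h | h
    · simp only [minRegion, Set.mem_union]
      exact Or.inl (Or.inl (Or.inr ⟨h₀, h₁, h, h₂⟩))
    · exact r₃ (by linarith) (by linarith) (by linarith)
  have h' := h
  simp only [minRegion, Set.mem_union, minRegion1, minRegion2, minRegion3, minRegion4,
    minRegion5, minRegion6, minRegion7, minRegion8, Set.mem_ofPred_eq, le_min_iff] at h'
  rcases h' with ((((((⟨h₀, h₁, h₂, h₃⟩ | ⟨h₀, h₁, h₂, h₃⟩) | ⟨h₀, h₁, h₂, h₃⟩) |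
    ⟨h₀, h₁, h₂, h₃, h₄⟩) | ⟨h₀, h₁, h₂, h₃⟩) | ⟨h₀, h₁, h₂, h₃⟩) | ⟨h₀, h₁, h₂, h₃⟩) |
    ⟨h₀, h₁, h₂, h₃⟩
  · exact r₁ h₀ h₁ (hle.trans h₃)
  · exact r₂ h₀ h₁ (hle.trans h₃)
  · exact r₃ h₀ h₁ (hle.trans h₃)
  · exact r₄ h₀ h₁ (hle.trans h₃) (hle.trans h₄)
  · rcases le_total (7 / 20 + 11 / 50 * B) l with h' | h'
    · simp only [minRegion, Set.mem_union]
      exact Or.inl (Or.inl (Or.inl (Or.inr ⟨h₀, h₁, h', hle.trans h₃⟩)))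
    -- Up to `B = 4/5` the lower edge of region 5 is at most `0.526`, under the cap `0.53` of region
    -- 4. Beyond that it lies under the parabola of region 1.
    · rcases le_total B (4 / 5) with h'' | h''
      · exact r₄ (by linarith) (by linarith) (by linarith) (by linarith)
      · exact r₁ (by linarith) (by linarith) (by nlinarith)
  · exact r₆ h₀ h₁ (hle.trans h₃)
  · rcases le_total (99 / 100 * B) l with h' | h'
    · simp only [minRegion, Set.mem_union]
      exact Or.inl (Or.inr ⟨h₀, h₁, h', hle.trans h₃⟩)
    · rcases le_total B (1 / 2) with h'' | h''
      · exact r₃ (by linarith) h'' h'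
      -- The lines `0.99 B` and `0.665 - 0.26 B` cross at `B = 0.532`, at a height below `0.53`, so
      -- together they give the cap of region 4.
      · exact r₄ h'' (by linarith) (by linarith) (by linarith)
  · rcases le_total (-(3 / 40) + 34 / 25 * B) l with h' | h'
    · simp only [minRegion, Set.mem_union]
      exact Or.inr ⟨h₀, h₁, h', hle.trans h₃⟩
    · exact r₆ (by linarith) (by linarith) (by linarith)

end RegionCertificates

/-! ### Analytic properties of the partition function -/

section PartitionFunction

variable {V : Type u} [Fintype V] (G : SimpleGraph V) [DecidableRel G.Adj]

theorem isingWeight_false (B lam : ℝ) :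
    isingWeight G B lam (fun _ => false) = B ^ G.edgeFinset.card := by
  have h : monoEdges G (fun _ => false) = G.edgeFinset.card := by
    rw [monoEdges, Finset.filter_true_of_mem]
    intro e _
    induction e with
    | _ a b => simp
  simp [isingWeight, h, plusCount]

variable [DecidableEq V]

/-- The sum of `plusCount` over all spin assignments, weighted as in the partition function. -/
def isingMoment (B lam : ℝ) : ℝ := ∑ σ : V → Bool, isingWeight G B lam σ * plusCount σ

theorem isingZ_eq_sum_isingWeight (B lam : ℝ) : isingZ G B lam = ∑ σ, isingWeight G B lam σ := rfl

theorem isingZ_pos {B lam : ℝ} (hB : 0 < B) (hlam : 0 ≤ lam) : 0 < isingZ G B lam := by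
  refine Finset.sum_pos' (fun σ _ => by positivity) ⟨fun _ => false, Finset.mem_univ _, ?_⟩
  rw [← isingWeight, isingWeight_false]
  positivity

theorem isingZ_zero_field (B : ℝ) : isingZ G B 0 = B ^ G.edgeFinset.card := by
  rw [isingZ_eq_sum_isingWeight, Finset.sum_eq_single (fun _ => false), isingWeight_false]
  · intro σ _ hσ
    obtain ⟨x, hx⟩ := Function.ne_iff.1 hσ
    have : plusCount σ ≠ 0 := by
      rw [plusCount, Finset.card_ne_zero]
      exact ⟨x, by simpa using hx⟩
    rw [isingWeight, zero_pow this, mul_zero]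
  · simp

theorem continuous_isingZ : Continuous fun p : ℝ × ℝ => isingZ G p.1 p.2 := by
  unfold isingZ
  fun_prop

theorem continuous_isingMoment : Continuous fun p : ℝ × ℝ => isingMoment G p.1 p.2 := by
  unfold isingMoment isingWeight
  fun_prop

theorem hasDerivAt_isingZ {B lam : ℝ} (hlam : lam ≠ 0) :
    HasDerivAt (fun l => isingZ G B l) (isingMoment G B lam / lam) lam := by
  unfold isingZ isingMoment
  rw [Finset.sum_div]
  refine HasDerivAt.fun_sum fun σ _ => ?_
  refine ((hasDerivAt_pow (plusCount σ) lam).const_mul (B ^ monoEdges G σ)).congr_deriv ?_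
  simp only [isingWeight]
  cases plusCount σ with
  | zero => simp
  | succ k => simp [pow_succ, mul_assoc]; field_simp

theorem hasDerivAt_log_isingZ {B lam : ℝ} (hB : 0 < B) (hlam : 0 < lam) :
    HasDerivAt (fun l => Real.log (isingZ G B l))
      (isingMoment G B lam / lam / isingZ G B lam) lam :=
  (hasDerivAt_isingZ G hlam.ne').log (isingZ_pos G hB hlam.le).ne'

/-- Since `isingMoment` is `lam · ∂Z/∂lam`, the occupancy fraction is the expected proportion of
plus vertices. -/
theorem occupancyFraction_eq_div {B lam : ℝ} (hB : 0 < B) (hlam : 0 < lam) :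
    occupancyFraction G B lam = isingMoment G B lam / (Fintype.card V * isingZ G B lam) := by
  rw [occupancyFraction, (hasDerivAt_log_isingZ G hB hlam).deriv]
  have := hlam.ne'
  have := (isingZ_pos G hB hlam.le).ne'
  field_simp

theorem occupancyFraction_zero_field (B : ℝ) : occupancyFraction G B 0 = 0 := by
  simp [occupancyFraction]

theorem hasDerivAt_freeEnergyDensity {B lam : ℝ} (hB : 0 < B) (hlam : 0 < lam) :
    HasDerivAt (fun l => freeEnergyDensity G B l) (occupancyFraction G B lam / lam) lam := by
  unfold freeEnergyDensity
  refine ((hasDerivAt_log_isingZ G hB hlam).const_mul (1 / (Fintype.card V : ℝ))).congr_deriv ?_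
  have := hlam.ne'
  simp only [occupancyFraction, (hasDerivAt_log_isingZ G hB hlam).deriv]
  field_simp

theorem continuousOn_freeEnergyDensity {B : ℝ} (hB : 0 < B) :
    ContinuousOn (fun l => freeEnergyDensity G B l) (Set.Ici 0) := by
  unfold freeEnergyDensity
  refine continuousOn_const.mul (ContinuousOn.log ?_ fun l hl => (isingZ_pos G hB hl).ne')
  exact ((continuous_isingZ G).comp (Continuous.prodMk_right B)).continuousOn

variable {G}

/-- At field `0` only the all-minus assignment survives, and a cubic graph has `3 |V| / 2` edges.
The formula includes `B = 0` through `Real.log 0 = 0`, in agreement with the convention at the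
degenerate point. -/
theorem freeEnergyDensity_zero_field [Nonempty V] (hG : G.IsRegularOfDegree 3) (B : ℝ) :
    freeEnergyDensity G B 0 = 3 / 2 * Real.log B := by
  have h : 2 * G.edgeFinset.card = Fintype.card V * 3 := by
    rw [← G.sum_degrees_eq_twice_card_edges, Finset.sum_congr rfl fun x _ => hG x]
    simp
  have h' : 2 * (G.edgeFinset.card : ℝ) = Fintype.card V * 3 := by exact_mod_cast h
  have hV : (Fintype.card V : ℝ) ≠ 0 := by exact_mod_cast Fintype.card_ne_zero
  rw [freeEnergyDensity, isingZ_zero_field, Real.log_pow]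
  field_simp
  linear_combination Real.log B * h'

end PartitionFunction

/-! ### Binary coding of spin assignments for exact enumeration -/

section EdgeLists

theorem testBit_bijective (n : ℕ) :
    Function.Bijective fun (j : Fin (2 ^ n)) (i : Fin n) => j.val.testBit i := by
  rw [Fintype.bijective_iff_injective_and_card]
  refine ⟨fun a b h => Fin.ext (Nat.eq_of_testBit_eq fun i => ?_), by simp⟩
  by_cases hi : i < n
  · exact congrFun h ⟨i, hi⟩
  · have := Nat.pow_le_pow_right (n := 2) (by norm_num) (not_lt.1 hi)
    rw [Nat.testBit_lt_two_pow (a.2.trans_le this), Nat.testBit_lt_two_pow (b.2.trans_le this)]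

theorem sum_spins_eq_sum_range {M : Type*} [AddCommMonoid M] (n : ℕ) (f : (Fin n → Bool) → M) :
    ∑ σ, f σ = ∑ j ∈ Finset.range (2 ^ n), f fun i => j.testBit i := by
  rw [Finset.sum_range]
  exact ((testBit_bijective n).sum_comp f).symm

variable {n : ℕ}

/-- The number of monochromatic pairs of `E` under the spins given by the binary digits of `j`. -/
def codeMono (E : List (ℕ × ℕ)) (j : ℕ) : ℕ :=
  E.countP fun e => j.testBit e.1 == j.testBit e.2

/-- The number of ones among the first `n` binary digits of `j`. -/
def codePlus (n j : ℕ) : ℕ := (List.range n).countP j.testBit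

theorem plusCount_testBit (j : ℕ) :
    plusCount (fun i : Fin n => j.testBit i) = codePlus n j := by
  have h : (Finset.univ.filter fun i : Fin n => j.testBit i = true) =
      ((List.finRange n).filter fun i : Fin n => j.testBit i.val).toFinset := by
    ext i
    simp
  rw [plusCount, h, List.toFinset_card_of_nodup ((List.nodup_finRange n).filter _), codePlus,
    ← List.map_coe_finRange_eq_range, List.countP_map, List.countP_eq_length_filter]
  rfl

/-- The edge list must have no repeated unordered pair, so that counting its entries counts each
edge once. -/
theorem monoEdges_testBit {G : SimpleGraph (Fin n)} [DecidableRel G.Adj]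
    {E : List (Fin n × Fin n)} (hE : ∀ a b, G.Adj a b ↔ s(a, b) ∈ E.map fun e => s(e.1, e.2))
    (hd : (E.map fun e => s(e.1, e.2)).Nodup) (j : ℕ) :
    monoEdges G (fun i : Fin n => j.testBit i) =
      codeMono (E.map fun e => (e.1.val, e.2.val)) j := by
  have h : (G.edgeFinset.filter fun e => (e.map fun i : Fin n => j.testBit i).IsDiag) =
      ((E.map fun e => s(e.1, e.2)).filter fun e =>
        decide (e.map fun i : Fin n => j.testBit i).IsDiag).toFinset := by
    ext e
    induction e with
    | _ a b =>
      simp only [Finset.mem_filter, SimpleGraph.mem_edgeFinset, SimpleGraph.mem_edgeSet, hE,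
        List.mem_toFinset, List.mem_filter, decide_eq_true_eq]
  rw [monoEdges, h, List.toFinset_card_of_nodup (hd.filter _), List.filter_map, List.length_map,
    codeMono, List.countP_map, List.countP_eq_length_filter]
  congr 1
  refine List.filter_congr fun e _ => ?_
  simp [Bool.beq_eq_decide_eq]

theorem isingZ_eq_sum_range {G : SimpleGraph (Fin n)} [DecidableRel G.Adj]
    {E : List (Fin n × Fin n)} (hE : ∀ a b, G.Adj a b ↔ s(a, b) ∈ E.map fun e => s(e.1, e.2))
    (hd : (E.map fun e => s(e.1, e.2)).Nodup) (B lam : ℝ) :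
    isingZ G B lam = ∑ j ∈ Finset.range (2 ^ n),
      B ^ codeMono (E.map fun e => (e.1.val, e.2.val)) j * lam ^ codePlus n j := by
  rw [isingZ, sum_spins_eq_sum_range]
  simp only [monoEdges_testBit hE hd, plusCount_testBit]

theorem isingMoment_eq_sum_range {G : SimpleGraph (Fin n)} [DecidableRel G.Adj]
    {E : List (Fin n × Fin n)} (hE : ∀ a b, G.Adj a b ↔ s(a, b) ∈ E.map fun e => s(e.1, e.2))
    (hd : (E.map fun e => s(e.1, e.2)).Nodup) (B lam : ℝ) :
    isingMoment G B lam = ∑ j ∈ Finset.range (2 ^ n),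
      B ^ codeMono (E.map fun e => (e.1.val, e.2.val)) j * lam ^ codePlus n j * codePlus n j := by
  rw [isingMoment, sum_spins_eq_sum_range]
  simp only [isingWeight, monoEdges_testBit hE hd, plusCount_testBit]

end EdgeLists

/-! ### Minimality of `K₄` -/

section CompleteGraph

def edgesK4 : List (Fin 4 × Fin 4) := [(0, 1), (0, 2), (0, 3), (1, 2), (1, 3), (2, 3)]

theorem graphK4_adj_iff (a b : Fin 4) :
    graphK4.Adj a b ↔ s(a, b) ∈ edgesK4.map fun e => s(e.1, e.2) := by
  revert a b
  decide

theorem graphK4_isRegularOfDegree : graphK4.IsRegularOfDegree 3 := by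
  unfold SimpleGraph.IsRegularOfDegree
  decide

/-- The numbers of monochromatic edges of `K₄` and of vertices with spin `+`, for each code. -/
theorem codes_K4 : (List.range 16).map (fun j =>
    (codeMono (edgesK4.map fun e => (e.1.val, e.2.val)) j, codePlus 4 j)) =
      [(6, 0), (3, 1), (3, 1), (2, 2), (3, 1), (2, 2), (2, 2), (3, 3),
        (3, 1), (2, 2), (2, 2), (3, 3), (2, 2), (3, 3), (3, 3), (6, 4)] := by
  decide

theorem sum_codes_K4 (f : ℕ × ℕ → ℝ) :
    ∑ j ∈ Finset.range (2 ^ 4),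
      f (codeMono (edgesK4.map fun e => (e.1.val, e.2.val)) j, codePlus 4 j) =
    f (6, 0) + 4 * f (3, 1) + 6 * f (2, 2) + 4 * f (3, 3) + f (6, 4) := by
  have h := congrArg (fun L => (L.map f).sum) codes_K4
  rw [List.map_map] at h
  rw [show (2 : ℕ) ^ 4 = 16 from rfl, ← List.toFinset_range,
    List.sum_toFinset _ List.nodup_range]
  refine h.trans ?_
  simp only [List.map_cons, List.map_nil, List.sum_cons, List.sum_nil]
  ring

theorem isingZ_graphK4 (B lam : ℝ) : isingZ graphK4 B lam = B ^ 2 * centerZ B lam := by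
  rw [isingZ_eq_sum_range graphK4_adj_iff (by decide),
    sum_codes_K4 fun p => B ^ p.1 * lam ^ p.2, centerZ]
  ring

theorem isingMoment_graphK4 (B lam : ℝ) :
    isingMoment graphK4 B lam = 4 * (B ^ 2 * centerN B lam) := by
  rw [isingMoment_eq_sum_range graphK4_adj_iff (by decide),
    sum_codes_K4 fun p => B ^ p.1 * lam ^ p.2 * p.2, centerN]
  push_cast
  ring

theorem occupancyFraction_graphK4 {B lam : ℝ} (hB : 0 < B) (hlam : 0 < lam) :
    occupancyFraction graphK4 B lam = centerN B lam / centerZ B lam := by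
  have hZ := isingZ_pos graphK4 hB hlam.le
  rw [isingZ_graphK4] at hZ
  have : centerZ B lam ≠ 0 := fun h => by simp [h] at hZ
  rw [occupancyFraction_eq_div _ hB hlam, isingZ_graphK4, isingMoment_graphK4]
  simp only [Fintype.card_fin]
  push_cast
  field_simp

variable {V : Type u} [Fintype V] [DecidableEq V] [Nonempty V] {G : SimpleGraph V}
  [DecidableRel G.Adj]

theorem occupancyFraction_graphK4_le (hG : G.IsRegularOfDegree 3) {B lam : ℝ}
    (h : (B, lam) ∈ minRegion) :
    occupancyFraction graphK4 B lam ≤ occupancyFraction G B lam := by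
  obtain ⟨hB, -, hlam, -, hz⟩ := minRegion_bounds h
  rcases hlam.eq_or_lt with rfl | hlam
  -- At field `0` the prefactor `lam` makes both sides `0`; this includes the degenerate point.
  · rw [occupancyFraction_zero_field, occupancyFraction_zero_field]
  have hB : 0 < B := hB.lt_of_ne fun hB => hlam.ne' (hz hB.symm)
  obtain ⟨D, ψ, hD, hψ⟩ := exists_certificate hB hlam h
  have hZ := isingZ_pos G hB hlam.le
  have hc : 0 < centerZ B lam := by
    unfold centerZ
    positivity
  have hV : 0 < (Fintype.card V : ℝ) := by exact_mod_cast Fintype.card_pos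
  rw [occupancyFraction_graphK4 hB hlam, occupancyFraction_eq_div G hB hlam,
    div_le_div_iff₀ hc (by positivity), mul_comm (isingMoment G B lam)]
  exact mean_plusCount_ge hG hB hlam.le hD hψ

/-- The difference of the free energies vanishes at field `0`, and its derivative is the difference
of the occupancy fractions divided by the field. It is therefore nondecreasing along the segment up
to `lam`. -/
theorem freeEnergyDensity_graphK4_le (hG : G.IsRegularOfDegree 3) {B lam : ℝ}
    (h : (B, lam) ∈ minRegion) :
    freeEnergyDensity graphK4 B lam ≤ freeEnergyDensity G B lam := by
  obtain ⟨hB, -, hlam, -, hz⟩ := minRegion_bounds h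
  have h₀ : freeEnergyDensity graphK4 B 0 = freeEnergyDensity G B 0 := by
    rw [freeEnergyDensity_zero_field hG,
      freeEnergyDensity_zero_field graphK4_isRegularOfDegree]
  rcases hlam.eq_or_lt with rfl | hlam
  · exact h₀.le
  have hB : 0 < B := hB.lt_of_ne fun hB => hlam.ne' (hz hB.symm)
  have hd : ∀ l ∈ interior (Set.Icc 0 lam), HasDerivWithinAt
      (fun l => freeEnergyDensity G B l - freeEnergyDensity graphK4 B l)
      (occupancyFraction G B l / l - occupancyFraction graphK4 B l / l)
      (interior (Set.Icc 0 lam)) l := by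
    rw [interior_Icc]
    exact fun l hl => ((hasDerivAt_freeEnergyDensity G hB hl.1).sub
      (hasDerivAt_freeEnergyDensity graphK4 hB hl.1)).hasDerivWithinAt
  have hc : ContinuousOn (fun l => freeEnergyDensity G B l - freeEnergyDensity graphK4 B l)
      (Set.Icc 0 lam) := ((continuousOn_freeEnergyDensity G hB).sub
    (continuousOn_freeEnergyDensity graphK4 hB)).mono Set.Icc_subset_Ici_self
  have hm := monotoneOn_of_hasDerivWithinAt_nonneg (convex_Icc 0 lam) hc hd (by
    rw [interior_Icc]
    intro l hl
    -- Downward closure keeps every intermediate field inside the region.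
    have := occupancyFraction_graphK4_le hG
      (minRegion_downward_closed h hl.1.le hl.2.le)
    rw [sub_nonneg]
    exact div_le_div_of_nonneg_right this hl.1.le)
  have := hm (Set.left_mem_Icc.2 hlam.le) (Set.right_mem_Icc.2 hlam.le) hlam.le
  simp only at this
  linarith

end CompleteGraph

/-! ### Exact values for the Petersen and Goose graphs at one point -/

section TenVertices

def edgesPetersen : List (Fin 10 × Fin 10) :=
  [(0, 1), (1, 2), (2, 3), (3, 4), (4, 0), (0, 5), (1, 6), (2, 7), (3, 8), (4, 9),
    (5, 7), (7, 9), (9, 6), (6, 8), (8, 5)]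

def edgesGoose : List (Fin 10 × Fin 10) :=
  [(0, 1), (0, 2), (1, 2), (0, 3), (1, 3), (2, 4), (3, 5), (4, 6), (4, 7), (6, 7),
    (5, 8), (6, 8), (5, 9), (7, 9), (8, 9)]

theorem petersenGraph_adj_iff (a b : Fin 10) :
    petersenGraph.Adj a b ↔ s(a, b) ∈ edgesPetersen.map fun e => s(e.1, e.2) := by
  revert a b
  decide +kernel

theorem gooseGraph_adj_iff (a b : Fin 10) :
    gooseGraph.Adj a b ↔ s(a, b) ∈ edgesGoose.map fun e => s(e.1, e.2) := by
  revert a b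
  decide +kernel

theorem petersenGraph_isRegularOfDegree : petersenGraph.IsRegularOfDegree 3 := by
  unfold SimpleGraph.IsRegularOfDegree
  decide +kernel

theorem gooseGraph_isRegularOfDegree : gooseGraph.IsRegularOfDegree 3 := by
  unfold SimpleGraph.IsRegularOfDegree
  decide +kernel

/-- `25 ^ 15 * 5 ^ 10` times the weight at edge activity `6 / 25` and external field `3 / 5` of the
spin assignment coded by `j`. -/
def codeWeight (E : List (Fin 10 × Fin 10)) (j : ℕ) : ℕ :=
  6 ^ codeMono (E.map fun e => (e.1.val, e.2.val)) j *
    25 ^ (15 - codeMono (E.map fun e => (e.1.val, e.2.val)) j) *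
    (3 ^ codePlus 10 j * 5 ^ (10 - codePlus 10 j))

theorem codeWeight_eq {E : List (Fin 10 × Fin 10)} (hE : E.length = 15) (j : ℕ) :
    (codeWeight E j : ℝ) = 25 ^ 15 * 5 ^ 10 *
      ((6 / 25) ^ codeMono (E.map fun e => (e.1.val, e.2.val)) j * (3 / 5) ^ codePlus 10 j) := by
  have aux : ∀ (a b : ℝ) (k n : ℕ), b ≠ 0 → k ≤ n → a ^ k * b ^ (n - k) = b ^ n * (a / b) ^ k := by
    intro a b k n hb hk
    rw [div_pow, pow_sub₀ b hb hk]
    field_simp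
  have hm : codeMono (E.map fun e => (e.1.val, e.2.val)) j ≤ 15 :=
    List.countP_le_length.trans (by simp [hE])
  have hp : codePlus 10 j ≤ 10 := List.countP_le_length.trans (by simp)
  rw [codeWeight]
  push_cast
  rw [aux 6 25 _ _ (by norm_num) hm, aux 3 5 _ _ (by norm_num) hp]
  ring

def codeZ (E : List (Fin 10 × Fin 10)) : ℕ := ∑ j ∈ Finset.range (2 ^ 10), codeWeight E j

def codeMoment (E : List (Fin 10 × Fin 10)) : ℕ :=
  ∑ j ∈ Finset.range (2 ^ 10), codeWeight E j * codePlus 10 j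

theorem codeZ_pos (E : List (Fin 10 × Fin 10)) : 0 < codeZ E :=
  Finset.sum_pos (fun j _ => by unfold codeWeight; positivity) (by simp)

/-- The integer scale `25 ^ 15 * 5 ^ 10` is common to numerator and denominator and cancels. -/
theorem occupancyFraction_eq_codeMoment_div {G : SimpleGraph (Fin 10)} [DecidableRel G.Adj]
    {E : List (Fin 10 × Fin 10)} (hE : ∀ a b, G.Adj a b ↔ s(a, b) ∈ E.map fun e => s(e.1, e.2))
    (hd : (E.map fun e => s(e.1, e.2)).Nodup) (hl : E.length = 15) :
    occupancyFraction G (6 / 25) (3 / 5) = codeMoment E / (10 * codeZ E : ℕ) := by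
  have hZ : (codeZ E : ℝ) = 25 ^ 15 * 5 ^ 10 * isingZ G (6 / 25) (3 / 5) := by
    rw [isingZ_eq_sum_range hE hd, codeZ, Finset.mul_sum, Nat.cast_sum]
    exact Finset.sum_congr rfl fun j _ => codeWeight_eq hl j
  have hM : (codeMoment E : ℝ) = 25 ^ 15 * 5 ^ 10 * isingMoment G (6 / 25) (3 / 5) := by
    rw [isingMoment_eq_sum_range hE hd, codeMoment, Finset.mul_sum, Nat.cast_sum]
    refine Finset.sum_congr rfl fun j _ => ?_
    rw [Nat.cast_mul, codeWeight_eq hl j]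
    ring
  have := isingZ_pos G (B := 6 / 25) (lam := 3 / 5) (by norm_num) (by norm_num)
  rw [occupancyFraction_eq_div _ (by norm_num) (by norm_num), Nat.cast_mul, hZ, hM,
    Fintype.card_fin]
  push_cast
  field_simp

/-- The rationals `0.46823` and `0.46806` are chosen to separate the values of `K₄`, Petersen and
Goose, which reduces their comparison to integer inequalities. -/
theorem codeMoment_petersen_lt :
    codeMoment edgesPetersen * 1000000 < 468230 * (10 * codeZ edgesPetersen) := by
  decide +kernel

theorem codeMoment_goose_lt :
    codeMoment edgesGoose * 1000000 < 468060 * (10 * codeZ edgesGoose) := by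
  decide +kernel

theorem lt_codeMoment_petersen :
    468060 * (10 * codeZ edgesPetersen) < codeMoment edgesPetersen * 1000000 := by
  decide +kernel

theorem occupancyFraction_petersenGraph_lt :
    occupancyFraction petersenGraph (6 / 25) (3 / 5) < 468230 / 1000000 := by
  rw [occupancyFraction_eq_codeMoment_div petersenGraph_adj_iff (by decide +kernel) rfl,
    div_lt_div_iff₀ (by exact_mod_cast Nat.mul_pos (by norm_num) (codeZ_pos _)) (by norm_num)]
  exact_mod_cast codeMoment_petersen_lt

theorem lt_occupancyFraction_petersenGraph :
    468060 / 1000000 < occupancyFraction petersenGraph (6 / 25) (3 / 5) := by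
  rw [occupancyFraction_eq_codeMoment_div petersenGraph_adj_iff (by decide +kernel) rfl,
    div_lt_div_iff₀ (by norm_num) (by exact_mod_cast Nat.mul_pos (by norm_num) (codeZ_pos _))]
  exact_mod_cast lt_codeMoment_petersen

theorem occupancyFraction_gooseGraph_lt :
    occupancyFraction gooseGraph (6 / 25) (3 / 5) < 468060 / 1000000 := by
  rw [occupancyFraction_eq_codeMoment_div gooseGraph_adj_iff (by decide +kernel) rfl,
    div_lt_div_iff₀ (by exact_mod_cast Nat.mul_pos (by norm_num) (codeZ_pos _)) (by norm_num)]
  exact_mod_cast codeMoment_goose_lt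

theorem lt_occupancyFraction_graphK4 :
    468230 / 1000000 < occupancyFraction graphK4 (6 / 25) (3 / 5) := by
  rw [occupancyFraction_graphK4 (by norm_num) (by norm_num), centerN, centerZ]
  norm_num

end TenVertices

/-! ### From one point to an open region -/

section ParameterRegions

/-- The quotient formula for the occupancy fraction is available where both parameters are positive.
This is an open condition, so it suffices for continuity at such a point. -/
theorem continuousAt_occupancyFraction {V : Type u} [Fintype V] [DecidableEq V] [Nonempty V]
    (G : SimpleGraph V) [DecidableRel G.Adj] {p : ℝ × ℝ} (h₁ : 0 < p.1) (h₂ : 0 < p.2) :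
    ContinuousAt (fun q : ℝ × ℝ => occupancyFraction G q.1 q.2) p := by
  have hpos : ∀ᶠ q : ℝ × ℝ in nhds p, 0 < q.1 ∧ 0 < q.2 :=
    (continuousAt_fst.eventually_const_lt h₁).and (continuousAt_snd.eventually_const_lt h₂)
  have hZ := isingZ_pos G h₁ h₂.le
  have hV : 0 < (Fintype.card V : ℝ) := by exact_mod_cast Fintype.card_pos
  have h : ContinuousAt (fun q : ℝ × ℝ =>
      isingMoment G q.1 q.2 / (Fintype.card V * isingZ G q.1 q.2)) p :=
    (continuous_isingMoment G).continuousAt.div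
      (continuousAt_const.mul (continuous_isingZ G).continuousAt) (by positivity)
  refine h.congr (hpos.mono fun q hq => ?_)
  exact (occupancyFraction_eq_div G hq.1 hq.2).symm

/-- A property of all parameters near a point of the open parameter square
holds on a region around it. -/
theorem exists_region_of_eventually {P : ℝ × ℝ → Prop} {p : ℝ × ℝ}
    (hp : p ∈ interior parameterSquare) (hP : ∀ᶠ q in nhds p, P q) :
    ∃ R, IsParameterRegion R ∧ ∀ q ∈ R, P q := by
  obtain ⟨ε, hε, h⟩ := Metric.eventually_nhds_iff_ball.1
    (hP.and (mem_interior_iff_mem_nhds.1 hp))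
  exact ⟨Metric.ball p ε, ⟨fun q hq => (h q hq).2, Metric.isOpen_ball,
    (convex_ball p ε).isConnected (Metric.nonempty_ball.2 hε)⟩, fun q hq => (h q hq).1⟩

theorem mem_interior_parameterSquare :
    ((6 / 25, 3 / 5) : ℝ × ℝ) ∈ interior parameterSquare := by
  rw [parameterSquare, interior_prod_eq, interior_Icc]
  constructor <;> constructor <;> norm_num

theorem eventually_occupancyFraction_lt {V W : Type*} [Fintype V] [DecidableEq V] [Nonempty V]
    [Fintype W] [DecidableEq W] [Nonempty W] (G : SimpleGraph V) [DecidableRel G.Adj]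
    (H : SimpleGraph W) [DecidableRel H.Adj] {p : ℝ × ℝ} (h₁ : 0 < p.1) (h₂ : 0 < p.2)
    (h : occupancyFraction G p.1 p.2 < occupancyFraction H p.1 p.2) :
    ∀ᶠ q : ℝ × ℝ in nhds p, occupancyFraction G q.1 q.2 < occupancyFraction H q.1 q.2 :=
  (continuousAt_occupancyFraction G h₁ h₂).eventually_lt (continuousAt_occupancyFraction H h₁ h₂) h

end ParameterRegions

/-! ### Assembly of the theorem -/

theorem theorem1p3 :
    -- `K₄` minimizes the occupancy fraction on the union of the eight regions
    (∀ B lam : ℝ, (B, lam) ∈ minRegion →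
      MinimizesOccupancyFraction.{u, 0} graphK4 B lam) ∧
    -- the union is downward closed in the external field
    (∀ B lam l : ℝ, (B, lam) ∈ minRegion → 0 ≤ l → l ≤ lam → (B, l) ∈ minRegion) ∧
    -- `K₄` minimizes the free energy density there too
    (∀ B lam : ℝ, (B, lam) ∈ minRegion →
      MinimizesFreeEnergyDensity.{u, 0} graphK4 B lam) ∧
    -- `K₄` is not the minimizer on all of `[0,1]²`
    (¬ ∀ B lam : ℝ, (B, lam) ∈ parameterSquare →
      MinimizesOccupancyFraction.{0, 0} graphK4 B lam) ∧
    -- in some region the Petersen graph has smaller occupancy fraction than `K₄`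
    (petersenGraph.IsRegularOfDegree 3 ∧
      ∃ RPet : Set (ℝ × ℝ), IsParameterRegion RPet ∧ ∀ B lam : ℝ, (B, lam) ∈ RPet →
        occupancyFraction petersenGraph B lam < occupancyFraction graphK4 B lam) ∧
    -- the minimizer is not always one of `K₄` and the Petersen graph
    (¬ ∀ B lam : ℝ, (B, lam) ∈ parameterSquare →
      MinimizesOccupancyFraction.{0, 0} graphK4 B lam ∨
        MinimizesOccupancyFraction.{0, 0} petersenGraph B lam) ∧
    -- in some region the Goose graph has smaller occupancy fraction than both
    (gooseGraph.IsRegularOfDegree 3 ∧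
      ∃ RGoose : Set (ℝ × ℝ), IsParameterRegion RGoose ∧ ∀ B lam : ℝ, (B, lam) ∈ RGoose →
        occupancyFraction gooseGraph B lam < occupancyFraction graphK4 B lam ∧
        occupancyFraction gooseGraph B lam < occupancyFraction petersenGraph B lam) := by
  have hPK := occupancyFraction_petersenGraph_lt.trans lt_occupancyFraction_graphK4
  have hGP := occupancyFraction_gooseGraph_lt.trans lt_occupancyFraction_petersenGraph
  have hmem := interior_subset mem_interior_parameterSquare
  refine ⟨fun B lam h => ⟨graphK4_isRegularOfDegree, fun V _ _ _ G _ hG =>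
      occupancyFraction_graphK4_le hG h⟩,
    fun B lam l h hl hle => minRegion_downward_closed h hl hle,
    fun B lam h => ⟨graphK4_isRegularOfDegree, fun V _ _ _ G _ hG =>
      freeEnergyDensity_graphK4_le hG h⟩,
    fun h => ?_, ⟨petersenGraph_isRegularOfDegree, ?_⟩, fun h => ?_,
    ⟨gooseGraph_isRegularOfDegree, ?_⟩⟩
  · exact hPK.not_ge ((h _ _ hmem).2 _ petersenGraph petersenGraph_isRegularOfDegree)
  · obtain ⟨R, hR, h⟩ := exists_region_of_eventually mem_interior_parameterSquare
      (eventually_occupancyFraction_lt petersenGraph graphK4 (by norm_num) (by norm_num) hPK)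
    exact ⟨R, hR, fun B lam hq => h _ hq⟩
  -- At `(6/25, 3/5)` the Petersen graph beats `K₄`, and the Goose graph beats the Petersen graph.
  · rcases h _ _ hmem with h | h
    · exact hPK.not_ge (h.2 _ petersenGraph petersenGraph_isRegularOfDegree)
    · exact hGP.not_ge (h.2 _ gooseGraph gooseGraph_isRegularOfDegree)
  · obtain ⟨R, hR, h⟩ := exists_region_of_eventually mem_interior_parameterSquare
      ((eventually_occupancyFraction_lt gooseGraph graphK4 (by norm_num) (by norm_num)
        (hGP.trans hPK)).and (eventually_occupancyFraction_lt gooseGraph petersenGraph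
          (by norm_num) (by norm_num) hGP))
    exact ⟨R, hR, fun B lam hq => h _ hq⟩
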